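/- Let $\Omega\subset\mathbb R^2$ be a bounded domain with $C^\infty$ boundary, and let $D$ be a bounded domain with $\overline D\subset\Omega$ whose boundary $\partial D$ is a single smooth simple closed curve, with arclength parameter $s$ and tangential derivative $\partial_s$. Let $$\mathcal H=\{u\in H^1(\Omega;\mathbb R) : u|_{\partial D}\in H^2(\partial D)\}.$$ For positive constants $\mu,\mu_s,\ell$ and $f\in H^{1/2}(\partial\Omega)$, let $u\in\mathcal H$ be the weak solution of $$-\Delta u=0 \text{ in }\Omega\setminus \overline D,\qquad -\mu\Delta u=0\text{ in } D,\qquad \partial_\nu u^+-\mu\,\partial_\nu u^-=\partial_s^2(\mu_s\ell^2\partial_s^2u)-\partial_s(\mu_s\partial_s u)\text{ on }\partial D,\qquad u=f\text{ on }\partial\Omega,$$ where $\nu$ is the outward unit normal and $u^+$, $u^-$ denote the limits on $\partial D$ from $\Omega\setminus\overline D$ and from $D$; that is, $u\in\mathcal H$, $u|_{\partial\Omega}=f$ and $$\int_{\Omega\setminus D}\nabla u\cdot\nabla\varphi\,dx+\int_D\mu\nabla u\cdot\nabla\varphi\,dx+\int_{\partial D}\mu_s\,\partial_su\,\partial_s\varphi\,ds+\int_{\partial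 D}\mu_s\ell^2\,\partial_s^2u\,\partial_s^2\varphi\,ds=0\qquad\text{for all }\varphi\in\mathcal H\cap H^1_0(\Omega).$$ Let $\Lambda=\Lambda_{\mu,\mu_s,\ell}:H^{1/2}(\partial\Omega)\to H^{-1/2}(\partial\Omega)$, $\Lambda f=\partial_\nu u|_{\partial\Omega}$, be the associated Dirichlet-to-Neumann map, with $\partial_\nu u|_{\partial\Omega}$ understood weakly, through Green's identity. Then, for fixed $\Omega$ and $D$, the map $$(0,\infty)^3\ni(\mu,\mu_s,\ell)\longmapsto\Lambda_{\mu,\mu_s,\ell}$$ is injective: if $\Lambda_{\mu^{(1)},\mu_s^{(1)},\ell^{(1)}}=\Lambda_{\mu^{(2)},\mu_s^{(2)},\ell^{(2)}}$, then $\mu^{(1)}=\mu^{(2)}$, $\mu_s^{(1)}=\mu_s^{(2)}$ and $\ell^{(1)}=\ell^{(2)}$. -/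

import Mathlib

namespace AntiplaneShear

open MeasureTheory Filter Topology Set
open scoped ContDiff

/-- The Euclidean plane. -/
abbrev Plane : Type := EuclideanSpace ℝ (Fin 2)

/-- A bounded domain (nonempty, open, connected) with `C^∞` boundary: near each of its boundary
points it is the sublevel set of a smooth function with nonvanishing differential. -/
structure IsSmoothDomain (U : Set Plane) : Prop where
  isOpen : IsOpen U
  isConnected : IsConnected U
  isBounded : Bornology.IsBounded U
  smooth_boundary : ∀ x ∈ frontier U, ∃ V : Set Plane, IsOpen V ∧ x ∈ V ∧
    ∃ ρ : Plane → ℝ, ContDiff ℝ ∞ ρ ∧ fderiv ℝ ρ x ≠ 0 ∧ U ∩ V = {y ∈ V | ρ y < 0}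

/-- `γ` is a smooth arclength parametrization, of period (total length) `L`, of a simple closed
curve with image `Γ`. -/
structure IsArclengthParam (Γ : Set Plane) (L : ℝ) (γ : ℝ → Plane) : Prop where
  length_pos : 0 < L
  smooth : ContDiff ℝ ∞ γ
  periodic : Function.Periodic γ L
  unit_speed : ∀ s, ‖deriv γ s‖ = 1
  injOn : InjOn γ (Ico 0 L)
  range_eq : range γ = Γ

/-! ### The spaces `H¹(Ω)`, `H¹₀(Ω)`, `H^{1/2}(∂Ω)`, `H^{-1/2}(∂Ω)` -/

/-- Smooth functions with compact support in `Ω`. -/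
structure IsTestFunction (Ω : Set Plane) (φ : Plane → ℝ) : Prop where
  smooth : ContDiff ℝ ∞ φ
  compact : HasCompactSupport φ
  supp : tsupport φ ⊆ Ω

/-- `G` is the weak gradient of `u` in `Ω`. -/
def IsWeakGrad (Ω : Set Plane) (u : Lp ℝ 2 (volume.restrict Ω))
    (G : Lp Plane 2 (volume.restrict Ω)) : Prop :=
  ∀ φ : Plane → ℝ, IsTestFunction Ω φ → ∀ v : Plane,
    ∫ x in Ω, u x * fderiv ℝ φ x v = - ∫ x in Ω, inner ℝ (G x) v * φ x

theorem IsTestFunction.memLp {Ω : Set Plane} {φ : Plane → ℝ} (h : IsTestFunction Ω φ) :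
    MemLp φ 2 (volume.restrict Ω) :=
  (h.smooth.continuous.memLp_of_hasCompactSupport h.compact).restrict Ω

theorem IsTestFunction.memLp_fderiv {Ω : Set Plane} {φ : Plane → ℝ} (h : IsTestFunction Ω φ)
    (v : Plane) : MemLp (fun x => fderiv ℝ φ x v) 2 (volume.restrict Ω) := by
  have hc : Continuous (fun x => fderiv ℝ φ x v) :=
    (h.smooth.continuous_fderiv (by simp)).clm_apply continuous_const
  have hs : HasCompactSupport (fun x => fderiv ℝ φ x v) :=
    (h.compact.fderiv (𝕜 := ℝ)).comp_left (g := fun T : Plane →L[ℝ] ℝ => T v) (by simp)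
  exact (hc.memLp_of_hasCompactSupport hs).restrict Ω

theorem integrable_left {Ω : Set Plane} {φ : Plane → ℝ} (h : IsTestFunction Ω φ)
    (u : Lp ℝ 2 (volume.restrict Ω)) (v : Plane) :
    Integrable (fun x => u x * fderiv ℝ φ x v) (volume.restrict Ω) :=
  (Lp.memLp u).integrable_mul (h.memLp_fderiv v)

theorem integrable_right {Ω : Set Plane} {φ : Plane → ℝ} (h : IsTestFunction Ω φ)
    (G : Lp Plane 2 (volume.restrict Ω)) (v : Plane) :
    Integrable (fun x => inner ℝ (G x) v * φ x) (volume.restrict Ω) :=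
  ((Lp.memLp G).inner_const v).integrable_mul h.memLp

/-- The Sobolev space `H¹(Ω)`: pairs of an `L²` function and its `L²` weak gradient, with the
norm `(‖u‖² + ‖∇u‖²)^{1/2}`. -/
noncomputable def H1 (Ω : Set Plane) : Submodule ℝ
    (WithLp 2 (Lp ℝ 2 (volume.restrict Ω) × Lp Plane 2 (volume.restrict Ω))) where
  carrier := {p | IsWeakGrad Ω p.fst p.snd}
  zero_mem' := by
    intro φ hφ v
    have h1 : ∫ x in Ω, (0 : Lp ℝ 2 (volume.restrict Ω)) x * fderiv ℝ φ x v = 0 := by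
      rw [← integral_zero Plane ℝ (μ := volume.restrict Ω)]
      refine integral_congr_ae ?_
      filter_upwards [Lp.coeFn_zero ℝ 2 (volume.restrict Ω)] with x hx
      rw [hx]
      simp
    have h2 : ∫ x in Ω, inner ℝ ((0 : Lp Plane 2 (volume.restrict Ω)) x) v * φ x = 0 := by
      rw [← integral_zero Plane ℝ (μ := volume.restrict Ω)]
      refine integral_congr_ae ?_
      filter_upwards [Lp.coeFn_zero Plane 2 (volume.restrict Ω)] with x hx
      rw [hx]
      simp
    rw [WithLp.zero_fst, WithLp.zero_snd, h1, h2, neg_zero]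
  add_mem' := by
    intro p q hp hq φ hφ v
    have h1 : ∫ x in Ω, (p.fst + q.fst) x * fderiv ℝ φ x v
        = ∫ x in Ω, p.fst x * fderiv ℝ φ x v + q.fst x * fderiv ℝ φ x v := by
      refine integral_congr_ae ?_
      filter_upwards [Lp.coeFn_add p.fst q.fst] with x hx
      simp only [hx, Pi.add_apply, add_mul]
    have h2 : ∫ x in Ω, inner ℝ ((p.snd + q.snd) x) v * φ x
        = ∫ x in Ω, inner ℝ (p.snd x) v * φ x + inner ℝ (q.snd x) v * φ x := by
      refine integral_congr_ae ?_
      filter_upwards [Lp.coeFn_add p.snd q.snd] with x hx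
      simp only [hx, Pi.add_apply, inner_add_left, add_mul]
    rw [WithLp.add_fst, WithLp.add_snd, h1, h2,
      integral_add (integrable_left hφ _ v) (integrable_left hφ _ v),
      integral_add (integrable_right hφ _ v) (integrable_right hφ _ v), hp φ hφ v, hq φ hφ v]
    ring
  smul_mem' := by
    intro c p hp φ hφ v
    have h1 : ∫ x in Ω, (c • p.fst) x * fderiv ℝ φ x v
        = ∫ x in Ω, c * (p.fst x * fderiv ℝ φ x v) := by
      refine integral_congr_ae ?_
      filter_upwards [Lp.coeFn_smul c p.fst] with x hx
      simp only [hx, Pi.smul_apply, smul_eq_mul, mul_assoc]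
    have h2 : ∫ x in Ω, inner ℝ ((c • p.snd) x) v * φ x
        = ∫ x in Ω, c * (inner ℝ (p.snd x) v * φ x) := by
      refine integral_congr_ae ?_
      filter_upwards [Lp.coeFn_smul c p.snd] with x hx
      simp only [hx, Pi.smul_apply, real_inner_smul_left, mul_assoc]
    rw [WithLp.smul_fst, WithLp.smul_snd, h1, h2, integral_const_mul, integral_const_mul,
      hp φ hφ v]
    ring

/-- The underlying `L²` function of an element of `H¹(Ω)`. -/
noncomputable def fn {Ω : Set Plane} (u : H1 Ω) : Lp ℝ 2 (volume.restrict Ω) := u.1.fst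

/-- The weak gradient of an element of `H¹(Ω)`. -/
noncomputable def grad {Ω : Set Plane} (u : H1 Ω) : Lp Plane 2 (volume.restrict Ω) := u.1.snd

/-- `H¹₀(Ω)`, the closure of the test functions in `H¹(Ω)`. -/
noncomputable def H10 (Ω : Set Plane) : Submodule ℝ (H1 Ω) :=
  (Submodule.span ℝ
    {w : H1 Ω | ∃ φ, IsTestFunction Ω φ ∧ fn w =ᵐ[volume.restrict Ω] φ}).topologicalClosure

/-- The trace space `H^{1/2}(∂Ω) = H¹(Ω) / H¹₀(Ω)`, with the quotient norm. -/
abbrev HalfTrace (Ω : Set Plane) : Type := H1 Ω ⧸ H10 Ω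

/-- The trace `u|_{∂Ω} ∈ H^{1/2}(∂Ω)` of `u ∈ H¹(Ω)`. -/
noncomputable def outerTrace {Ω : Set Plane} (u : H1 Ω) : HalfTrace Ω := (H10 Ω).mkQ u

/-- `H^{-1/2}(∂Ω)`, the topological dual of `H^{1/2}(∂Ω)`. -/
abbrev NegHalf (Ω : Set Plane) : Type := StrongDual ℝ (HalfTrace Ω)

/-! ### The space `H²(∂D)` and traces on `∂D`, in the arclength parameter -/

/-- `L²` of a closed curve of length `L`, in the arclength parameter. -/
abbrev L2Curve (L : ℝ) : Type := Lp ℝ 2 (volume.restrict (Ioc 0 L))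

/-- `g' = ∂_s g` weakly on the closed curve of length `L` (smooth periodic test functions). -/
def IsWeakDerivCurve (L : ℝ) (g g' : L2Curve L) : Prop :=
  ∀ η : ℝ → ℝ, ContDiff ℝ ∞ η → Function.Periodic η L →
    ∫ s in Ioc 0 L, g s * deriv η s = - ∫ s in Ioc 0 L, g' s * η s

/-- `g` is the trace of `u ∈ H¹(Ω)` on the closed curve `γ` inside `Ω`: the limit in `L²` of the
restrictions to `γ` of smooth functions on `Ω` converging to `u` in `H¹(Ω)`. -/
def IsCurveTrace {Ω : Set Plane} (L : ℝ) (γ : ℝ → Plane) (u : H1 Ω) (g : L2Curve L) : Prop :=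
  ∃ (w : ℕ → H1 Ω) (φ : ℕ → Plane → ℝ),
    (∀ n, ContDiffOn ℝ ∞ (φ n) Ω ∧ fn (w n) =ᵐ[volume.restrict Ω] φ n) ∧
    Tendsto w atTop (𝓝 u) ∧
    Tendsto (fun n => eLpNorm (fun s => φ n (γ s) - g s) 2 (volume.restrict (Ioc 0 L)))
      atTop (𝓝 0)

/-- `u` belongs to `ℋ = {u ∈ H¹(Ω) : u|_{∂D} ∈ H²(∂D)}`, with `∂_s u = g₁` and `∂_s² u = g₂`
on `∂D`. -/
def HasH2Trace {Ω : Set Plane} (L : ℝ) (γ : ℝ → Plane) (u : H1 Ω) (g₁ g₂ : L2Curve L) : Prop :=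
  ∃ g : L2Curve L, IsCurveTrace L γ u g ∧ IsWeakDerivCurve L g g₁ ∧ IsWeakDerivCurve L g₁ g₂

/-! ### The boundary value problem and its Dirichlet-to-Neumann map -/

/-- `u ∈ ℋ` is the weak solution of
`-Δu = 0` in `Ω \ D`, `-μ Δu = 0` in `D`,
`∂_ν u⁺ - μ ∂_ν u⁻ = ∂_s²(μ_s ℓ² ∂_s² u) - ∂_s(μ_s ∂_s u)` on `∂D`, `u = f` on `∂Ω`;
the test functions range over `ℋ ∩ H¹₀(Ω)`. -/
def IsWeakSolution {Ω : Set Plane} (D : Set Plane) (L : ℝ) (γ : ℝ → Plane) (μ μs ℓ : ℝ)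
    (f : HalfTrace Ω) (u : H1 Ω) : Prop :=
  outerTrace u = f ∧
  ∃ u₁ u₂ : L2Curve L, HasH2Trace L γ u u₁ u₂ ∧
    ∀ φ ∈ H10 Ω, ∀ φ₁ φ₂ : L2Curve L, HasH2Trace L γ φ φ₁ φ₂ →
      (∫ x in Ω \ D, inner ℝ (grad u x) (grad φ x))
        + (∫ x in D, μ * inner ℝ (grad u x) (grad φ x))
        + (∫ s in Ioc 0 L, μs * (u₁ s * φ₁ s))
        + (∫ s in Ioc 0 L, μs * ℓ ^ 2 * (u₂ s * φ₂ s)) = 0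

/-- `ξ ∈ H^{-1/2}(∂Ω)` is the weak outward normal derivative `∂_ν u|_{∂Ω}` of a function `u`
harmonic in `Ω \ closure D`: Green's identity against all `φ ∈ H¹(Ω)` that vanish in a
neighbourhood of `closure D` (every class in `H^{1/2}(∂Ω)` has such a representative when
`closure D ⊆ Ω` is compact). -/
def IsNormalDeriv {Ω : Set Plane} (D : Set Plane) (u : H1 Ω) (ξ : NegHalf Ω) : Prop :=
  ∀ φ : H1 Ω,
    (∃ V : Set Plane, IsOpen V ∧ closure D ⊆ V ∧
      ∀ᵐ x ∂(volume.restrict Ω), x ∈ V → fn φ x = 0) →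
    ξ (outerTrace φ) = ∫ x in Ω \ D, inner ℝ (grad u x) (grad φ x)

/-- `ξ = ∂_ν u|_{∂Ω}` for a solution `u ∈ ℋ` of the boundary value problem with data `f`. -/
def IsDtNValue {Ω : Set Plane} (D : Set Plane) (L : ℝ) (γ : ℝ → Plane) (μ μs ℓ : ℝ)
    (f : HalfTrace Ω) (ξ : NegHalf Ω) : Prop :=
  ∃ u : H1 Ω, IsWeakSolution D L γ μ μs ℓ f u ∧ IsNormalDeriv D u ξ

open Classical in
/-- The Dirichlet-to-Neumann map `Λ : H^{1/2}(∂Ω) → H^{-1/2}(∂Ω)`, `f ↦ ∂_ν u|_{∂Ω}`. The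
boundary value problem is well-posed for positive parameters, so the value is the unique `ξ` with
`IsDtNValue`; the value `0` is only a default where there is none. -/
noncomputable def dtn (Ω D : Set Plane) (L : ℝ) (γ : ℝ → Plane) (μ μs ℓ : ℝ) :
    HalfTrace Ω → NegHalf Ω :=
  fun f => if h : ∃ ξ, IsDtNValue D L γ μ μs ℓ f ξ then h.choose else 0

end AntiplaneShear

namespace AntiplaneShear

open MeasureTheory Filter Topology Set Metric InnerProductSpace
open scoped ContDiff ENNReal NNReal Laplacian Gradient Convolution

/-!
Let `u` and `u'` solve the two problems with the same boundary values. If the Dirichlet-to-Neumann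
maps agree, `u - u'` has vanishing Cauchy data on `∂Ω`; the exterior `Ω \ D̄` is connected, so
unique continuation gives `u = u'` there. Comparing the two weak formulations by duality, the two
energies agree at every test function which is harmonic in `D`. Hence a harmonic `φ` satisfies
`(μ - μ') ∫_D |∇φ|² + (μₛ - μₛ') ∫_∂D |∂ₛφ|² + (μₛ ℓ² - μₛ' ℓ'²) ∫_∂D |∂ₛ²φ|² = 0`.
Summed over `φ = Re exp (l z)` and `φ = - Im exp (l z)`, the three integrals have different orders
as `l → ∞`: relative to `l² ∫_∂D exp (2 l x₀)` the first tends to zero, because `x₀` attains its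
maximum over `D̄` at a critical point of its restriction to `∂D`, the second is constant, and the
third tends to infinity. So the three coefficients vanish.
-/

/-! ### The Laplacian -/

section Laplacian

variable {E E' F : Type*} [NormedAddCommGroup E] [InnerProductSpace ℝ E] [FiniteDimensional ℝ E]
  [NormedAddCommGroup E'] [InnerProductSpace ℝ E'] [FiniteDimensional ℝ E']
  [NormedAddCommGroup F] [NormedSpace ℝ F]

theorem laplacian_eq_sum_fderiv_fderiv {ι : Type*} [Fintype ι] (b : OrthonormalBasis ι ℝ E)
    {f : E → F} (hf : ContDiff ℝ 2 f) (x : E) :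
    Δ f x = ∑ i, fderiv ℝ (fun y ↦ fderiv ℝ f y (b i)) x (b i) := by
  have hd : DifferentiableAt ℝ (fderiv ℝ f) x :=
    (hf.fderiv_right (m := 1) (by norm_num)).differentiable one_ne_zero x
  rw [laplacian_eq_iteratedFDeriv_orthonormalBasis f b]
  refine Finset.sum_congr rfl fun i _ ↦ ?_
  rw [iteratedFDeriv_two_apply, fderiv_clm_apply hd (differentiableAt_const _)]
  simp

theorem laplacian_comp_linearIsometryEquiv (J : E ≃ₗᵢ[ℝ] E') (f : E' → F) (x : E) :
    Δ (fun y ↦ f (J y)) x = Δ f (J x) := by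
  have hcomp := J.toContinuousLinearEquiv.iteratedFDerivWithin_comp_right f uniqueDiffOn_univ
    (x := x) (mem_univ _) 2
  simp only [preimage_univ, iteratedFDerivWithin_univ] at hcomp
  rw [laplacian_eq_iteratedFDeriv_orthonormalBasis _ (stdOrthonormalBasis ℝ E),
    laplacian_eq_iteratedFDeriv_orthonormalBasis _ ((stdOrthonormalBasis ℝ E).map J)]
  refine Finset.sum_congr rfl fun i _ ↦ (DFunLike.congr_fun hcomp _).trans ?_
  rw [ContinuousMultilinearMap.compContinuousLinearMap_apply]
  congr 1
  ext k
  fin_cases k <;> simp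

theorem laplacian_comp_const_sub (f : E → F) (a x : E) :
    Δ (fun y ↦ f (a - y)) x = Δ f (a - x) := by
  have htrans (z : E) : Δ (fun y ↦ f (a + y)) z = Δ f (a + z) := by
    simp only [laplacian_eq_iteratedFDeriv_stdOrthonormalBasis, iteratedFDeriv_comp_add_left]
  simpa [sub_eq_add_neg, htrans] using
    laplacian_comp_linearIsometryEquiv (LinearIsometryEquiv.neg ℝ) (fun y ↦ f (a + y)) x

theorem laplacian_comp_smul {f : E → F} (hf : ContDiff ℝ 2 f) (c : ℝ) (x : E) :
    Δ (fun y ↦ f (c • y)) x = c ^ 2 • Δ f (c • x) := by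
  simp only [laplacian_eq_iteratedFDeriv_stdOrthonormalBasis, iteratedFDeriv_comp_const_smul c hf,
    Finset.smul_sum]
  rfl

theorem laplacian_comp_norm_sq {f : ℝ → ℝ} (hf : ContDiff ℝ 2 f) (x : E) :
    Δ (fun y : E ↦ f (‖y‖ ^ 2)) x = 4 * ‖x‖ ^ 2 * deriv (deriv f) (‖x‖ ^ 2)
      + 2 * Module.finrank ℝ E * deriv f (‖x‖ ^ 2) := by
  have hdf : Differentiable ℝ (deriv f) := hf.differentiable_deriv_two
  have hnorm (y : E) : HasFDerivAt (fun z : E ↦ ‖z‖ ^ 2) (2 • innerSL ℝ y) y :=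
    (hasStrictFDerivAt_norm_sq y).hasFDerivAt
  have hfst (y v : E) :
      fderiv ℝ (fun z : E ↦ f (‖z‖ ^ 2)) y v = deriv f (‖y‖ ^ 2) * (2 * inner ℝ y v) := by
    have h := (hf.differentiable two_ne_zero _).hasDerivAt.comp_hasFDerivAt y (hnorm y)
    simp [HasFDerivAt.fderiv (f := fun z : E ↦ f (‖z‖ ^ 2)) h]
  have hsnd (v : E) : fderiv ℝ (fun y : E ↦ deriv f (‖y‖ ^ 2) * (2 * inner ℝ y v)) x v
      = 4 * deriv (deriv f) (‖x‖ ^ 2) * inner ℝ x v ^ 2 + 2 * deriv f (‖x‖ ^ 2) * ‖v‖ ^ 2 := by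
    have hinner : HasFDerivAt (fun y : E ↦ 2 * inner ℝ y v) ((2 : ℝ) • innerSL ℝ v) x := by
      simp only [← real_inner_comm]
      exact (innerSL ℝ v).hasFDerivAt.const_mul 2
    have h := ((hdf _).hasDerivAt.comp_hasFDerivAt x (hnorm x)).mul hinner
    simp only [HasFDerivAt.fderiv (f := fun y : E ↦ deriv f (‖y‖ ^ 2) * (2 * inner ℝ y v)) h]
    simp [real_inner_comm v x]
    ring
  have hparseval := (stdOrthonormalBasis ℝ E).sum_sq_norm_inner_left x
  simp only [Real.norm_eq_abs, sq_abs] at hparseval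
  rw [laplacian_eq_sum_fderiv_fderiv (f := fun y : E ↦ f (‖y‖ ^ 2)) (stdOrthonormalBasis ℝ E)
    (hf.comp (contDiff_norm_sq ℝ))]
  simp only [hfst, hsnd, Finset.sum_add_distrib, ← Finset.mul_sum, hparseval,
    OrthonormalBasis.norm_eq_one, one_pow, Finset.sum_const, Finset.card_univ, Fintype.card_fin,
    nsmul_eq_mul, mul_one]
  ring

variable [MeasurableSpace E] [BorelSpace E]

theorem fderiv_convolution_right {u : E → ℝ} {g : E → F} (hu : LocallyIntegrable u)
    (hg : ContDiff ℝ 1 g) (hc : HasCompactSupport g) (x v : E) :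
    fderiv ℝ (u ⋆ g) x v = (u ⋆ fun y ↦ fderiv ℝ g y v) x := by
  rw [(hc.hasFDerivAt_convolution_right _ hu hg x).fderiv,
    convolution_precompR_apply _ hu (hc.fderiv ℝ) (hg.continuous_fderiv one_ne_zero)]

theorem laplacian_convolution_right {u : E → ℝ} {g : E → F} (hu : LocallyIntegrable u)
    (hg : ContDiff ℝ 2 g) (hc : HasCompactSupport g) (x : E) :
    Δ (u ⋆ g) x = (u ⋆ Δ g) x := by
  let b := stdOrthonormalBasis ℝ E
  have hg₁ (v : E) : ContDiff ℝ 1 fun y ↦ fderiv ℝ g y v :=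
    (hg.fderiv_right (by norm_num)).clm_apply contDiff_const
  have hc₁ {f : E → F} (hf : HasCompactSupport f) (v : E) :
      HasCompactSupport fun y ↦ fderiv ℝ f y v := hf.fderiv_apply (𝕜 := ℝ) v
  have hexists (i) : ConvolutionExistsAt u
      (fun y ↦ fderiv ℝ (fun z ↦ fderiv ℝ g z (b i)) y (b i)) x (.lsmul ℝ ℝ) :=
    (hc₁ (hc₁ hc _) _).convolutionExists_right _ hu
      (((hg₁ _).continuous_fderiv one_ne_zero).clm_apply continuous_const) x
  rw [laplacian_eq_sum_fderiv_fderiv b (hc.contDiff_convolution_right _ hu hg)]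
  simp only [fderiv_convolution_right hu (hg.of_le one_le_two) hc,
    fderiv_convolution_right hu (hg₁ _) (hc₁ hc _)]
  simp only [convolution, laplacian_eq_sum_fderiv_fderiv b hg, map_sum]
  exact (integral_finsetSum _ fun i _ ↦ hexists i).symm

end Laplacian

/-! ### Weyl's lemma in the plane -/

theorem ae_tendsto_convolution_dilation {E : Type*} [NormedAddCommGroup E] [InnerProductSpace ℝ E]
    [FiniteDimensional ℝ E] [MeasurableSpace E] [BorelSpace E] {u g : E → ℝ}
    (hu : LocallyIntegrable u) (hg : Continuous g) (hs : Function.support g ⊆ closedBall 0 1)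
    (hint : ∫ x, g x = 1) :
    ∀ᵐ x, Tendsto
      (fun ε : ℝ ↦ (u ⋆ fun y ↦ (ε ^ Module.finrank ℝ E)⁻¹ * g (ε⁻¹ • y)) x)
      (𝓝[>] 0) (𝓝 (u x)) := by
  obtain ⟨C, hC⟩ := hg.bounded_above_of_compact_support
    (HasCompactSupport.of_support_subset_isCompact (isCompact_closedBall 0 1) hs)
  set V : ℝ := volume.real (closedBall (0 : E) 1)
  have hV : 0 < V := ENNReal.toReal_pos (measure_closedBall_pos _ _ one_pos).ne'
    measure_closedBall_lt_top.ne
  filter_upwards [(Besicovitch.vitaliFamily volume).ae_tendsto_average_norm_sub hu] with x hx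
  simp only [convolution_def, ContinuousLinearMap.lsmul_apply, smul_eq_mul, mul_comm (u _)]
  refine tendsto_integral_smul_of_tendsto_average_norm_sub (C * V)
    (hx.comp (Besicovitch.tendsto_filterAt volume x))
    (.of_forall fun ε ↦ hu.integrableOn_isCompact (isCompact_closedBall _ _)) ?_ ?_ ?_
  · refine tendsto_const_nhds.congr' ?_
    filter_upwards [self_mem_nhdsWithin] with ε (hε : 0 < ε)
    rw [integral_sub_left_eq_self (fun y ↦ (ε ^ Module.finrank ℝ E)⁻¹ * g (ε⁻¹ • y)),
      integral_const_mul, Measure.integral_comp_inv_smul_of_nonneg volume g hε.le, hint,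
      smul_eq_mul, mul_one, inv_mul_cancel₀ (by positivity)]
  · filter_upwards [self_mem_nhdsWithin] with ε (hε : 0 < ε) y hy
    have := hs (right_ne_zero_of_mul hy)
    rwa [mem_closedBall_zero_iff, norm_smul, norm_inv, Real.norm_of_nonneg hε.le,
      inv_mul_le_one₀ hε, ← dist_eq_norm, dist_comm] at this
  · filter_upwards [self_mem_nhdsWithin] with ε (hε : 0 < ε) y
    rw [Measure.addHaar_real_closedBall' volume x hε.le, abs_mul,
      abs_of_pos (by positivity : 0 < (ε ^ Module.finrank ℝ E)⁻¹),
      mul_div_mul_right _ _ hV.ne', div_eq_inv_mul]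
    gcongr
    exact hC _

/-- A smooth monotone step, equal to `0` on `(-∞, 1/2]` and to `1` on `[1, ∞)`. -/
noncomputable def cutoff (t : ℝ) : ℝ := Real.smoothTransition (2 * t - 1)

theorem contDiff_cutoff : ContDiff ℝ ∞ cutoff :=
  Real.smoothTransition.contDiff.comp ((contDiff_const.mul contDiff_id).sub contDiff_const)

theorem cutoff_eq_zero {t : ℝ} (h : t ≤ 1 / 2) : cutoff t = 0 :=
  Real.smoothTransition.zero_of_nonpos (by linarith)

theorem cutoff_eq_one {t : ℝ} (h : 1 ≤ t) : cutoff t = 1 :=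
  Real.smoothTransition.one_of_one_le (by linarith)

theorem monotone_cutoff : Monotone cutoff := fun a b h ↦
  Real.smoothTransition.monotone (by linarith)

theorem contDiff_cutoff_div : ContDiff ℝ ∞ fun t ↦ cutoff t / t := by
  refine contDiff_iff_contDiffAt.2 fun t ↦ ?_
  obtain rfl | ht := eq_or_ne t 0
  · have hzero : (fun t ↦ cutoff t / t) =ᶠ[𝓝 0] fun _ ↦ 0 := by
      filter_upwards [Iio_mem_nhds (one_half_pos (α := ℝ))] with s hs
      rw [cutoff_eq_zero (le_of_lt hs), zero_div]
    exact contDiffAt_const.congr_of_eventuallyEq hzero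
  · exact contDiff_cutoff.contDiffAt.div contDiffAt_id ht

/-- A smooth function on the line that agrees with `Real.log` on `[1, ∞)`. -/
noncomputable def smoothLog (q : ℝ) : ℝ := ∫ t in (1 : ℝ)..q, cutoff t / t

theorem deriv_smoothLog : deriv smoothLog = fun q ↦ cutoff q / q :=
  funext (contDiff_cutoff_div.continuous.deriv_integral _ 1)

theorem contDiff_smoothLog : ContDiff ℝ ∞ smoothLog :=
  contDiff_infty_iff_deriv.2 ⟨fun _ ↦ (intervalIntegral.integral_hasDerivAt_right
    (contDiff_cutoff_div.continuous.intervalIntegrable _ _)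
    (contDiff_cutoff_div.continuous.stronglyMeasurableAtFilter _ _)
    contDiff_cutoff_div.continuous.continuousAt).differentiableAt,
    deriv_smoothLog ▸ contDiff_cutoff_div⟩

theorem smoothLog_eq_log {q : ℝ} (hq : 1 ≤ q) : smoothLog q = Real.log q := by
  have hint : smoothLog q = ∫ t in (1 : ℝ)..q, 1 / t :=
    intervalIntegral.integral_congr fun t ht ↦ by
      simp only [cutoff_eq_one (uIcc_of_le hq ▸ ht).1]
  rw [hint, integral_one_div_of_pos one_pos (by linarith), div_one]

theorem mul_deriv_deriv_smoothLog_add (q : ℝ) :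
    q * deriv (deriv smoothLog) q + deriv smoothLog q = deriv cutoff q := by
  have hmul : cutoff = fun q ↦ q * (cutoff q / q) := by
    funext q
    obtain rfl | hq := eq_or_ne q 0
    · rw [zero_mul, cutoff_eq_zero (by norm_num)]
    · field_simp
  have hderiv : deriv cutoff q = 1 * (cutoff q / q) + q * deriv (fun q ↦ cutoff q / q) q := by
    conv_lhs => rw [hmul]
    exact ((hasDerivAt_id q).mul
      (contDiff_cutoff_div.differentiable (by simp) q).hasDerivAt).deriv
  rw [hderiv, deriv_smoothLog]
  ring

/-- A smooth radial function on the plane that agrees with `log ‖x‖²` outside the unit ball. -/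
noncomputable def logPotential (x : Plane) : ℝ := smoothLog (‖x‖ ^ 2)

theorem contDiff_logPotential : ContDiff ℝ ∞ logPotential :=
  contDiff_smoothLog.comp (contDiff_norm_sq ℝ)

theorem laplacian_logPotential : Δ logPotential = fun x ↦ 4 * deriv cutoff (‖x‖ ^ 2) := by
  funext x
  refine (laplacian_comp_norm_sq (contDiff_smoothLog.of_le (by norm_cast)) x).trans ?_
  rw [← mul_deriv_deriv_smoothLog_add, finrank_euclideanSpace, Fintype.card_fin]
  push_cast
  ring

theorem contDiff_laplacian_logPotential : ContDiff ℝ ∞ (Δ logPotential) :=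
  laplacian_logPotential ▸ contDiff_const.mul
    ((contDiff_infty_iff_deriv.1 contDiff_cutoff).2.comp (contDiff_norm_sq ℝ))

theorem support_laplacian_logPotential :
    Function.support (Δ logPotential) ⊆ closedBall 0 1 := by
  refine fun x hx ↦ mem_closedBall_zero_iff.2 (le_of_not_gt fun h ↦ hx ?_)
  have hone : cutoff =ᶠ[𝓝 (‖x‖ ^ 2)] fun _ ↦ 1 := by
    filter_upwards [Ioi_mem_nhds (one_lt_pow₀ h two_ne_zero)] with s hs
    exact cutoff_eq_one (le_of_lt hs)
  simp [laplacian_logPotential, hone.deriv_eq]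

theorem integral_laplacian_logPotential_pos : 0 < ∫ x, Δ logPotential x := by
  obtain ⟨t, ht, hslope⟩ := exists_deriv_eq_slope cutoff zero_lt_one
    contDiff_cutoff.continuous.continuousOn
    (contDiff_cutoff.differentiable (by simp)).differentiableOn
  rw [cutoff_eq_one le_rfl, cutoff_eq_zero (by norm_num)] at hslope
  refine contDiff_laplacian_logPotential.continuous.integral_pos_of_hasCompactSupport_nonneg_nonzero
    (.of_support_subset_isCompact (isCompact_closedBall 0 1) support_laplacian_logPotential)
    (fun x ↦ ?_) (x := EuclideanSpace.single 0 √t) ?_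
  · rw [laplacian_logPotential]
    exact mul_nonneg zero_le_four monotone_cutoff.deriv_nonneg
  · simp [laplacian_logPotential, Real.sq_sqrt ht.1.le, hslope]

/-- The Newtonian potential of the plane, smoothed in the ball of radius `ε`; outside that ball it
is a multiple of `log ‖x‖²` that does not depend on `ε`. -/
noncomputable def regularizedLog (ε : ℝ) (x : Plane) : ℝ :=
  (∫ y, Δ logPotential y)⁻¹ * (logPotential (ε⁻¹ • x) + Real.log (ε ^ 2))

/-- The Laplacian of `regularizedLog ε`: a smooth function of integral one, supported in the ball
of radius `ε`. -/
noncomputable def mollifier (ε : ℝ) (x : Plane) : ℝ :=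
  (ε ^ 2)⁻¹ * ((∫ y, Δ logPotential y)⁻¹ * Δ logPotential (ε⁻¹ • x))

theorem contDiff_regularizedLog (ε : ℝ) : ContDiff ℝ ∞ (regularizedLog ε) :=
  contDiff_const.mul
    ((contDiff_logPotential.comp (contDiff_const_smul _)).add contDiff_const)

theorem contDiff_mollifier (ε : ℝ) : ContDiff ℝ ∞ (mollifier ε) :=
  contDiff_const.mul (contDiff_const.mul
    (contDiff_laplacian_logPotential.comp (contDiff_const_smul _)))

theorem laplacian_regularizedLog (ε : ℝ) : Δ (regularizedLog ε) = mollifier ε := by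
  funext x
  let f : Plane → ℝ := fun y ↦ logPotential (ε⁻¹ • y)
  let g : Plane → ℝ := fun _ ↦ Real.log (ε ^ 2)
  have hf : ContDiffAt ℝ 2 f x :=
    ((contDiff_logPotential.comp (contDiff_const_smul _)).of_le (by norm_cast)).contDiffAt
  have hg : ContDiffAt ℝ 2 g x := contDiffAt_const
  have hsum : regularizedLog ε = (∫ y, Δ logPotential y)⁻¹ • (f + g) := rfl
  have hΔf : Δ f x = (ε⁻¹) ^ 2 • Δ logPotential (ε⁻¹ • x) :=
    laplacian_comp_smul (contDiff_logPotential.of_le (by norm_cast)) _ x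
  have hΔg : Δ g x = 0 := by simp only [g, laplacian_const, Pi.zero_apply]
  rw [hsum, laplacian_smul (f := f + g) _ (hf.add hg),
    hf.laplacian_add hg, hΔf, hΔg, mollifier, inv_pow,
    smul_eq_mul, smul_eq_mul]
  ring

theorem regularizedLog_eq {ε : ℝ} (hε : 0 < ε) {x : Plane} (hx : ε ≤ ‖x‖) :
    regularizedLog ε x = (∫ y, Δ logPotential y)⁻¹ * Real.log (‖x‖ ^ 2) := by
  have hnorm : ‖ε⁻¹ • x‖ ^ 2 = ‖x‖ ^ 2 / ε ^ 2 := by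
    rw [norm_smul, norm_inv, Real.norm_of_nonneg hε.le]
    ring
  have hone : 1 ≤ ‖ε⁻¹ • x‖ ^ 2 := by
    rw [hnorm, one_le_div (by positivity)]
    gcongr
  have hx₀ : 0 < ‖x‖ := hε.trans_le hx
  rw [regularizedLog, logPotential, smoothLog_eq_log hone, hnorm,
    Real.log_div (by positivity) (by positivity), sub_add_cancel]

theorem support_mollifier {ε : ℝ} (hε : 0 < ε) :
    Function.support (mollifier ε) ⊆ closedBall 0 ε := fun x hx ↦ by
  have h := support_laplacian_logPotential (right_ne_zero_of_mul (right_ne_zero_of_mul hx))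
  rwa [mem_closedBall_zero_iff, norm_smul, norm_inv, Real.norm_of_nonneg hε.le,
    inv_mul_le_one₀ hε, ← mem_closedBall_zero_iff] at h

theorem hasCompactSupport_mollifier {ε : ℝ} (hε : 0 < ε) : HasCompactSupport (mollifier ε) :=
  .of_support_subset_isCompact (isCompact_closedBall 0 ε) (support_mollifier hε)

theorem ae_tendsto_convolution_mollifier {u : Plane → ℝ} (hu : LocallyIntegrable u) :
    ∀ᵐ x, Tendsto (fun ε ↦ (u ⋆ mollifier ε) x) (𝓝[>] 0) (𝓝 (u x)) := by
  have h := ae_tendsto_convolution_dilation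
    (g := fun x ↦ (∫ y, Δ logPotential y)⁻¹ * Δ logPotential x) hu
    (contDiff_const.mul contDiff_laplacian_logPotential).continuous
    (fun x hx ↦ support_laplacian_logPotential (right_ne_zero_of_mul hx))
    (by rw [integral_const_mul, inv_mul_cancel₀ integral_laplacian_logPotential_pos.ne'])
  rw [finrank_euclideanSpace, Fintype.card_fin] at h
  exact h

/-- Weak (distributional) harmonicity of `u` in `U`. -/
def IsWeaklyHarmonic (U : Set Plane) (u : Plane → ℝ) : Prop :=
  ∀ ψ, IsTestFunction U ψ → ∫ y, u y * Δ ψ y = 0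

theorem isTestFunction_comp_const_sub {U : Set Plane} {ψ : Plane → ℝ} {x : Plane} {r : ℝ}
    (hψ : ContDiff ℝ ∞ ψ) (hs : Function.support ψ ⊆ closedBall 0 r) (hU : closedBall x r ⊆ U) :
    IsTestFunction U fun y ↦ ψ (x - y) := by
  have hsupp : Function.support (fun y ↦ ψ (x - y)) ⊆ closedBall x r := fun y hy ↦
    mem_closedBall_iff_norm'.2 (mem_closedBall_zero_iff.1 (hs hy))
  exact ⟨hψ.comp (contDiff_const.sub contDiff_id),
    .of_support_subset_isCompact (isCompact_closedBall x r) hsupp,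
    (closure_minimal hsupp isClosed_closedBall).trans hU⟩

namespace IsWeaklyHarmonic

variable {U : Set Plane} {u : Plane → ℝ} {x : Plane}

theorem convolution_laplacian_eq_zero (hw : IsWeaklyHarmonic U u) {ψ : Plane → ℝ} {r : ℝ}
    (hψ : ContDiff ℝ ∞ ψ) (hs : Function.support ψ ⊆ closedBall 0 r) (hU : closedBall x r ⊆ U) :
    (u ⋆ Δ ψ) x = 0 := by
  have h := hw _ (isTestFunction_comp_const_sub hψ hs hU)
  simp only [laplacian_comp_const_sub] at h
  exact h

theorem convolution_mollifier_eq (hw : IsWeaklyHarmonic U u) (hu : LocallyIntegrable u) {ε δ : ℝ}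
    (hε : 0 < ε) (hδ : 0 < δ) (hεU : closedBall x ε ⊆ U) (hδU : closedBall x δ ⊆ U) :
    (u ⋆ mollifier ε) x = (u ⋆ mollifier δ) x := by
  have hlap : Δ (regularizedLog ε - regularizedLog δ) = mollifier ε - mollifier δ := by
    funext y
    rw [((contDiff_regularizedLog ε).of_le (by norm_cast)).contDiffAt.laplacian_sub
      ((contDiff_regularizedLog δ).of_le (by norm_cast)).contDiffAt, laplacian_regularizedLog,
      laplacian_regularizedLog, Pi.sub_apply]
  have hsupp : Function.support (regularizedLog ε - regularizedLog δ) ⊆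
      closedBall 0 (max ε δ) := fun y hy ↦ by
    refine mem_closedBall_zero_iff.2 (le_of_not_gt fun h ↦ hy ?_)
    rw [Pi.sub_apply, regularizedLog_eq hε ((le_max_left _ _).trans h.le),
      regularizedLog_eq hδ ((le_max_right _ _).trans h.le), sub_self]
  have hmax : closedBall x (max ε δ) ⊆ U := by
    rcases max_choice ε δ with h | h <;> rwa [h]
  have hzero := hw.convolution_laplacian_eq_zero (ψ := regularizedLog ε - regularizedLog δ)
    ((contDiff_regularizedLog ε).sub (contDiff_regularizedLog δ)) hsupp hmax
  have hexists {η : ℝ} (hη : 0 < η) : ConvolutionExistsAt u (mollifier η) x (.lsmul ℝ ℝ) :=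
    (hasCompactSupport_mollifier hη).convolutionExists_right _ hu
      (contDiff_mollifier η).continuous x
  rw [hlap, convolution_def] at hzero
  simp only [Pi.sub_apply, map_sub] at hzero
  rw [integral_sub (hexists hε) (hexists hδ)] at hzero
  exact sub_eq_zero.1 hzero

theorem laplacian_convolution_mollifier (hw : IsWeaklyHarmonic U u) (hu : LocallyIntegrable u)
    {ε : ℝ} (hε : 0 < ε) (hU : closedBall x ε ⊆ U) : Δ (u ⋆ mollifier ε) x = 0 := by
  rw [laplacian_convolution_right hu ((contDiff_mollifier ε).of_le (by norm_cast))
    (hasCompactSupport_mollifier hε)]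
  exact hw.convolution_laplacian_eq_zero (contDiff_mollifier ε) (support_mollifier hε) hU

/-- **Weyl's lemma**: by `convolution_mollifier_eq`, mollifying `u` at any sufficiently small scale
yields the same function, which is harmonic and agrees with `u` almost everywhere. -/
theorem exists_harmonicOnNhd (hw : IsWeaklyHarmonic U u) (hU : IsOpen U)
    (hu : LocallyIntegrable u) :
    ∃ h : Plane → ℝ, HarmonicOnNhd h U ∧ ∀ᵐ x, x ∈ U → u x = h x := by
  have hball (x : Plane) : ∃ r > 0, x ∈ U → closedBall x (r + r) ⊆ U := by
    by_cases hx : x ∈ U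
    · obtain ⟨r, hr, h⟩ := nhds_basis_closedBall.mem_iff.1 (hU.mem_nhds hx)
      exact ⟨r / 2, half_pos hr, fun _ ↦ by rwa [add_halves]⟩
    · exact ⟨1, one_pos, fun h ↦ absurd h hx⟩
  choose r hr hrU using hball
  have hself {x : Plane} (hx : x ∈ U) : closedBall x (r x) ⊆ U :=
    (closedBall_subset_closedBall (by linarith [hr x])).trans (hrU x hx)
  have hnear {x y : Plane} (hx : x ∈ U) (hy : y ∈ ball x (r x)) : closedBall y (r x) ⊆ U :=
    (closedBall_subset_closedBall' (by linarith [mem_ball.1 hy])).trans (hrU x hx)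
  have hlocal {x : Plane} (hx : x ∈ U) :
      (fun y ↦ (u ⋆ mollifier (r y)) y) =ᶠ[𝓝 x] u ⋆ mollifier (r x) := by
    filter_upwards [ball_mem_nhds x (hr x)] with y hy
    exact hw.convolution_mollifier_eq hu (hr y) (hr x)
      (hself (hnear hx hy (mem_closedBall_self (hr x).le))) (hnear hx hy)
  refine ⟨fun y ↦ (u ⋆ mollifier (r y)) y, fun x hx ↦ ?_, ?_⟩
  · refine (harmonicAt_congr_nhds (hlocal hx)).2 ⟨?_, ?_⟩
    · exact ((hasCompactSupport_mollifier (hr x)).contDiff_convolution_right _ hu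
        ((contDiff_mollifier _).of_le (by norm_cast))).contDiffAt
    · filter_upwards [ball_mem_nhds x (hr x)] with y hy
      exact hw.laplacian_convolution_mollifier hu (hr x) (hnear hx hy)
  · filter_upwards [ae_tendsto_convolution_mollifier hu] with x hx hxU
    refine tendsto_nhds_unique hx (tendsto_const_nhds.congr' ?_)
    filter_upwards [Ioo_mem_nhdsGT (hr x)] with ε hε
    exact hw.convolution_mollifier_eq hu (hr x) hε.1 (hself hxU)
      ((closedBall_subset_closedBall hε.2.le).trans (hself hxU))

end IsWeaklyHarmonic

theorem analyticOnNhd_of_harmonicOnNhd {U : Set Plane} {h : Plane → ℝ} (hh : HarmonicOnNhd h U) :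
    AnalyticOnNhd ℝ h U := fun x hx ↦ by
  let J := Complex.orthonormalBasisOneI.repr
  have hJx : J (J.symm x) = x := J.apply_symm_apply x
  have hharm : HarmonicAt (fun w ↦ h (J w)) (J.symm x) := by
    refine ⟨(hJx.symm ▸ (hh x hx).1).comp _ J.contDiff.contDiffAt, ?_⟩
    have hlap : ∀ᶠ w in 𝓝 (J.symm x), Δ h (J w) = 0 :=
      (J.continuous.tendsto' _ _ hJx).eventually (hh x hx).2
    filter_upwards [hlap] with w hw
    rw [laplacian_comp_linearIsometryEquiv, hw, Pi.zero_apply]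
  simpa using AnalyticAt.fun_comp (f := fun y ↦ J.symm y) (HarmonicAt.analyticAt hharm)
    (J.symm.toContinuousLinearEquiv.toContinuousLinearMap.analyticAt x)

/-! ### Boundary charts and connectedness of the exterior -/

/-- A chart of radius `r` of the domain `U` at its boundary point `x`: in `ball x r` the domain is
the sublevel set of `ρ`, and `n` is the multiple of `∇ ρ x` with derivative `1` along it. The radius
is so small that the derivative along `n` remains at least `1 / 2`. -/
structure IsBoundaryChart (U : Set Plane) (x n : Plane) (r : ℝ) (ρ : Plane → ℝ) : Prop where
  pos : 0 < r
  contDiff : ContDiff ℝ ∞ ρ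
  fderiv_normal : fderiv ℝ ρ x n = 1
  inner_normal : ∀ v, fderiv ℝ ρ x v = 0 → inner ℝ v n = 0
  mem_iff : ∀ y ∈ ball x r, y ∈ U ↔ ρ y < 0
  half_le_fderiv : ∀ y ∈ ball x r, 1 / 2 ≤ fderiv ℝ ρ y n

theorem IsSmoothDomain.exists_isBoundaryChart {U : Set Plane} (hU : IsSmoothDomain U) {x : Plane}
    (hx : x ∈ frontier U) {N : Set Plane} (hN : N ∈ 𝓝 x) :
    ∃ n r ρ, IsBoundaryChart U x n r ρ ∧ ball x r ⊆ N := by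
  obtain ⟨V, hV, hxV, ρ, hρ, hdρ, hUV⟩ := hU.smooth_boundary x hx
  have hgrad : ‖∇ ρ x‖ ^ 2 ≠ 0 := by
    simpa [gradient] using hdρ
  have fderiv_eq (v : Plane) : fderiv ℝ ρ x v = inner ℝ (∇ ρ x) v :=
    toDual_symm_apply.symm
  set n : Plane := (‖∇ ρ x‖ ^ 2)⁻¹ • ∇ ρ x with hn
  have hn1 : fderiv ℝ ρ x n = 1 := by
    rw [fderiv_eq, hn, inner_smul_right, real_inner_self_eq_norm_sq, inv_mul_cancel₀ hgrad]
  have hcont : Continuous fun y ↦ fderiv ℝ ρ y n :=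
    (hρ.continuous_fderiv (by simp)).clm_apply continuous_const
  have hev : {y | 1 / 2 < fderiv ℝ ρ y n} ∈ 𝓝 x :=
    hcont.continuousAt.eventually (lt_mem_nhds (by norm_num [hn1]))
  obtain ⟨r, hr, hball⟩ := Metric.mem_nhds_iff.1 (inter_mem hN (inter_mem (hV.mem_nhds hxV) hev))
  refine ⟨n, r, ρ, ⟨hr, hρ, hn1, fun v hv ↦ ?_, fun y hy ↦ ?_, fun y hy ↦ (hball hy).2.2.le⟩,
    fun y hy ↦ (hball hy).1⟩
  · rw [hn, inner_smul_right, real_inner_comm, ← fderiv_eq, hv, mul_zero]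
  · have hyV : y ∈ V := (hball hy).2.1
    calc y ∈ U ↔ y ∈ U ∩ V := by simp [hyV]
      _ ↔ ρ y < 0 := by simp [hUV, hyV]

theorem tendsto_add_smul_nhdsGT_zero (y n : Plane) :
    Tendsto (fun t : ℝ ↦ y + t • n) (𝓝[>] 0) (𝓝 y) := by
  have hcont : Continuous fun t : ℝ ↦ y + t • n := by fun_prop
  simpa using (hcont.tendsto 0).mono_left (nhdsWithin_le_nhds (s := Ioi 0))

namespace IsBoundaryChart

variable {U : Set Plane} {x n : Plane} {r : ℝ} {ρ : Plane → ℝ}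

theorem add_half_le (h : IsBoundaryChart U x n r ρ) {y : Plane} {t : ℝ} (ht : 0 ≤ t)
    (hy : y ∈ ball x r) (hyt : y + t • n ∈ ball x r) : ρ y + t / 2 ≤ ρ (y + t • n) := by
  have hline (τ : ℝ) : HasDerivAt (fun τ : ℝ ↦ y + τ • n) n τ := by
    simpa using ((hasDerivAt_id τ).smul_const n).const_add y
  have hderiv (τ : ℝ) : HasDerivAt (fun τ : ℝ ↦ ρ (y + τ • n)) (fderiv ℝ ρ (y + τ • n) n) τ :=
    (h.contDiff.differentiable (by simp) _).hasFDerivAt.comp_hasDerivAt τ (hline τ)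
  have hconvex : Convex ℝ {τ : ℝ | y + τ • n ∈ ball x r} := by
    convert! (convex_ball x r).affine_preimage (AffineMap.lineMap y (y + n) : ℝ →ᵃ[ℝ] Plane)
      using 1
    ext τ
    simp [AffineMap.lineMap_apply, add_comm]
  have hmean := hconvex.mul_sub_le_image_sub_of_le_deriv (C := 1 / 2)
    (fun τ _ ↦ (hderiv τ).continuousAt.continuousWithinAt)
    (fun τ _ ↦ (hderiv τ).differentiableAt.differentiableWithinAt)
    (fun τ hτ ↦ by
      rw [(hderiv τ).deriv]
      exact h.half_le_fderiv _ (interior_subset (s := {τ : ℝ | y + τ • n ∈ ball x r}) hτ))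
    0 (by simpa using hy) t hyt ht
  simp only [zero_smul, add_zero] at hmean
  linarith

theorem mem_compl_closure_iff (h : IsBoundaryChart U x n r ρ) {y : Plane} (hy : y ∈ ball x r) :
    y ∈ (closure U)ᶜ ↔ 0 < ρ y := by
  constructor
  · contrapose!
    intro hle hyU
    have htendsto := tendsto_add_smul_nhdsGT_zero y (-n)
    refine hyU (mem_closure_of_tendsto htendsto ?_)
    filter_upwards [self_mem_nhdsWithin, htendsto.eventually (isOpen_ball.mem_nhds hy)]
      with t (ht : 0 < t) htball
    have := h.add_half_le ht.le htball (by simpa using hy)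
    simp only [smul_neg, neg_add_cancel_right] at this
    exact (h.mem_iff _ htball).2 (by simp only [smul_neg]; linarith)
  · intro hpos hyU
    have hnhds : {z | 0 < ρ z} ∩ ball x r ∈ 𝓝 y :=
      inter_mem ((isOpen_lt continuous_const h.contDiff.continuous).mem_nhds hpos)
        (isOpen_ball.mem_nhds hy)
    obtain ⟨z, ⟨hz : 0 < ρ z, hzball⟩, hzU⟩ := mem_closure_iff_nhds.1 hyU _ hnhds
    exact hz.not_gt ((h.mem_iff z hzball).1 hzU)

theorem eq_zero (h : IsBoundaryChart U x n r ρ) (hU : IsOpen U) {y : Plane}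
    (hy : y ∈ frontier U) (hball : y ∈ ball x r) : ρ y = 0 := by
  refine le_antisymm (not_lt.1 fun hpos ↦ ?_) (not_lt.1 fun hneg ↦ ?_)
  · exact (h.mem_compl_closure_iff hball).2 hpos hy.1
  · exact hy.2 (hU.interior_eq.symm ▸ (h.mem_iff y hball).2 hneg)

theorem exterior_of_pos (h : IsBoundaryChart U x n r ρ) {y : Plane} {t : ℝ} (ht : 0 ≤ t)
    (hy : y ∈ ball x r) (hyt : y + t • n ∈ ball x r) (hpos : 0 < ρ y + t / 2) :
    y + t • n ∈ (closure U)ᶜ :=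
  (h.mem_compl_closure_iff hyt).2 (hpos.trans_le (h.add_half_le ht hy hyt))

theorem eventually_exterior (h : IsBoundaryChart U x n r ρ) (hU : IsOpen U)
    (hx : x ∈ frontier U) :
    ∀ᶠ t : ℝ in 𝓝[>] 0, 0 < t ∧ x + t • n ∈ ball x r ∩ (closure U)ᶜ := by
  filter_upwards [self_mem_nhdsWithin,
    (tendsto_add_smul_nhdsGT_zero x n).eventually (ball_mem_nhds x h.pos)]
      with t (ht : 0 < t) htball
  exact ⟨ht, htball, h.exterior_of_pos ht.le (mem_ball_self h.pos) htball
    (by rw [h.eq_zero hU hx (mem_ball_self h.pos)]; linarith)⟩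

end IsBoundaryChart

theorem IsSmoothDomain.mem_closure_exterior {U : Set Plane} (hU : IsSmoothDomain U) {x : Plane}
    (hx : x ∈ frontier U) : x ∈ closure (closure U)ᶜ := by
  obtain ⟨n, r, ρ, h, -⟩ := hU.exists_isBoundaryChart hx univ_mem
  refine mem_closure_of_tendsto (tendsto_add_smul_nhdsGT_zero x n) ?_
  filter_upwards [h.eventually_exterior hU.isOpen hx] with t ht using ht.2.2

/-- Near `x`, every exterior point is joined to a fixed small ball by a segment along the normal. -/
theorem IsSmoothDomain.exists_connectedComponentIn_exterior_eq {U : Set Plane}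
    (hU : IsSmoothDomain U) {x : Plane} (hx : x ∈ frontier U) :
    ∃ K, ∀ᶠ y in 𝓝 x, y ∈ (closure U)ᶜ → connectedComponentIn (closure U)ᶜ y = K := by
  obtain ⟨n, r, ρ, h, -⟩ := hU.exists_isBoundaryChart hx univ_mem
  obtain ⟨t, ht, hp⟩ := (h.eventually_exterior hU.isOpen hx).exists
  obtain ⟨δ, hδ, hball⟩ := Metric.mem_nhds_iff.1
    ((isOpen_ball.inter isClosed_closure.isOpen_compl).mem_nhds hp)
  refine ⟨connectedComponentIn (closure U)ᶜ (x + t • n), ?_⟩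
  filter_upwards [ball_mem_nhds x hδ, ball_mem_nhds x h.pos] with y hy hyr hyU
  have hyt : y + t • n ∈ ball (x + t • n) δ := by
    simpa only [mem_ball, dist_add_right] using hy
  have hsegment : segment ℝ y (y + t • n) ⊆ (closure U)ᶜ := by
    intro z hz
    have hzr : z ∈ ball x r := (convex_ball x r).segment_subset hyr (hball hyt).1 hz
    rw [segment_eq_image'] at hz
    obtain ⟨θ, hθ, rfl⟩ := hz
    have hpos : 0 ≤ θ * t := mul_nonneg hθ.1 ht.le
    simp only [add_sub_cancel_left, smul_smul] at hzr ⊢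
    exact h.exterior_of_pos hpos hyr hzr (by linarith [(h.mem_compl_closure_iff hyr).1 hyU])
  have hconnected : IsPreconnected (segment ℝ y (y + t • n) ∪ ball (x + t • n) δ) :=
    (convex_segment y (y + t • n)).isPreconnected.union (y + t • n)
      (right_mem_segment ℝ _ _) hyt (convex_ball _ _).isPreconnected
  have hsub := hconnected.subset_connectedComponentIn (F := (closure U)ᶜ)
    (Or.inl (left_mem_segment ℝ y (y + t • n)))
    (union_subset hsegment fun z hz ↦ (hball hz).2)
  exact connectedComponentIn_eq (hsub (Or.inr (mem_ball_self hδ)))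

section Topology

variable {X Y : Type*} [TopologicalSpace X] [LocallyConnectedSpace X] [TopologicalSpace Y]
  {E : Set X}

theorem frontier_connectedComponentIn_subset (hE : IsOpen E) (x : X) :
    frontier (connectedComponentIn E x) ⊆ frontier E := by
  intro z hz
  refine ⟨closure_mono (connectedComponentIn_subset E x) hz.1, fun hzE ↦ ?_⟩
  rw [hE.interior_eq] at hzE
  obtain ⟨w, hwz, hwx⟩ := mem_closure_iff_nhds.1 hz.1 _
    (hE.connectedComponentIn.mem_nhds (mem_connectedComponentIn hzE))
  have heq : connectedComponentIn E z = connectedComponentIn E x :=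
    (connectedComponentIn_eq hwz).trans (connectedComponentIn_eq hwx).symm
  rw [hE.connectedComponentIn.frontier_eq] at hz
  exact hz.2 (heq ▸ mem_connectedComponentIn hzE)

/-- An open set is connected if it lies locally on one side of its boundary, and that boundary is
the image of a connected space. -/
theorem isPreconnected_of_frontier_subset_range [PreconnectedSpace X] [PreconnectedSpace Y]
    (hE : IsOpen E) (hne : E ≠ univ) {γ : Y → X} (hγ : Continuous γ)
    (hfrontier : frontier E ⊆ range γ) (hclosure : ∀ s, γ s ∈ closure E)
    (hside : ∀ s, ∃ K, ∀ᶠ y in 𝓝 (γ s), y ∈ E → connectedComponentIn E y = K) :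
    IsPreconnected E := by
  choose K hK using hside
  have hconst : IsLocallyConstant K := by
    refine (IsLocallyConstant.iff_eventually_eq K).2 fun s ↦ ?_
    filter_upwards [(hγ.tendsto s).eventually (eventually_eventually_nhds.2 (hK s))] with s' hs'
    obtain ⟨y, hyE, hy, hy'⟩ := (mem_closure_iff_frequently.1 (hclosure s')).and_eventually
      (hs'.and (hK s')) |>.exists
    rw [← hy hyE, ← hy' hyE]
  have exists_component {y : X} (hy : y ∈ E) : ∃ s, connectedComponentIn E y = K s := by
    have hfr : (frontier (connectedComponentIn E y)).Nonempty :=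
      nonempty_frontier_iff.2 ⟨⟨y, mem_connectedComponentIn hy⟩, fun h ↦
        hne (univ_subset_iff.1 (h ▸ connectedComponentIn_subset E y))⟩
    obtain ⟨z, hz⟩ := hfr
    obtain ⟨s, rfl⟩ := hfrontier (frontier_connectedComponentIn_subset hE y hz)
    obtain ⟨w, hwy, hw⟩ := ((mem_closure_iff_frequently.1 hz.1).and_eventually (hK s)).exists
    exact ⟨s, (connectedComponentIn_eq hwy).trans (hw (connectedComponentIn_subset E y hwy))⟩
  refine isPreconnected_of_forall_pair fun x hx y hy ↦ ?_
  obtain ⟨s, hs⟩ := exists_component hx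
  obtain ⟨s', hs'⟩ := exists_component hy
  have heq : connectedComponentIn E x = connectedComponentIn E y := by
    rw [hs, hs', hconst.apply_eq_of_preconnectedSpace s s']
  exact ⟨connectedComponentIn E x, connectedComponentIn_subset E x, mem_connectedComponentIn hx,
    heq ▸ mem_connectedComponentIn hy, isPreconnected_connectedComponentIn⟩

end Topology

theorem IsSmoothDomain.isPreconnected_exterior {D : Set Plane} (hD : IsSmoothDomain D) {L : ℝ}
    {γ : ℝ → Plane} (hγ : IsArclengthParam (frontier D) L γ) : IsPreconnected (closure D)ᶜ := by
  have hmem (s : ℝ) : γ s ∈ frontier D := hγ.range_eq ▸ mem_range_self s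
  obtain ⟨d, hd⟩ := hD.isConnected.nonempty
  refine isPreconnected_of_frontier_subset_range isClosed_closure.isOpen_compl
    (fun h ↦ (h ▸ mem_univ d : d ∈ (closure D)ᶜ) (subset_closure hd)) hγ.smooth.continuous ?_
    (fun s ↦ hD.mem_closure_exterior (hmem s))
    (fun s ↦ hD.exists_connectedComponentIn_exterior_eq (hmem s))
  rw [frontier_compl, hγ.range_eq]
  exact frontier_closure_subset

theorem addHaar_range_eq_zero_of_finrank_lt {E F : Type*} [NormedAddCommGroup E] [NormedSpace ℝ E]
    [FiniteDimensional ℝ E] [NormedAddCommGroup F] [NormedSpace ℝ F] [FiniteDimensional ℝ F]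
    [MeasurableSpace F] [BorelSpace F] (μ : Measure F) [μ.IsAddHaarMeasure] {f : E → F}
    (hf : ContDiff ℝ 1 f) (h : Module.finrank ℝ E < Module.finrank ℝ F) : μ (range f) = 0 := by
  refine measure_zero_of_dimH_lt (d := Module.finrank ℝ F) ?_
    (hf.dimH_range_le.trans_lt (by exact_mod_cast h))
  rw [NNReal.coe_natCast]
  exact Measure.absolutelyContinuous_isAddHaarMeasure μ _

theorem IsArclengthParam.volume_eq_zero {Γ : Set Plane} {L : ℝ} {γ : ℝ → Plane}
    (hγ : IsArclengthParam Γ L γ) : volume Γ = 0 :=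
  hγ.range_eq ▸ addHaar_range_eq_zero_of_finrank_lt volume (hγ.smooth.of_le (by simp)) (by simp)

/-! ### The trace inequality on the curve, from the exterior side -/

theorem sq_le_intervalIntegral {f f' : ℝ → ℝ} {t₀ : ℝ} (ht₀ : 0 < t₀)
    (hf : ∀ t ∈ Icc 0 t₀, HasDerivAt f (f' t) t) (hf' : ContinuousOn f' (Icc 0 t₀)) :
    f 0 ^ 2 ≤ (1 + t₀⁻¹) * ∫ t in (0 : ℝ)..t₀, f t ^ 2 + f' t ^ 2 := by
  rw [← uIcc_of_le ht₀.le] at hf hf'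
  have hfc : ContinuousOn f (uIcc 0 t₀) := fun t ht ↦ (hf t ht).continuousAt.continuousWithinAt
  have hderiv : ∀ t ∈ uIcc 0 t₀, HasDerivAt (fun t ↦ -((1 - t * t₀⁻¹) * f t ^ 2))
      (t₀⁻¹ * f t ^ 2 - (1 - t * t₀⁻¹) * (2 * f t * f' t)) t := by
    intro t ht
    have hweight : HasDerivAt (fun t : ℝ ↦ 1 - t * t₀⁻¹) (-t₀⁻¹) t := by
      simpa using ((hasDerivAt_id t).mul_const t₀⁻¹).const_sub 1
    convert! (hweight.mul ((hf t ht).pow 2)).neg using 1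
    simp
    ring
  have hint : IntervalIntegrable
      (fun t ↦ t₀⁻¹ * f t ^ 2 - (1 - t * t₀⁻¹) * (2 * f t * f' t)) volume 0 t₀ :=
    ContinuousOn.intervalIntegrable (by fun_prop)
  have hint' : IntervalIntegrable (fun t ↦ (1 + t₀⁻¹) * (f t ^ 2 + f' t ^ 2)) volume 0 t₀ :=
    ContinuousOn.intervalIntegrable (by fun_prop)
  calc f 0 ^ 2 = ∫ t in (0 : ℝ)..t₀, (t₀⁻¹ * f t ^ 2 - (1 - t * t₀⁻¹) * (2 * f t * f' t)) := by
        rw [intervalIntegral.integral_eq_sub_of_hasDerivAt hderiv hint, mul_inv_cancel₀ ht₀.ne']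
        simp
    _ ≤ ∫ t in (0 : ℝ)..t₀, (1 + t₀⁻¹) * (f t ^ 2 + f' t ^ 2) := by
        refine intervalIntegral.integral_mono_on ht₀.le hint hint' fun t ht ↦ ?_
        have hnonneg : 0 ≤ t * t₀⁻¹ := mul_nonneg ht.1 (inv_nonneg.2 ht₀.le)
        have hle : t * t₀⁻¹ ≤ 1 := by
          rw [← div_eq_mul_inv, div_le_one ht₀]; exact ht.2
        nlinarith [mul_nonneg (sub_nonneg.2 hle) (sq_nonneg (f t + f' t)),
          mul_nonneg hnonneg (add_nonneg (sq_nonneg (f t)) (sq_nonneg (f' t))),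
          mul_nonneg (inv_pos.2 ht₀).le (sq_nonneg (f' t))]
    _ = _ := intervalIntegral.integral_const_mul _ _

theorem ofReal_sq_le_lintegral {f f' : ℝ → ℝ} {t₀ : ℝ} (ht₀ : 0 < t₀)
    (hf : ∀ t ∈ Icc 0 t₀, HasDerivAt f (f' t) t) (hf' : ContinuousOn f' (Icc 0 t₀)) :
    ENNReal.ofReal (f 0 ^ 2) ≤ ENNReal.ofReal (1 + t₀⁻¹) *
      ∫⁻ t in Ioo 0 t₀, ENNReal.ofReal (f t ^ 2 + f' t ^ 2) := by
  have hfc : ContinuousOn f (Icc 0 t₀) := fun t ht ↦ (hf t ht).continuousAt.continuousWithinAt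
  have hcont : ContinuousOn (fun t ↦ f t ^ 2 + f' t ^ 2) (Icc 0 t₀) := by fun_prop
  have hint : IntegrableOn (fun t ↦ f t ^ 2 + f' t ^ 2) (Ioo 0 t₀) :=
    (hcont.integrableOn_compact isCompact_Icc).mono_set Ioo_subset_Icc_self
  have hle := sq_le_intervalIntegral ht₀ hf hf'
  rw [intervalIntegral.integral_of_le ht₀.le, integral_Ioc_eq_integral_Ioo] at hle
  rw [← ofReal_integral_eq_lintegral_ofReal hint (Eventually.of_forall fun t ↦ by positivity),
    ← ENNReal.ofReal_mul (by positivity)]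
  exact ENNReal.ofReal_le_ofReal hle

/-- The coordinate rectangle `I × J` in the plane. -/
def box (I J : Set ℝ) : Set Plane := {q | q 0 ∈ I ∧ q 1 ∈ J}

theorem measurableSet_box {I J : Set ℝ} (hI : MeasurableSet I) (hJ : MeasurableSet J) :
    MeasurableSet (box I J) :=
  ((EuclideanSpace.proj (0 : Fin 2) : Plane →L[ℝ] ℝ).continuous.measurable hI).inter
    ((EuclideanSpace.proj (1 : Fin 2) : Plane →L[ℝ] ℝ).continuous.measurable hJ)

theorem lintegral_box {I J : Set ℝ} (hI : MeasurableSet I) (hJ : MeasurableSet J)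
    {F : Plane → ℝ≥0∞} (hF : Measurable F) :
    ∫⁻ q in box I J, F q = ∫⁻ s in I, ∫⁻ t in J, F !₂[s, t] := by
  have hpreserving :=
    (PiLp.volume_preserving_toLp (Fin 2)).comp (volume_preserving_finTwoArrow ℝ).symm
  have hpreimage : (WithLp.toLp 2 ∘ ⇑(MeasurableEquiv.finTwoArrow (α := ℝ)).symm) ⁻¹' box I J
      = I ×ˢ J := by
    ext ⟨s, t⟩
    simp [box]
  rw [← hpreserving.setLIntegral_comp_preimage (measurableSet_box hI hJ) hF, hpreimage,
    Measure.volume_eq_prod, ← Measure.prod_restrict]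
  exact lintegral_prod _ (hF.comp hpreserving.measurable).aemeasurable

/-- The density `φ² + |∇φ|²` of the squared `H¹` norm. -/
noncomputable def sobolevDensity (φ : Plane → ℝ) (x : Plane) : ℝ≥0∞ :=
  ENNReal.ofReal (φ x ^ 2 + ‖fderiv ℝ φ x‖ ^ 2)

section Collar

variable {Ω : Set Plane} {φ : Plane → ℝ}

theorem measurable_indicator_sobolevDensity (hΩ : IsOpen Ω) (hφ : ContDiffOn ℝ ∞ φ Ω) :
    Measurable (Ω.indicator (sobolevDensity φ)) := by
  have hcont : ContinuousOn (sobolevDensity φ) Ω := by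
    refine ENNReal.continuous_ofReal.comp_continuousOn ?_
    exact (hφ.continuousOn.pow 2).add
      ((hφ.continuousOn_fderiv_of_isOpen hΩ (by simp)).norm.pow 2)
  classical
  rw [← piecewise_eq_indicator]
  exact hcont.measurable_piecewise continuousOn_const hΩ.measurableSet

theorem ofReal_sq_le_lintegral_sobolevDensity (hΩ : IsOpen Ω) (hφ : ContDiffOn ℝ ∞ φ Ω)
    {p n : Plane} {t₀ : ℝ} (ht₀ : 0 < t₀) (hsegment : ∀ t ∈ Icc 0 t₀, p + t • n ∈ Ω) :
    ENNReal.ofReal (φ p ^ 2) ≤ ENNReal.ofReal ((1 + t₀⁻¹) * (1 + ‖n‖ ^ 2)) *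
      ∫⁻ t in Ioo 0 t₀, sobolevDensity φ (p + t • n) := by
  have hline (t : ℝ) : HasDerivAt (fun t : ℝ ↦ p + t • n) n t := by
    simpa using ((hasDerivAt_id t).smul_const n).const_add p
  have hderiv : ∀ t ∈ Icc 0 t₀, HasDerivAt (fun t : ℝ ↦ φ (p + t • n))
      (fderiv ℝ φ (p + t • n) n) t := fun t ht ↦
    ((hφ.contDiffAt (hΩ.mem_nhds (hsegment t ht))).differentiableAt (by simp)).hasFDerivAt
      |>.comp_hasDerivAt t (hline t)
  have hcont : ContinuousOn (fun t : ℝ ↦ fderiv ℝ φ (p + t • n) n) (Icc 0 t₀) :=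
    ((hφ.continuousOn_fderiv_of_isOpen hΩ (by simp)).comp (by fun_prop) hsegment).clm_apply
      continuousOn_const
  have hle := ofReal_sq_le_lintegral ht₀ hderiv hcont
  simp only [zero_smul, add_zero] at hle
  refine hle.trans ?_
  rw [ENNReal.ofReal_mul (by positivity), mul_assoc]
  gcongr
  rw [← lintegral_const_mul' _ _ ENNReal.ofReal_ne_top]
  refine lintegral_mono fun t ↦ ?_
  rw [sobolevDensity, ← ENNReal.ofReal_mul (by positivity)]
  refine ENNReal.ofReal_le_ofReal ?_
  have hsq : fderiv ℝ φ (p + t • n) n ^ 2 ≤ (‖fderiv ℝ φ (p + t • n)‖ * ‖n‖) ^ 2 := by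
    rw [← sq_abs]
    exact pow_le_pow_left₀ (abs_nonneg _) ((fderiv ℝ φ (p + t • n)).le_opNorm n) 2
  nlinarith [mul_nonneg (sq_nonneg ‖n‖) (sq_nonneg (φ (p + t • n))),
    sq_nonneg ‖fderiv ℝ φ (p + t • n)‖]

/-- The map `(s, t) ↦ γ s + t n`, which sweeps out a one-sided neighbourhood of the curve `γ` by
parallel segments. -/
noncomputable def collarMap (γ : ℝ → Plane) (n : Plane) (q : Plane) : Plane := γ (q 0) + q 1 • n

/-- The derivative of `collarMap γ n` at every point with first coordinate `s`. -/
noncomputable def collarDeriv (γ : ℝ → Plane) (n : Plane) (s : ℝ) : Plane →L[ℝ] Plane :=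
  (EuclideanSpace.proj (0 : Fin 2) : Plane →L[ℝ] ℝ).smulRight (deriv γ s) +
    (EuclideanSpace.proj (1 : Fin 2) : Plane →L[ℝ] ℝ).smulRight n

variable {γ : ℝ → Plane} {n τ : Plane}

theorem hasFDerivAt_collarMap (hγ : Differentiable ℝ γ) (n q : Plane) :
    HasFDerivAt (collarMap γ n) (collarDeriv γ n (q 0)) q := by
  refine HasFDerivAt.add ?_
    ((EuclideanSpace.proj (1 : Fin 2) : Plane →L[ℝ] ℝ).smulRight n).hasFDerivAt
  convert! (hγ (q 0)).hasDerivAt.hasFDerivAt.comp q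
    (EuclideanSpace.proj (0 : Fin 2) : Plane →L[ℝ] ℝ).hasFDerivAt using 1

theorem continuous_det_collarDeriv (hγ : Continuous (deriv γ)) (n : Plane) :
    Continuous fun s ↦ (collarDeriv γ n s).det := by
  refine ContinuousLinearMap.continuous_det.comp (Continuous.add ?_ continuous_const)
  exact (ContinuousLinearMap.smulRightL ℝ Plane Plane (EuclideanSpace.proj 0)).continuous.comp hγ

theorem det_collarDeriv_ne_zero {s : ℝ} (hγ : deriv γ s ≠ 0) (hn : n ≠ 0)
    (horth : inner ℝ (deriv γ s) n = 0) : (collarDeriv γ n s).det ≠ 0 := by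
  intro hdet
  obtain ⟨v, hv, hv0⟩ := (Submodule.ne_bot_iff _).1
    (LinearMap.bot_lt_ker_of_det_eq_zero (f := (collarDeriv γ n s : Plane →ₗ[ℝ] Plane)) hdet).ne'
  have hv : v 0 • deriv γ s + v 1 • n = 0 := hv
  have h0 : v 0 = 0 := by
    have := congrArg (inner ℝ (deriv γ s)) hv
    simpa [inner_add_right, inner_smul_right, horth, hγ] using this
  have h1 : v 1 = 0 := by simpa [h0, hn] using hv
  exact hv0 (PiLp.ext (Fin.forall_fin_two.2 ⟨h0, h1⟩))

theorem injOn_collarMap {I J : Set ℝ} (hn : n ≠ 0) (horth : inner ℝ τ n = 0)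
    (hγ : InjOn (fun s ↦ inner ℝ τ (γ s)) I) : InjOn (collarMap γ n) (box I J) := by
  intro q hq q' hq' heq
  have h0 : q 0 = q' 0 := by
    refine hγ hq.1 hq'.1 ?_
    simpa [collarMap, inner_add_right, inner_smul_right, horth] using congrArg (inner ℝ τ) heq
  have h1 : q 1 = q' 1 := by
    simp only [collarMap, h0, add_right_inj] at heq
    exact smul_left_injective ℝ hn heq
  exact PiLp.ext (Fin.forall_fin_two.2 ⟨h0, h1⟩)

theorem lintegral_box_le_lintegral_image {I J : Set ℝ} {c : ℝ} (hI : MeasurableSet I)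
    (hJ : MeasurableSet J) (hγ : Differentiable ℝ γ) (hc : 0 < c)
    (hdet : ∀ s ∈ I, c ≤ |(collarDeriv γ n s).det|) (hinj : InjOn (collarMap γ n) (box I J))
    (F : Plane → ℝ≥0∞) :
    ∫⁻ q in box I J, F (collarMap γ n q) ≤
      ENNReal.ofReal c⁻¹ * ∫⁻ x in collarMap γ n '' box I J, F x := by
  have hbox := measurableSet_box hI hJ
  rw [lintegral_image_eq_lintegral_abs_det_fderiv_mul volume hbox
    (fun q _ ↦ (hasFDerivAt_collarMap hγ n q).hasFDerivWithinAt) hinj,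
    ← lintegral_const_mul' _ _ ENNReal.ofReal_ne_top]
  refine setLIntegral_mono' hbox fun q hq ↦ ?_
  rw [← mul_assoc, ← ENNReal.ofReal_mul (by positivity)]
  refine le_mul_of_one_le_left zero_le ?_
  rw [ENNReal.one_le_ofReal, inv_mul_eq_div, one_le_div hc]
  exact hdet _ hq.1

theorem lintegral_sq_le_of_collar {I : Set ℝ} {t₀ c : ℝ} (hΩ : IsOpen Ω)
    (hφ : ContDiffOn ℝ ∞ φ Ω) (hI : MeasurableSet I) (hγ : Differentiable ℝ γ) (ht₀ : 0 < t₀)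
    (hc : 0 < c) (hdet : ∀ s ∈ I, c ≤ |(collarDeriv γ n s).det|)
    (hinj : InjOn (collarMap γ n) (box I (Ioo 0 t₀)))
    (hsegment : ∀ s ∈ I, ∀ t ∈ Icc 0 t₀, γ s + t • n ∈ Ω) :
    ∫⁻ s in I, ENNReal.ofReal (φ (γ s) ^ 2) ≤
      ENNReal.ofReal ((1 + t₀⁻¹) * (1 + ‖n‖ ^ 2)) * (ENNReal.ofReal c⁻¹ *
        ∫⁻ x in collarMap γ n '' box I (Ioo 0 t₀), sobolevDensity φ x) := by
  set K := (1 + t₀⁻¹) * (1 + ‖n‖ ^ 2)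
  set F := Ω.indicator (sobolevDensity φ)
  have hcollar : Measurable (collarMap γ n) :=
    (continuous_iff_continuousAt.2 fun q ↦
      (hasFDerivAt_collarMap hγ n q).continuousAt).measurable
  have hpointwise : ∀ s ∈ I, ENNReal.ofReal (φ (γ s) ^ 2) ≤
      ENNReal.ofReal K * ∫⁻ t in Ioo 0 t₀, F (collarMap γ n !₂[s, t]) := by
    intro s hs
    refine (ofReal_sq_le_lintegral_sobolevDensity hΩ hφ ht₀ (hsegment s hs)).trans ?_
    gcongr ENNReal.ofReal K * ?_
    refine setLIntegral_mono' measurableSet_Ioo fun t ht ↦ ?_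
    exact (indicator_of_mem (hsegment s hs t (Ioo_subset_Icc_self ht)) _).ge
  calc ∫⁻ s in I, ENNReal.ofReal (φ (γ s) ^ 2)
      ≤ ∫⁻ s in I, ENNReal.ofReal K * ∫⁻ t in Ioo 0 t₀, F (collarMap γ n !₂[s, t]) :=
        setLIntegral_mono' hI hpointwise
    _ = ENNReal.ofReal K * ∫⁻ q in box I (Ioo 0 t₀), F (collarMap γ n q) := by
        rw [lintegral_const_mul' _ _ ENNReal.ofReal_ne_top,
          lintegral_box (F := fun q ↦ F (collarMap γ n q)) hI measurableSet_Ioo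
            ((measurable_indicator_sobolevDensity hΩ hφ).comp hcollar)]
    _ ≤ ENNReal.ofReal K * (ENNReal.ofReal c⁻¹ *
          ∫⁻ x in collarMap γ n '' box I (Ioo 0 t₀), F x) := by
        gcongr
        exact lintegral_box_le_lintegral_image hI measurableSet_Ioo hγ hc hdet hinj F
    _ ≤ _ := by
        gcongr
        exact indicator_le_self _ _ _

end Collar

section Curve

variable {D Ω N : Set Plane} {L : ℝ} {γ : ℝ → Plane}

theorem IsArclengthParam.differentiable {Γ : Set Plane} (hγ : IsArclengthParam Γ L γ) :
    Differentiable ℝ γ :=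
  hγ.smooth.differentiable (by simp)

theorem IsArclengthParam.continuous_deriv {Γ : Set Plane} (hγ : IsArclengthParam Γ L γ) :
    Continuous (deriv γ) :=
  (contDiff_infty_iff_deriv.1 hγ.smooth).2.continuous

theorem IsArclengthParam.mem {Γ : Set Plane} (hγ : IsArclengthParam Γ L γ) (s : ℝ) : γ s ∈ Γ :=
  hγ.range_eq ▸ mem_range_self s

theorem IsArclengthParam.exists_strictMonoOn_inner {Γ : Set Plane} (hγ : IsArclengthParam Γ L γ)
    {s₀ : ℝ} {S : Set ℝ} (hS : S ∈ 𝓝 s₀) :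
    ∃ δ > 0, Icc (s₀ - δ) (s₀ + δ) ⊆ S ∧
      StrictMonoOn (fun s ↦ inner ℝ (deriv γ s₀) (γ s)) (Icc (s₀ - δ) (s₀ + δ)) := by
  have hpos : {s | 0 < inner ℝ (deriv γ s₀) (deriv γ s)} ∈ 𝓝 s₀ := by
    refine (continuous_const.inner hγ.continuous_deriv).continuousAt.eventually (lt_mem_nhds ?_)
    simp [hγ.unit_speed]
  obtain ⟨δ, hδ, hsub⟩ := nhds_basis_closedBall.mem_iff.1 (inter_mem hS hpos)
  rw [Real.closedBall_eq_Icc] at hsub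
  refine ⟨δ, hδ, fun s hs ↦ (hsub hs).1, strictMonoOn_of_deriv_pos (convex_Icc _ _)
    (continuous_const.inner hγ.smooth.continuous).continuousOn fun s hs ↦ ?_⟩
  rw [((hasDerivAt_const s (deriv γ s₀)).inner ℝ (hγ.differentiable s).hasDerivAt).deriv]
  simpa using (hsub (interior_subset hs)).2

theorem IsBoundaryChart.inner_deriv_eq_zero {x n : Plane} {r : ℝ} {ρ : Plane → ℝ}
    (h : IsBoundaryChart D x n r ρ) (hD : IsOpen D) (hγ : IsArclengthParam (frontier D) L γ)
    {s : ℝ} (hs : γ s = x) : inner ℝ (deriv γ s) n = 0 := by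
  subst hs
  refine h.inner_normal _ ?_
  have hderiv : HasDerivAt (fun s ↦ ρ (γ s)) (fderiv ℝ ρ (γ s) (deriv γ s)) s :=
    (h.contDiff.differentiable (by simp) (γ s)).hasFDerivAt.comp_hasDerivAt s
      (hγ.differentiable s).hasDerivAt
  have hzero : (fun s ↦ ρ (γ s)) =ᶠ[𝓝 s] fun _ ↦ 0 := by
    filter_upwards [(hγ.smooth.continuous.tendsto s).eventually (ball_mem_nhds _ h.pos)] with s' hs'
    exact h.eq_zero hD (hγ.mem s') hs'
  rw [← hderiv.deriv, hzero.deriv_eq, deriv_const]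

theorem add_smul_mem_ball {E : Type*} [SeminormedAddCommGroup E] [NormedSpace ℝ E] {x y n : E}
    {r t t₀ : ℝ} (hy : y ∈ ball x (r / 2)) (ht₀ : t₀ * ‖n‖ = r / 2) (ht : t ∈ Icc 0 t₀) :
    y + t • n ∈ ball x r := by
  have htn : ‖t • n‖ ≤ r / 2 := by
    rw [norm_smul, Real.norm_of_nonneg ht.1, ← ht₀]
    gcongr
    exact ht.2
  rw [mem_ball_iff_norm] at hy ⊢
  rw [add_sub_right_comm]
  linarith [norm_add_le (y - x) (t • n)]

theorem IsBoundaryChart.image_collarMap_subset {x n : Plane} {r t₀ : ℝ} {ρ : Plane → ℝ} {I : Set ℝ}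
    (h : IsBoundaryChart D x n r ρ) (hD : IsOpen D) (hγ : ∀ s, γ s ∈ frontier D)
    (hI : ∀ s ∈ I, ∀ t ∈ Icc 0 t₀, γ s + t • n ∈ ball x r) :
    collarMap γ n '' box I (Ioo 0 t₀) ⊆ ball x r \ closure D := by
  rintro _ ⟨q, hq, rfl⟩
  have hmem := hI (q 0) hq.1 (q 1) (Ioo_subset_Icc_self hq.2)
  have hmem0 : γ (q 0) ∈ ball x r := by
    simpa only [zero_smul, add_zero] using
      hI (q 0) hq.1 0 (left_mem_Icc.2 (hq.2.1.trans hq.2.2).le)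
  refine ⟨hmem, h.exterior_of_pos hq.2.1.le hmem0 hmem ?_⟩
  rw [h.eq_zero hD (hγ _) hmem0, zero_add]
  exact half_pos hq.2.1

theorem exists_lintegral_sq_le_near (hD : IsSmoothDomain D)
    (hγ : IsArclengthParam (frontier D) L γ) (hΩ : IsOpen Ω) (hN : IsOpen N)
    (hDN : frontier D ⊆ N) (hNΩ : N ⊆ Ω) (s₀ : ℝ) :
    ∃ S ∈ 𝓝 s₀, ∃ C : ℝ≥0, ∀ φ : Plane → ℝ, ContDiffOn ℝ ∞ φ Ω →
      ∫⁻ s in S, ENNReal.ofReal (φ (γ s) ^ 2) ≤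
        C * ∫⁻ x in N \ closure D, sobolevDensity φ x := by
  obtain ⟨n, r, ρ, h, hrN⟩ :=
    hD.exists_isBoundaryChart (hγ.mem s₀) (hN.mem_nhds (hDN (hγ.mem s₀)))
  have hn : n ≠ 0 := by
    rintro rfl
    simpa using h.fderiv_normal
  have horth : inner ℝ (deriv γ s₀) n = 0 := h.inner_deriv_eq_zero hD.isOpen hγ rfl
  have hτ : deriv γ s₀ ≠ 0 := fun h0 ↦ by simpa [h0] using hγ.unit_speed s₀
  obtain ⟨c, hc, hcdet⟩ := exists_between (abs_pos.2 (det_collarDeriv_ne_zero hτ hn horth))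
  have hdet : {s | c < |(collarDeriv γ n s).det|} ∈ 𝓝 s₀ :=
    (continuous_det_collarDeriv hγ.continuous_deriv n).abs.continuousAt.eventually
      (lt_mem_nhds hcdet)
  obtain ⟨δ, hδ, hsub, hmono⟩ := hγ.exists_strictMonoOn_inner (inter_mem hdet
    ((hγ.smooth.continuous.tendsto s₀).eventually (ball_mem_nhds _ (half_pos h.pos))))
  set I := Icc (s₀ - δ) (s₀ + δ)
  obtain ⟨t₀, ht₀, ht₀n⟩ : ∃ t₀ > 0, t₀ * ‖n‖ = r / 2 :=
    ⟨r / 2 / ‖n‖, div_pos (half_pos h.pos) (norm_pos_iff.2 hn),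
      div_mul_cancel₀ _ (norm_ne_zero_iff.2 hn)⟩
  have hball : ∀ s ∈ I, ∀ t ∈ Icc 0 t₀, γ s + t • n ∈ ball (γ s₀) r :=
    fun s hs t ht ↦ add_smul_mem_ball (hsub hs).2 ht₀n ht
  have himage : collarMap γ n '' box I (Ioo 0 t₀) ⊆ N \ closure D :=
    (h.image_collarMap_subset hD.isOpen hγ.mem hball).trans (sdiff_subset_sdiff_left hrN)
  refine ⟨I, Icc_mem_nhds (by linarith) (by linarith),
    ⟨(1 + t₀⁻¹) * (1 + ‖n‖ ^ 2) * c⁻¹, by positivity⟩, fun φ hφ ↦ ?_⟩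
  refine (lintegral_sq_le_of_collar hΩ hφ measurableSet_Icc hγ.differentiable ht₀ hc
    (fun s hs ↦ (hsub hs).1.le) (injOn_collarMap hn horth hmono.injOn)
    fun s hs t ht ↦ hNΩ (hrN (hball s hs t ht))).trans ?_
  rw [← mul_assoc, ← ENNReal.ofReal_mul (by positivity)]
  gcongr
  exact (ENNReal.ofReal_eq_coe_nnreal _).le

theorem exists_lintegral_sq_le (hD : IsSmoothDomain D) (hγ : IsArclengthParam (frontier D) L γ)
    (hΩ : IsOpen Ω) (hN : IsOpen N) (hDN : frontier D ⊆ N) (hNΩ : N ⊆ Ω) :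
    ∃ C : ℝ≥0, ∀ φ : Plane → ℝ, ContDiffOn ℝ ∞ φ Ω →
      ∫⁻ s in Ioc 0 L, ENNReal.ofReal (φ (γ s) ^ 2) ≤
        C * ∫⁻ x in N \ closure D, sobolevDensity φ x := by
  have hcompact := (isCompact_Icc (a := (0 : ℝ)) (b := L)).induction_on
    (p := fun S ↦ ∃ C : ℝ≥0, ∀ φ : Plane → ℝ, ContDiffOn ℝ ∞ φ Ω →
      ∫⁻ s in S, ENNReal.ofReal (φ (γ s) ^ 2) ≤
        C * ∫⁻ x in N \ closure D, sobolevDensity φ x)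
    ⟨0, fun φ _ ↦ by simp⟩
    (fun S T hST ⟨C, hC⟩ ↦ ⟨C, fun φ hφ ↦ (lintegral_mono_set hST).trans (hC φ hφ)⟩)
    (fun S T ⟨C, hC⟩ ⟨C', hC'⟩ ↦ ⟨C + C', fun φ hφ ↦ by
      rw [ENNReal.coe_add, add_mul]
      exact (lintegral_union_le _ _ _).trans (add_le_add (hC φ hφ) (hC' φ hφ))⟩)
    (fun s _ ↦ by
      obtain ⟨S, hS, hC⟩ := exists_lintegral_sq_le_near hD hγ hΩ hN hDN hNΩ s
      exact ⟨S, mem_nhdsWithin_of_mem_nhds hS, hC⟩)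
  obtain ⟨C, hC⟩ := hcompact
  exact ⟨C, fun φ hφ ↦ (lintegral_mono_set Ioc_subset_Icc_self).trans (hC φ hφ)⟩

end Curve

/-! ### The spaces `H¹(Ω)` and `H¹₀(Ω)` -/

section Gradient

variable {F : Type*} [NormedAddCommGroup F] [InnerProductSpace ℝ F] [CompleteSpace F]

theorem norm_gradient (φ : F → ℝ) (x : F) : ‖∇ φ x‖ = ‖fderiv ℝ φ x‖ := by
  rw [gradient, LinearIsometryEquiv.norm_map]

theorem continuousOn_gradient {φ : F → ℝ} {W : Set F} (hφ : ContDiffOn ℝ 1 φ W) (hW : IsOpen W) :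
    ContinuousOn (∇ φ) W :=
  (toDual ℝ F).symm.continuous.comp_continuousOn (hφ.continuousOn_fderiv_of_isOpen hW le_rfl)

theorem hasCompactSupport_gradient {φ : F → ℝ} (hφ : HasCompactSupport φ) :
    HasCompactSupport (∇ φ) :=
  (hφ.fderiv (𝕜 := ℝ)).comp_left (g := (toDual ℝ F).symm) (by simp)

end Gradient

section IntegrationByParts

theorem integrable_mul_of_tsupport_subset {X : Type*} [TopologicalSpace X] [MeasurableSpace X]
    [OpensMeasurableSpace X] {ν : Measure X} [IsFiniteMeasureOnCompacts ν] {W : Set X}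
    {f g : X → ℝ} (hW : IsOpen W) (hf : ContinuousOn f W) (hg : Continuous g)
    (hc : HasCompactSupport g) (hgW : tsupport g ⊆ W) : Integrable (fun x ↦ f x * g x) ν := by
  refine (continuous_of_tsupport fun x hx ↦ ?_).integrable_of_hasCompactSupport
    (HasCompactSupport.mul_left hc)
  exact (hf.continuousAt (hW.mem_nhds (hgW (tsupport_mul_subset_right hx)))).mul hg.continuousAt

variable {E : Type*} [NormedAddCommGroup E] [NormedSpace ℝ E] [FiniteDimensional ℝ E]
  [MeasurableSpace E] [BorelSpace E] {ν : Measure E} [ν.IsAddHaarMeasure]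

theorem integral_mul_fderiv_eq_neg_of_tsupport_subset {W : Set E} {f g : E → ℝ} (hW : IsOpen W)
    (hf : ContDiffOn ℝ 1 f W) (hg : ContDiff ℝ 1 g) (hc : HasCompactSupport g)
    (hgW : tsupport g ⊆ W) (v : E) :
    ∫ x, f x * fderiv ℝ g x v ∂ν = - ∫ x, fderiv ℝ f x v * g x ∂ν := by
  have hf' : ContinuousOn (fun x ↦ fderiv ℝ f x v) W :=
    (hf.continuousOn_fderiv_of_isOpen hW le_rfl).clm_apply continuousOn_const
  have hg' : Continuous (fun x ↦ fderiv ℝ g x v) :=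
    (hg.continuous_fderiv one_ne_zero).clm_apply continuous_const
  refine integral_mul_fderiv_eq_neg_fderiv_mul_of_integrable
    (integrable_mul_of_tsupport_subset hW hf' hg.continuous hc hgW)
    (integrable_mul_of_tsupport_subset hW hf.continuousOn hg' (hc.fderiv_apply ℝ v)
      ((tsupport_fderiv_apply_subset ℝ v).trans hgW))
    (integrable_mul_of_tsupport_subset hW hf.continuousOn hg.continuous hc hgW)
    (fun x hx ↦ ?_) (fun x _ ↦ hg.differentiable one_ne_zero x)
  exact (hf.contDiffAt (hW.mem_nhds (hgW hx))).differentiableAt one_ne_zero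

end IntegrationByParts

section L2

variable {α : Type*} [MeasurableSpace α] {ν : Measure α} {F : Type*} [NormedAddCommGroup F]
  [InnerProductSpace ℝ F]

theorem inner_toLp_left {f : α → F} (hf : MemLp f 2 ν) (u : Lp F 2 ν) :
    inner ℝ (hf.toLp f) u = ∫ x, inner ℝ (f x) (u x) ∂ν := by
  rw [L2.inner_def]
  refine integral_congr_ae ?_
  filter_upwards [hf.coeFn_toLp] with x hx
  rw [hx]

theorem norm_sq_eq_integral (u : Lp F 2 ν) : ‖u‖ ^ 2 = ∫ x, ‖u x‖ ^ 2 ∂ν := by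
  rw [← real_inner_self_eq_norm_sq, L2.inner_def]
  simp only [real_inner_self_eq_norm_sq]

end L2

section TestFunction

variable {Ω : Set Plane} {φ ψ : Plane → ℝ}

theorem IsTestFunction.add (hφ : IsTestFunction Ω φ) (hψ : IsTestFunction Ω ψ) :
    IsTestFunction Ω fun x ↦ φ x + ψ x :=
  ⟨hφ.smooth.add hψ.smooth, hφ.compact.add hψ.compact,
    (tsupport_add φ ψ).trans (union_subset hφ.supp hψ.supp)⟩

theorem IsTestFunction.const_mul (c : ℝ) (hφ : IsTestFunction Ω φ) :
    IsTestFunction Ω fun x ↦ c * φ x :=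
  ⟨contDiff_const.mul hφ.smooth, hφ.compact.mul_left,
    (tsupport_mul_subset_right (f := fun _ ↦ c) (g := φ)).trans hφ.supp⟩

theorem IsTestFunction.mono {W : Set Plane} (hφ : IsTestFunction W φ) (h : W ⊆ Ω) :
    IsTestFunction Ω φ :=
  ⟨hφ.smooth, hφ.compact, hφ.supp.trans h⟩

theorem IsTestFunction.eq_zero (hφ : IsTestFunction Ω φ) {x : Plane} (hx : x ∉ Ω) : φ x = 0 :=
  image_eq_zero_of_notMem_tsupport fun h ↦ hx (hφ.supp h)

theorem IsTestFunction.fderiv_eq_zero (hφ : IsTestFunction Ω φ) {x : Plane} (hx : x ∉ Ω) :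
    fderiv ℝ φ x = 0 :=
  fderiv_of_notMem_tsupport ℝ fun h ↦ hx (hφ.supp h)

theorem IsTestFunction.setIntegral_mul (hφ : IsTestFunction Ω φ) (f : Plane → ℝ) :
    ∫ x in Ω, f x * φ x = ∫ x, f x * φ x :=
  setIntegral_eq_integral_of_forall_compl_eq_zero fun x hx ↦ by rw [hφ.eq_zero hx, mul_zero]

theorem IsTestFunction.setIntegral_mul_fderiv (hφ : IsTestFunction Ω φ) (f : Plane → ℝ)
    (v : Plane) : ∫ x in Ω, f x * fderiv ℝ φ x v = ∫ x, f x * fderiv ℝ φ x v :=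
  setIntegral_eq_integral_of_forall_compl_eq_zero fun x hx ↦ by
    rw [hφ.fderiv_eq_zero hx, _root_.zero_apply, mul_zero]

end TestFunction

variable {Ω : Set Plane}

theorem isClosed_H1 (Ω : Set Plane) : IsClosed (H1 Ω : Set
    (WithLp 2 (Lp ℝ 2 (volume.restrict Ω) × Lp Plane 2 (volume.restrict Ω)))) := by
  have hH1 : (H1 Ω : Set (WithLp 2 (Lp ℝ 2 (volume.restrict Ω) × Lp Plane 2 (volume.restrict Ω))))
      = ⋂ φ : {φ : Plane → ℝ // IsTestFunction Ω φ}, ⋂ v : Plane,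
      {p | ∫ x in Ω, p.fst x * fderiv ℝ φ.1 x v = - ∫ x in Ω, inner ℝ (p.snd x) v * φ.1 x} := by
    ext p
    simp only [mem_iInter, Subtype.forall]
    rfl
  rw [hH1]
  refine isClosed_iInter fun ⟨φ, hφ⟩ ↦ isClosed_iInter fun v ↦ ?_
  have hv : MemLp (fun x ↦ φ x • v) 2 (volume.restrict Ω) :=
    ((hφ.smooth.continuous.smul continuous_const).memLp_of_hasCompactSupport
      hφ.compact.smul_right).restrict Ω
  have h_left : ∀ p : WithLp 2 (Lp ℝ 2 (volume.restrict Ω) × Lp Plane 2 (volume.restrict Ω)),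
      ∫ x in Ω, p.fst x * fderiv ℝ φ x v = inner ℝ ((hφ.memLp_fderiv v).toLp _) p.fst := fun p ↦ by
    rw [inner_toLp_left]
    rfl
  have h_right : ∀ p : WithLp 2 (Lp ℝ 2 (volume.restrict Ω) × Lp Plane 2 (volume.restrict Ω)),
      ∫ x in Ω, inner ℝ (p.snd x) v * φ x = inner ℝ (hv.toLp _) p.snd := fun p ↦ by
    rw [inner_toLp_left]
    refine integral_congr_ae (Eventually.of_forall fun x ↦ ?_)
    simp only [real_inner_smul_left]
    rw [real_inner_comm, mul_comm]
  simp only [h_left, h_right]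
  exact isClosed_eq (continuous_const.inner (WithLp.fstL 2 ℝ _ _).continuous)
    (continuous_const.inner (WithLp.sndL 2 ℝ _ _).continuous).neg

instance completeSpace_H1 (Ω : Set Plane) : CompleteSpace (H1 Ω) :=
  (isClosed_H1 Ω).completeSpace_coe

instance isClosed_H10 (Ω : Set Plane) : IsClosed (H10 Ω : Set (H1 Ω)) :=
  Submodule.isClosed_topologicalClosure _

/-- The inclusion `H¹(Ω) → L²(Ω)` as a continuous linear map. -/
noncomputable def fnCLM (Ω : Set Plane) : H1 Ω →L[ℝ] Lp ℝ 2 (volume.restrict Ω) :=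
  (WithLp.fstL 2 ℝ _ _).comp (H1 Ω).subtypeL

/-- The weak gradient `H¹(Ω) → L²(Ω; ℝ²)` as a continuous linear map. -/
noncomputable def gradCLM (Ω : Set Plane) : H1 Ω →L[ℝ] Lp Plane 2 (volume.restrict Ω) :=
  (WithLp.sndL 2 ℝ _ _).comp (H1 Ω).subtypeL

theorem norm_sq_H1 (u : H1 Ω) : ‖u‖ ^ 2 = ‖fn u‖ ^ 2 + ‖grad u‖ ^ 2 :=
  WithLp.prod_norm_sq_eq_of_L2 u.1

theorem H1_ext {u v : H1 Ω} (h_fn : fn u = fn v) (h_grad : grad u = grad v) : u = v :=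
  Subtype.ext (WithLp.ofLp_injective 2 (Prod.ext h_fn h_grad))

theorem fn_add (u v : H1 Ω) : fn (u + v) =ᵐ[volume.restrict Ω] fun x ↦ fn u x + fn v x :=
  Lp.coeFn_add (fn u) (fn v)

theorem fn_sub (u v : H1 Ω) : fn (u - v) =ᵐ[volume.restrict Ω] fun x ↦ fn u x - fn v x :=
  Lp.coeFn_sub (fn u) (fn v)

theorem fn_smul (c : ℝ) (u : H1 Ω) : fn (c • u) =ᵐ[volume.restrict Ω] fun x ↦ c * fn u x :=
  Lp.coeFn_smul c (fn u)

theorem fn_zero : fn (0 : H1 Ω) =ᵐ[volume.restrict Ω] fun _ ↦ 0 :=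
  Lp.coeFn_zero ℝ 2 (volume.restrict Ω)

theorem grad_sub (u v : H1 Ω) : grad (u - v) =ᵐ[volume.restrict Ω] fun x ↦ grad u x - grad v x :=
  Lp.coeFn_sub (grad u) (grad v)

section WeakGradient

variable {W : Set Plane} {φ g : Plane → ℝ}

theorem integral_inner_grad_mul (hW : IsOpen W) (hWΩ : W ⊆ Ω) (u : H1 Ω) (hφ : ContDiffOn ℝ 1 φ W)
    (h : ∀ᵐ x ∂(volume.restrict Ω), x ∈ W → fn u x = φ x) (hg : IsTestFunction W g) (v : Plane) :
    ∫ x, inner ℝ (grad u x) v * g x = ∫ x, fderiv ℝ φ x v * g x := by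
  have hgΩ : IsTestFunction Ω g := hg.mono hWΩ
  have h_fn : ∫ x in Ω, fn u x * fderiv ℝ g x v = ∫ x in Ω, φ x * fderiv ℝ g x v := by
    refine integral_congr_ae ?_
    filter_upwards [h] with x hx
    by_cases hxW : x ∈ W
    · rw [hx hxW]
    · simp only [hg.fderiv_eq_zero hxW, _root_.zero_apply, mul_zero]
  have h_parts : ∫ x, φ x * fderiv ℝ g x v = - ∫ x, fderiv ℝ φ x v * g x :=
    integral_mul_fderiv_eq_neg_of_tsupport_subset hW hφ (hg.smooth.of_le (by simp)) hg.compact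
      hg.supp v
  have h_weak : ∫ x in Ω, fn u x * fderiv ℝ g x v = - ∫ x in Ω, inner ℝ (grad u x) v * g x :=
    u.2 g hgΩ v
  rwa [h_fn, hgΩ.setIntegral_mul_fderiv, h_parts, hgΩ.setIntegral_mul, neg_inj, eq_comm] at h_weak

theorem ae_inner_grad_eq_fderiv (hW : IsOpen W) (hWΩ : W ⊆ Ω) (u : H1 Ω)
    (hφ : ContDiffOn ℝ 1 φ W) (h : ∀ᵐ x ∂(volume.restrict Ω), x ∈ W → fn u x = φ x)
    (v : Plane) : ∀ᵐ x, x ∈ W → inner ℝ (grad u x) v - fderiv ℝ φ x v = 0 := by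
  have hφ' : ContinuousOn (fun x ↦ fderiv ℝ φ x v) W :=
    (hφ.continuousOn_fderiv_of_isOpen hW le_rfl).clm_apply continuousOn_const
  have hu : LocallyIntegrableOn (fun x ↦ inner ℝ (grad u x) v) W := by
    refine locallyIntegrableOn_of_locallyIntegrable_restrict (MemLp.locallyIntegrable
      (p := 2) ?_ (by norm_num))
    exact ((Lp.memLp (grad u)).inner_const v).mono_measure (Measure.restrict_mono hWΩ le_rfl)
  refine hW.ae_eq_zero_of_integral_contDiff_smul_eq_zero
    (hu.sub (hφ'.locallyIntegrableOn hW.measurableSet)) fun g hg hgc hgW ↦ ?_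
  have hg_test : IsTestFunction W g := ⟨hg, hgc, hgW⟩
  have hi_grad : Integrable (fun x ↦ inner ℝ (grad u x) v * g x) :=
    IntegrableOn.integrable_of_forall_notMem_eq_zero (s := Ω)
      (integrable_right (hg_test.mono hWΩ) (grad u) v) fun x hx ↦ by
        rw [(hg_test.mono hWΩ).eq_zero hx, mul_zero]
  have hi_fderiv : Integrable (fun x ↦ fderiv ℝ φ x v * g x) :=
    integrable_mul_of_tsupport_subset hW hφ' hg.continuous hgc hgW
  calc ∫ x, g x • (inner ℝ (grad u x) v - fderiv ℝ φ x v)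
      = ∫ x, (inner ℝ (grad u x) v * g x - fderiv ℝ φ x v * g x) := by
        simp only [smul_eq_mul, mul_sub, mul_comm]
    _ = 0 := by
        rw [integral_sub hi_grad hi_fderiv, integral_inner_grad_mul hW hWΩ u hφ h hg_test v,
          sub_self]

theorem grad_eq_gradient (hW : IsOpen W) (hWΩ : W ⊆ Ω) (u : H1 Ω) (hφ : ContDiffOn ℝ 1 φ W)
    (h : ∀ᵐ x ∂(volume.restrict Ω), x ∈ W → fn u x = φ x) :
    ∀ᵐ x ∂(volume.restrict Ω), x ∈ W → grad u x = ∇ φ x := by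
  let b := EuclideanSpace.basisFun (Fin 2) ℝ
  refine ae_restrict_of_ae ?_
  filter_upwards [ae_all_iff.2 fun i ↦ ae_inner_grad_eq_fderiv hW hWΩ u hφ h (b i)] with x hx hxW
  refine ext_inner_right_basis (𝕜 := ℝ) b.toBasis fun i ↦ ?_
  rw [b.coe_toBasis, inner_gradient_left, sub_eq_zero.1 (hx i hxW)]

theorem grad_eq_zero_of_fn_eq_zero (hW : IsOpen W) (hWΩ : W ⊆ Ω) (u : H1 Ω)
    (h : ∀ᵐ x ∂(volume.restrict Ω), x ∈ W → fn u x = 0) :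
    ∀ᵐ x ∂(volume.restrict Ω), x ∈ W → grad u x = 0 := by
  filter_upwards [grad_eq_gradient hW hWΩ u contDiffOn_const h] with x hx hxW
  rw [hx hxW, gradient_fun_const]

end WeakGradient

section Smooth

variable {φ : Plane → ℝ}

theorem memLp_of_contDiff (Ω : Set Plane) (hφ : ContDiff ℝ 1 φ) (hc : HasCompactSupport φ) :
    MemLp φ 2 (volume.restrict Ω) :=
  (hφ.continuous.memLp_of_hasCompactSupport hc).restrict Ω

theorem memLp_gradient (Ω : Set Plane) (hφ : ContDiff ℝ 1 φ) (hc : HasCompactSupport φ) :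
    MemLp (∇ φ) 2 (volume.restrict Ω) := by
  have h : Continuous (∇ φ) :=
    continuousOn_univ.1 (continuousOn_gradient hφ.contDiffOn isOpen_univ)
  exact (h.memLp_of_hasCompactSupport (hasCompactSupport_gradient hc)).restrict Ω

theorem isWeakGrad_gradient (Ω : Set Plane) (hφ : ContDiff ℝ 1 φ) (hc : HasCompactSupport φ) :
    IsWeakGrad Ω ((memLp_of_contDiff Ω hφ hc).toLp φ) ((memLp_gradient Ω hφ hc).toLp (∇ φ)) := by
  intro ψ hψ v
  have h_fn : ∫ x in Ω, ((memLp_of_contDiff Ω hφ hc).toLp φ) x * fderiv ℝ ψ x v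
      = ∫ x in Ω, φ x * fderiv ℝ ψ x v := by
    refine integral_congr_ae ?_
    filter_upwards [(memLp_of_contDiff Ω hφ hc).coeFn_toLp] with x hx
    rw [hx]
  have h_grad : ∫ x in Ω, inner ℝ (((memLp_gradient Ω hφ hc).toLp (∇ φ)) x) v * ψ x
      = ∫ x in Ω, fderiv ℝ φ x v * ψ x := by
    refine integral_congr_ae ?_
    filter_upwards [(memLp_gradient Ω hφ hc).coeFn_toLp] with x hx
    rw [hx, inner_gradient_left]
  rw [h_fn, h_grad, hψ.setIntegral_mul_fderiv, hψ.setIntegral_mul]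
  exact integral_mul_fderiv_eq_neg_of_tsupport_subset isOpen_univ hφ.contDiffOn
    (hψ.smooth.of_le (by simp)) hψ.compact (subset_univ _) v

/-- The restriction to `Ω` of a compactly supported `C¹` function, as an element of `H¹(Ω)`. -/
noncomputable def ofContDiff (Ω : Set Plane) (hφ : ContDiff ℝ 1 φ) (hc : HasCompactSupport φ) :
    H1 Ω :=
  ⟨WithLp.toLp 2 ((memLp_of_contDiff Ω hφ hc).toLp φ, (memLp_gradient Ω hφ hc).toLp (∇ φ)),
    isWeakGrad_gradient Ω hφ hc⟩

theorem fn_ofContDiff (hφ : ContDiff ℝ 1 φ) (hc : HasCompactSupport φ) :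
    fn (ofContDiff Ω hφ hc) =ᵐ[volume.restrict Ω] φ :=
  (memLp_of_contDiff Ω hφ hc).coeFn_toLp

theorem grad_ofContDiff (hφ : ContDiff ℝ 1 φ) (hc : HasCompactSupport φ) :
    grad (ofContDiff Ω hφ hc) =ᵐ[volume.restrict Ω] ∇ φ :=
  (memLp_gradient Ω hφ hc).coeFn_toLp

/-- A test function as an element of `H¹(Ω)`. -/
noncomputable def IsTestFunction.toH1 (hφ : IsTestFunction Ω φ) : H1 Ω :=
  ofContDiff Ω (hφ.smooth.of_le (by simp)) hφ.compact

theorem IsTestFunction.fn_toH1 (hφ : IsTestFunction Ω φ) : fn hφ.toH1 =ᵐ[volume.restrict Ω] φ :=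
  fn_ofContDiff _ _

theorem IsTestFunction.grad_toH1 (hφ : IsTestFunction Ω φ) :
    grad hφ.toH1 =ᵐ[volume.restrict Ω] ∇ φ :=
  grad_ofContDiff _ _

theorem IsTestFunction.toH1_mem_H10 (hφ : IsTestFunction Ω φ) : hφ.toH1 ∈ H10 Ω :=
  Submodule.le_topologicalClosure _ (Submodule.subset_span ⟨φ, hφ, hφ.fn_toH1⟩)

theorem exists_isTestFunction_of_mem_span {w : H1 Ω} (hw : w ∈ Submodule.span ℝ
    {w : H1 Ω | ∃ φ, IsTestFunction Ω φ ∧ fn w =ᵐ[volume.restrict Ω] φ}) :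
    ∃ φ, IsTestFunction Ω φ ∧ fn w =ᵐ[volume.restrict Ω] φ := by
  induction hw using Submodule.span_induction with
  | mem _ hw => exact hw
  | zero =>
    exact ⟨fun _ ↦ 0, ⟨contDiff_const, HasCompactSupport.zero, by simp [tsupport]⟩, fn_zero⟩
  | add u v _ _ hu hv =>
    obtain ⟨φ, hφ, hu⟩ := hu
    obtain ⟨ψ, hψ, hv⟩ := hv
    refine ⟨_, hφ.add hψ, ?_⟩
    filter_upwards [fn_add u v, hu, hv] with x h hux hvx
    rw [h, hux, hvx]
  | smul c u _ hu =>
    obtain ⟨φ, hφ, hu⟩ := hu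
    refine ⟨_, hφ.const_mul c, ?_⟩
    filter_upwards [fn_smul c u, hu] with x h hux
    rw [h, hux]

theorem H10_induction {P : H1 Ω → Prop} (hP : IsClosed {u | P u})
    (h : ∀ φ (hφ : IsTestFunction Ω φ), P hφ.toH1) (hΩ : IsOpen Ω) {u : H1 Ω} (hu : u ∈ H10 Ω) :
    P u := by
  refine closure_minimal (s := (Submodule.span ℝ {w : H1 Ω | ∃ φ, IsTestFunction Ω φ ∧
    fn w =ᵐ[volume.restrict Ω] φ} : Set (H1 Ω))) (fun w hw ↦ ?_) hP hu
  obtain ⟨φ, hφ, hwφ⟩ := exists_isTestFunction_of_mem_span hw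
  suffices w = hφ.toH1 from this ▸ h φ hφ
  refine H1_ext (Lp.ext (hwφ.trans hφ.fn_toH1.symm)) (Lp.ext ?_)
  have h_grad := grad_eq_gradient hΩ le_rfl w (hφ.smooth.of_le (by simp)).contDiffOn
    (hwφ.mono fun x hx _ ↦ hx)
  filter_upwards [h_grad, hφ.grad_toH1, ae_restrict_mem hΩ.measurableSet] with x hx hx' hxΩ
  rw [hx hxΩ, hx']

end Smooth

/-! ### The Dirichlet problem -/

section CoerciveForms

variable {H : Type*} [NormedAddCommGroup H] [InnerProductSpace ℝ H] {K : Submodule ℝ H} {c : ℝ}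

theorem exists_of_coercive {V : Type*} [NormedAddCommGroup V] [InnerProductSpace ℝ V]
    [CompleteSpace V] (B : V →L[ℝ] V →L[ℝ] ℝ) (hB : IsCoercive B) (f : V →L[ℝ] ℝ) :
    ∃ v, ∀ w, B v w = f w :=
  ⟨hB.continuousLinearEquivOfBilin.symm ((toDual ℝ V).symm f), fun w ↦ by
    rw [← hB.continuousLinearEquivOfBilin_apply, ContinuousLinearEquiv.apply_symm_apply,
      toDual_symm_apply]⟩

theorem exists_of_coercive_on (hK : IsComplete (K : Set H)) (B : H →L[ℝ] H →L[ℝ] ℝ) (hc : 0 < c)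
    (hB : ∀ w ∈ K, c * ‖w‖ ^ 2 ≤ B w w) (f : H →L[ℝ] ℝ) :
    ∃ w ∈ K, ∀ φ ∈ K, B w φ = f φ := by
  have : CompleteSpace K := hK.completeSpace_coe
  have hB_coercive : IsCoercive (B.bilinearComp K.subtypeL K.subtypeL) := by
    refine ⟨c, hc, fun w ↦ ?_⟩
    rw [mul_assoc, ← sq]
    exact hB w w.2
  obtain ⟨w, hw⟩ := exists_of_coercive _ hB_coercive (f.comp K.subtypeL)
  exact ⟨w, w.2, fun φ hφ ↦ hw ⟨φ, hφ⟩⟩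

theorem exists_sub_mem_forall_inner_eq_zero {F : Type*} [NormedAddCommGroup F]
    [InnerProductSpace ℝ F] (hK : IsComplete (K : Set H)) (G : H →L[ℝ] F) (hc : 0 < c)
    (hG : ∀ w ∈ K, c * ‖w‖ ^ 2 ≤ ‖G w‖ ^ 2) (u : H) :
    ∃ v, v - u ∈ K ∧ ∀ φ ∈ K, inner ℝ (G v) (G φ) = 0 := by
  obtain ⟨w, hwK, hw⟩ := exists_of_coercive_on hK ((innerSL ℝ).bilinearComp G G) hc
    (fun w hw ↦ (hG w hw).trans_eq (real_inner_self_eq_norm_sq _).symm)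
    ((innerSL ℝ (G u)).comp G)
  refine ⟨u - w, by simpa using hwK, fun φ hφ ↦ ?_⟩
  have h_inner : inner ℝ (G w) (G φ) = inner ℝ (G u) (G φ) := hw φ hφ
  rw [map_sub, inner_sub_left, h_inner, sub_self]

end CoerciveForms

section Poincare

variable {Ω : Set Plane}

/-- In the plane, `2` is the Sobolev exponent of `1`. -/
theorem IsTestFunction.eLpNorm_le {φ : Plane → ℝ} (hφ : IsTestFunction Ω φ) :
    eLpNorm φ 2 (volume.restrict Ω) ≤ eLpNormLESNormFDerivOneConst (volume : Measure Plane) 2 *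
      volume Ω ^ (1 / 2 : ℝ) * eLpNorm (∇ φ) 2 (volume.restrict Ω) := by
  have h_conj : NNReal.HolderConjugate (Module.finrank ℝ Plane) 2 := by
    rw [finrank_euclideanSpace, Fintype.card_fin]
    norm_num [NNReal.holderConjugate_iff]
  have h_support : Function.support (∇ φ) ⊆ Ω := fun x hx ↦ by
    by_contra hxΩ
    exact hx (by rw [gradient, hφ.fderiv_eq_zero hxΩ, map_zero])
  have h_norm : eLpNorm (fderiv ℝ φ) 1 volume = eLpNorm (∇ φ) 1 (volume.restrict Ω) := by
    rw [eLpNorm_restrict_eq_of_support_subset h_support]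
    exact eLpNorm_congr_norm_ae (Eventually.of_forall fun x ↦ (norm_gradient φ x).symm)
  have hφ₁ : ContDiff ℝ 1 φ := hφ.smooth.of_le (by simp)
  have h_holder := eLpNorm_le_eLpNorm_mul_rpow_measure_univ (p := 1) (q := 2) (by norm_num)
    (memLp_gradient Ω hφ₁ hφ.compact).1
  have h_exp : 1 / (1 : ℝ≥0∞).toReal - 1 / (2 : ℝ≥0∞).toReal = 1 / 2 := by norm_num
  rw [Measure.restrict_apply_univ, h_exp] at h_holder
  calc eLpNorm φ 2 (volume.restrict Ω) ≤ eLpNorm φ 2 volume :=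
        eLpNorm_mono_measure _ Measure.restrict_le_self
    _ ≤ eLpNormLESNormFDerivOneConst (volume : Measure Plane) 2 * eLpNorm (fderiv ℝ φ) 1 volume :=
      eLpNorm_le_eLpNorm_fderiv_one volume hφ₁ hφ.compact h_conj
    _ ≤ eLpNormLESNormFDerivOneConst (volume : Measure Plane) 2 *
        (eLpNorm (∇ φ) 2 (volume.restrict Ω) * volume Ω ^ (1 / 2 : ℝ)) := by
      rw [h_norm]
      gcongr
    _ = _ := by ring

theorem exists_norm_fn_le (hΩ : IsOpen Ω) (hb : Bornology.IsBounded Ω) :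
    ∃ C : ℝ, ∀ u ∈ H10 Ω, ‖fn u‖ ≤ C * ‖grad u‖ := by
  refine ⟨(eLpNormLESNormFDerivOneConst (volume : Measure Plane) 2 *
    volume Ω ^ (1 / 2 : ℝ)).toReal, fun u hu ↦ ?_⟩
  refine H10_induction (P := fun u ↦ ‖fn u‖ ≤ _ * ‖grad u‖) (isClosed_le (fnCLM Ω).continuous.norm
    (continuous_const.mul (gradCLM Ω).continuous.norm)) (fun φ hφ ↦ ?_) hΩ hu
  have hφ₁ : ContDiff ℝ 1 φ := hφ.smooth.of_le (by simp)
  have h_fn : ‖fn hφ.toH1‖ = (eLpNorm φ 2 (volume.restrict Ω)).toReal :=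
    Lp.norm_toLp _ (memLp_of_contDiff Ω hφ₁ hφ.compact)
  have h_grad : ‖grad hφ.toH1‖ = (eLpNorm (∇ φ) 2 (volume.restrict Ω)).toReal :=
    Lp.norm_toLp _ (memLp_gradient Ω hφ₁ hφ.compact)
  rw [h_fn, h_grad, ← ENNReal.toReal_mul]
  refine ENNReal.toReal_mono (ENNReal.mul_ne_top (ENNReal.mul_ne_top ENNReal.coe_ne_top ?_)
    (memLp_gradient Ω hφ₁ hφ.compact).2.ne) hφ.eLpNorm_le
  exact ENNReal.rpow_ne_top_of_nonneg (by norm_num) hb.measure_lt_top.ne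

theorem exists_norm_sq_le_norm_grad_sq (hΩ : IsOpen Ω) (hb : Bornology.IsBounded Ω) :
    ∃ c : ℝ, 0 < c ∧ ∀ u ∈ H10 Ω, c * ‖u‖ ^ 2 ≤ ‖grad u‖ ^ 2 := by
  obtain ⟨C, hC⟩ := exists_norm_fn_le hΩ hb
  refine ⟨(C ^ 2 + 1)⁻¹, by positivity, fun u hu ↦ ?_⟩
  have h_fn : ‖fn u‖ ^ 2 ≤ C ^ 2 * ‖grad u‖ ^ 2 := by
    rw [← mul_pow]
    exact pow_le_pow_left₀ (norm_nonneg _) (hC u hu) 2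
  rw [inv_mul_le_iff₀ (by positivity), norm_sq_H1]
  linarith

theorem exists_dirichlet_solution (hΩ : IsOpen Ω) (hb : Bornology.IsBounded Ω) (u : H1 Ω) :
    ∃ v : H1 Ω, v - u ∈ H10 Ω ∧ ∀ φ ∈ H10 Ω, inner ℝ (grad v) (grad φ) = 0 := by
  obtain ⟨c, hc, hP⟩ := exists_norm_sq_le_norm_grad_sq hΩ hb
  exact exists_sub_mem_forall_inner_eq_zero (isClosed_H10 Ω).isComplete (gradCLM Ω) hc hP u

end Poincare

section WeakLaplacian

variable {Ω : Set Plane} {φ ψ : Plane → ℝ}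

theorem IsTestFunction.fderiv_apply (hφ : IsTestFunction Ω φ) (v : Plane) :
    IsTestFunction Ω fun x ↦ fderiv ℝ φ x v :=
  ⟨(hφ.smooth.fderiv_right (m := ∞) (by simp)).clm_apply contDiff_const,
    hφ.compact.fderiv_apply ℝ v, (tsupport_fderiv_apply_subset ℝ v).trans hφ.supp⟩

theorem contDiff_fderiv_apply (hψ : ContDiff ℝ 2 ψ) (v : Plane) :
    ContDiff ℝ 1 fun x ↦ fderiv ℝ ψ x v :=
  (hψ.fderiv_right (m := 1) (by norm_num)).clm_apply contDiff_const

theorem integral_fn_mul_laplacian (v : H1 Ω) (hψ : ContDiff ℝ 2 ψ) (hc : HasCompactSupport ψ)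
    (h : ∀ e : Plane, ∫ x in Ω, fn v x * fderiv ℝ (fun y ↦ fderiv ℝ ψ y e) x e
      = - ∫ x in Ω, inner ℝ (grad v x) e * fderiv ℝ ψ x e) :
    ∫ x in Ω, fn v x * Δ ψ x
      = - inner ℝ (grad v) (grad (ofContDiff Ω (hψ.of_le one_le_two) hc)) := by
  let b := EuclideanSpace.basisFun (Fin 2) ℝ
  have hψ' (e : Plane) := contDiff_fderiv_apply hψ e
  have hc' (e : Plane) : HasCompactSupport fun x ↦ fderiv ℝ ψ x e := hc.fderiv_apply ℝ e
  have h_inner : inner ℝ (grad v) (grad (ofContDiff Ω (hψ.of_le one_le_two) hc))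
      = ∑ i, ∫ x in Ω, inner ℝ (grad v x) (b i) * fderiv ℝ ψ x (b i) := by
    have h_int (i : Fin 2) : Integrable
        (fun x ↦ inner ℝ (grad v x) (b i) * fderiv ℝ ψ x (b i)) (volume.restrict Ω) :=
      ((Lp.memLp (grad v)).inner_const (b i)).integrable_mul
        (memLp_of_contDiff Ω (hψ' (b i)) (hc' (b i)))
    rw [L2.inner_def, ← integral_finsetSum _ fun i _ ↦ h_int i]
    refine integral_congr_ae ?_
    filter_upwards [grad_ofContDiff (Ω := Ω) (hψ.of_le one_le_two) hc] with x hx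
    rw [hx, ← b.sum_inner_mul_inner]
    refine Finset.sum_congr rfl fun i _ ↦ ?_
    rw [real_inner_comm (∇ ψ x), inner_gradient_left]
  have h_int (i : Fin 2) : Integrable
      (fun x ↦ fn v x * fderiv ℝ (fun y ↦ fderiv ℝ ψ y (b i)) x (b i)) (volume.restrict Ω) := by
    have h_memLp : MemLp (fun x ↦ fderiv ℝ (fun y ↦ fderiv ℝ ψ y (b i)) x (b i)) 2 :=
      (((hψ' (b i)).continuous_fderiv one_ne_zero).clm_apply
        continuous_const).memLp_of_hasCompactSupport ((hc' (b i)).fderiv_apply ℝ (b i))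
    exact (Lp.memLp (fn v)).integrable_mul (h_memLp.restrict Ω)
  simp only [laplacian_eq_sum_fderiv_fderiv b hψ, Finset.mul_sum]
  rw [integral_finsetSum _ fun i _ ↦ h_int i, h_inner, ← Finset.sum_neg_distrib]
  exact Finset.sum_congr rfl fun i _ ↦ h (b i)

theorem continuous_integral_fn_mul {g : Plane → ℝ} (hg : MemLp g 2 (volume.restrict Ω)) :
    Continuous fun u : H1 Ω ↦ ∫ x in Ω, fn u x * g x := by
  have h (u : H1 Ω) : ∫ x in Ω, fn u x * g x = inner ℝ (hg.toLp g) (fnCLM Ω u) := by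
    rw [inner_toLp_left]
    rfl
  simp only [h]
  exact continuous_const.inner (fnCLM Ω).continuous

theorem continuous_integral_inner_grad_mul (v : Plane) {g : Plane → ℝ} (hg : Continuous g)
    (hc : HasCompactSupport g) :
    Continuous fun u : H1 Ω ↦ ∫ x in Ω, inner ℝ (grad u x) v * g x := by
  have hv : MemLp (fun x ↦ g x • v) 2 (volume.restrict Ω) :=
    ((hg.smul continuous_const).memLp_of_hasCompactSupport hc.smul_right).restrict Ω
  have h (u : H1 Ω) :
      ∫ x in Ω, inner ℝ (grad u x) v * g x = inner ℝ (hv.toLp _) (gradCLM Ω u) := by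
    rw [inner_toLp_left]
    refine integral_congr_ae (Eventually.of_forall fun x ↦ ?_)
    simp only [real_inner_smul_left]
    rw [real_inner_comm, mul_comm]
    rfl
  simp only [h]
  exact continuous_const.inner (gradCLM Ω).continuous

/-- Unlike in the definition of a weak gradient, `ψ` need not vanish on the boundary of `Ω`:
functions in `H¹₀(Ω)`, extended by zero, are weakly differentiable in the whole plane. -/
theorem integral_fn_mul_fderiv_of_mem_H10 (hΩ : IsOpen Ω) {u : H1 Ω} (hu : u ∈ H10 Ω)
    (hψ : ContDiff ℝ 1 ψ) (hc : HasCompactSupport ψ) (v : Plane) :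
    ∫ x in Ω, fn u x * fderiv ℝ ψ x v = - ∫ x in Ω, inner ℝ (grad u x) v * ψ x := by
  have hψ' : MemLp (fun x ↦ fderiv ℝ ψ x v) 2 (volume.restrict Ω) :=
    (((hψ.continuous_fderiv one_ne_zero).clm_apply continuous_const).memLp_of_hasCompactSupport
      (hc.fderiv_apply ℝ v)).restrict Ω
  refine H10_induction (P := fun u ↦ ∫ x in Ω, fn u x * fderiv ℝ ψ x v
    = - ∫ x in Ω, inner ℝ (grad u x) v * ψ x) (isClosed_eq (continuous_integral_fn_mul hψ')
    (continuous_integral_inner_grad_mul v hψ.continuous hc).neg) (fun φ hφ ↦ ?_) hΩ hu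
  have h_fn : ∫ x in Ω, fn hφ.toH1 x * fderiv ℝ ψ x v = ∫ x, fderiv ℝ ψ x v * φ x := by
    rw [← hφ.setIntegral_mul]
    refine integral_congr_ae ?_
    filter_upwards [hφ.fn_toH1] with x hx
    rw [hx, mul_comm]
  have h_grad : ∫ x in Ω, inner ℝ (grad hφ.toH1 x) v * ψ x = ∫ x, ψ x * fderiv ℝ φ x v := by
    rw [← hφ.setIntegral_mul_fderiv]
    refine integral_congr_ae ?_
    filter_upwards [hφ.grad_toH1] with x hx
    rw [hx, inner_gradient_left, mul_comm]
  rw [h_fn, h_grad, integral_mul_fderiv_eq_neg_of_tsupport_subset isOpen_univ hψ.contDiffOn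
    (hφ.smooth.of_le (by simp)) hφ.compact (subset_univ _) v, neg_neg]

theorem integral_fn_mul_laplacian_of_mem_H10 (hΩ : IsOpen Ω) {w : H1 Ω} (hw : w ∈ H10 Ω)
    (hψ : ContDiff ℝ 2 ψ) (hc : HasCompactSupport ψ) :
    ∫ x in Ω, fn w x * Δ ψ x
      = - inner ℝ (grad w) (grad (ofContDiff Ω (hψ.of_le one_le_two) hc)) :=
  integral_fn_mul_laplacian w hψ hc fun e ↦
    integral_fn_mul_fderiv_of_mem_H10 hΩ hw (contDiff_fderiv_apply hψ e) (hc.fderiv_apply ℝ e) e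

theorem IsTestFunction.integral_fn_mul_laplacian (hψ : IsTestFunction Ω ψ) (v : H1 Ω) :
    ∫ x in Ω, fn v x * Δ ψ x = - inner ℝ (grad v) (grad hψ.toH1) :=
  AntiplaneShear.integral_fn_mul_laplacian v (hψ.smooth.of_le (by norm_cast)) hψ.compact
    fun e ↦ v.2 _ (hψ.fderiv_apply e) e

/-- The extension by zero to the plane of the function underlying an element of `H¹(Ω)`. -/
noncomputable def zeroExtension (u : H1 Ω) : Plane → ℝ := Ω.indicator (fn u)

theorem integrable_zeroExtension (hΩ : IsOpen Ω) (hb : Bornology.IsBounded Ω) (u : H1 Ω) :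
    Integrable (zeroExtension u) := by
  have : IsFiniteMeasure (volume.restrict Ω) := ⟨by
    rw [Measure.restrict_apply_univ]
    exact hb.measure_lt_top⟩
  have h : IntegrableOn (fn u) Ω := (Lp.memLp (fn u)).integrable one_le_two
  exact h.integrable_indicator hΩ.measurableSet

theorem integral_zeroExtension_mul (hΩ : IsOpen Ω) (u : H1 Ω) (g : Plane → ℝ) :
    ∫ x, zeroExtension u x * g x = ∫ x in Ω, fn u x * g x := by
  rw [← integral_indicator hΩ.measurableSet]
  simp only [zeroExtension, indicator_mul_left]

theorem exists_contDiffOn_of_dirichlet (hΩ : IsOpen Ω) (hb : Bornology.IsBounded Ω) {v : H1 Ω}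
    (hv : ∀ φ ∈ H10 Ω, inner ℝ (grad v) (grad φ) = 0) :
    ∃ h : Plane → ℝ, ContDiffOn ℝ ∞ h Ω ∧ fn v =ᵐ[volume.restrict Ω] h := by
  have hw : IsWeaklyHarmonic Ω (zeroExtension v) := fun ψ hψ ↦ by
    rw [integral_zeroExtension_mul hΩ, hψ.integral_fn_mul_laplacian, hv _ hψ.toH1_mem_H10,
      neg_zero]
  obtain ⟨h, hh, hae⟩ :=
    hw.exists_harmonicOnNhd hΩ (integrable_zeroExtension hΩ hb v).locallyIntegrable
  refine ⟨h, (analyticOnNhd_of_harmonicOnNhd hh).contDiffOn hΩ.uniqueDiffOn, ?_⟩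
  filter_upwards [ae_restrict_of_ae hae, ae_restrict_mem hΩ.measurableSet] with x hx hxΩ
  rw [← hx hxΩ, zeroExtension, indicator_of_mem hxΩ]

end WeakLaplacian

/-! ### The trace on the curve -/

theorem norm_snd_le_of_mem_closure {H F : Type*} [NormedAddCommGroup H] [NormedAddCommGroup F]
    {C : ℝ≥0} {S : Set (H × F)} {u : H} (h : ∀ p ∈ S, ‖p.2‖ ≤ C * ‖p.1 - u‖) :
    ∀ p ∈ closure S, ‖p.2‖ ≤ C * ‖p.1 - u‖ := fun _ hp ↦
  closure_minimal (t := {p : H × F | ‖p.2‖ ≤ C * ‖p.1 - u‖}) h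
    (isClosed_le continuous_snd.norm
      (continuous_const.mul (continuous_fst.sub continuous_const).norm)) hp

section ClosedGraph

variable {H F : Type*} [NormedAddCommGroup H] [NormedSpace ℝ H] [NormedAddCommGroup F]
  [NormedSpace ℝ F] {G : Submodule ℝ (H × F)} {C : ℝ≥0}

theorem eq_of_mem_of_norm_snd_le (hG : ∀ p ∈ G, ‖p.2‖ ≤ C * ‖p.1‖) {u : H} {g g' : F}
    (h : (u, g) ∈ G) (h' : (u, g') ∈ G) : g = g' := by
  have h_sub := hG _ (G.sub_mem h h')
  simp only [Prod.mk_sub_mk, sub_self, norm_zero, mul_zero] at h_sub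
  exact sub_eq_zero.1 (norm_le_zero_iff.1 h_sub)

theorem isClosed_map_fst_of_norm_snd_le [CompleteSpace H] [CompleteSpace F]
    (hGc : IsClosed (G : Set (H × F))) (hG : ∀ p ∈ G, ‖p.2‖ ≤ C * ‖p.1‖) :
    IsClosed (Prod.fst '' (G : Set (H × F))) := by
  have : CompleteSpace G := hGc.completeSpace_coe
  let f : G →L[ℝ] H := (ContinuousLinearMap.fst ℝ H F).comp G.subtypeL
  have hf : AntilipschitzWith (max 1 C) f := by
    refine f.antilipschitz_of_bound fun p ↦ ?_
    rw [Submodule.coe_norm, Prod.norm_def, NNReal.coe_max, NNReal.coe_one]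
    refine max_le ?_ ((hG p p.2).trans ?_)
    · exact le_mul_of_one_le_left (norm_nonneg _) (le_max_left _ _)
    · exact mul_le_mul_of_nonneg_right (le_max_right _ _) (norm_nonneg _)
  have h_range : range f = Prod.fst '' (G : Set (H × F)) := by
    rw [image_eq_range]
    rfl
  exact h_range ▸ hf.isClosed_range f.uniformContinuous

theorem exists_clm_of_norm_snd_le [CompleteSpace H] [CompleteSpace F]
    (hGc : IsClosed (G : Set (H × F))) (hG : ∀ p ∈ G, ‖p.2‖ ≤ C * ‖p.1‖)
    (hd : Dense (Prod.fst '' (G : Set (H × F)))) :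
    ∃ T : H →L[ℝ] F, ∀ u g, (u, g) ∈ G ↔ g = T u := by
  have h_exists (u : H) : ∃ g, (u, g) ∈ G := by
    obtain ⟨p, hp, rfl⟩ := (isClosed_map_fst_of_norm_snd_le hGc hG).closure_subset (hd u)
    exact ⟨p.2, hp⟩
  choose t ht using h_exists
  let T : H →ₗ[ℝ] F :=
    { toFun := t
      map_add' := fun u v ↦ eq_of_mem_of_norm_snd_le hG (ht _) (G.add_mem (ht u) (ht v))
      map_smul' := fun c u ↦ eq_of_mem_of_norm_snd_le hG (ht _) (G.smul_mem c (ht u)) }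
  refine ⟨T.mkContinuous C fun u ↦ hG _ (ht u), fun u g ↦
    ⟨fun h ↦ eq_of_mem_of_norm_snd_le hG h (ht u), ?_⟩⟩
  rintro rfl
  exact ht u

theorem mem_closure_fst_of_sub_mem {A : Set H} (hA : ∀ w ∈ A, ∃ g, (w, g) ∈ G) {u v : H}
    (hv : ∃ g, (v, g) ∈ G) (h : v - u ∈ (Submodule.span ℝ A).topologicalClosure) :
    u ∈ closure (Prod.fst '' (G : Set (H × F))) := by
  set K := (G.map (LinearMap.fst ℝ H F)).topologicalClosure
  have h_le : (Submodule.span ℝ A).topologicalClosure ≤ K := by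
    refine Submodule.topologicalClosure_mono (Submodule.span_le.2 fun w hw ↦ ?_)
    obtain ⟨g, hg⟩ := hA w hw
    exact ⟨_, hg, rfl⟩
  obtain ⟨g, hg⟩ := hv
  have hvK : v ∈ K := Submodule.le_topologicalClosure _ ⟨_, hg, rfl⟩
  have huK := K.sub_mem hvK (h_le h)
  rw [sub_sub_cancel] at huK
  exact huK

end ClosedGraph

section TraceInequality

variable {Ω : Set Plane}

theorem lintegral_fn_sq_add_norm_grad_sq (u : H1 Ω) :
    ∫⁻ x in Ω, ENNReal.ofReal (fn u x ^ 2 + ‖grad u x‖ ^ 2) = ENNReal.ofReal (‖u‖ ^ 2) := by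
  have h_fn : Integrable (fun x ↦ fn u x ^ 2) (volume.restrict Ω) := (Lp.memLp (fn u)).integrable_sq
  have h_grad : Integrable (fun x ↦ ‖grad u x‖ ^ 2) (volume.restrict Ω) :=
    (Lp.memLp (grad u)).integrable_norm_pow two_ne_zero
  have h_add : Integrable (fun x ↦ fn u x ^ 2 + ‖grad u x‖ ^ 2) (volume.restrict Ω) :=
    h_fn.add h_grad
  rw [← ofReal_integral_eq_lintegral_ofReal h_add
    (Eventually.of_forall fun x ↦ by positivity), integral_add h_fn h_grad, norm_sq_H1,
    norm_sq_eq_integral, norm_sq_eq_integral]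
  simp only [Real.norm_eq_abs, sq_abs]

theorem eLpNorm_two_sq {α : Type*} [MeasurableSpace α] (ν : Measure α) (f : α → ℝ) :
    eLpNorm f 2 ν ^ 2 = ∫⁻ x, ENNReal.ofReal (f x ^ 2) ∂ν := by
  have h := eLpNorm_nnreal_pow_eq_lintegral (p := 2) (μ := ν) (f := f) two_ne_zero
  simp only [NNReal.coe_ofNat, ENNReal.rpow_ofNat, ENNReal.coe_ofNat] at h
  rw [h]
  refine lintegral_congr fun s ↦ ?_
  rw [← ofReal_norm, ← ENNReal.ofReal_pow (norm_nonneg _), Real.norm_eq_abs, sq_abs]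

theorem norm_le_of_eLpNorm_le {α : Type*} [MeasurableSpace α] {ν : Measure α} {g : Lp ℝ 2 ν}
    {f : α → ℝ} (hg : g =ᵐ[ν] f) {C : ℝ≥0} {r : ℝ} (hr : 0 ≤ r)
    (h : eLpNorm f 2 ν ≤ C * ENNReal.ofReal r) : ‖g‖ ≤ C * r := by
  rw [← eLpNorm_congr_ae hg, ← ENNReal.ofReal_coe_nnreal, ← ENNReal.ofReal_mul C.coe_nonneg] at h
  exact (ENNReal.toReal_mono ENNReal.ofReal_ne_top h).trans_eq
    (ENNReal.toReal_ofReal (by positivity))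

theorem lintegral_sobolevDensity_le (hΩ : IsOpen Ω) {A : Set Plane} (hA : IsOpen A) (hAΩ : A ⊆ Ω)
    {w u : H1 Ω} {φ : Plane → ℝ} (hφ : ContDiffOn ℝ ∞ φ Ω) (hwφ : fn w =ᵐ[volume.restrict Ω] φ)
    (hu : ∀ᵐ x ∂(volume.restrict Ω), x ∈ A → fn u x = 0) :
    ∫⁻ x in A, sobolevDensity φ x ≤ ENNReal.ofReal (‖w - u‖ ^ 2) := by
  have h_grad_u := grad_eq_zero_of_fn_eq_zero hA hAΩ u hu
  have h_grad_w := grad_eq_gradient hΩ le_rfl w (hφ.of_le (by simp)) (hwφ.mono fun x hx _ ↦ hx)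
  have h_density : ∀ᵐ x ∂(volume.restrict Ω), x ∈ A → sobolevDensity φ x
      = ENNReal.ofReal (fn (w - u) x ^ 2 + ‖grad (w - u) x‖ ^ 2) := by
    filter_upwards [hu, h_grad_u, h_grad_w, hwφ, fn_sub w u, grad_sub w u]
      with x hux hgu hgw hwx h_fn h_grad hx
    rw [sobolevDensity, h_fn, h_grad, hux hx, hgu hx, hgw (hAΩ hx), hwx, sub_zero, sub_zero,
      norm_gradient]
  calc ∫⁻ x in A, sobolevDensity φ x
      = ∫⁻ x in A, ENNReal.ofReal (fn (w - u) x ^ 2 + ‖grad (w - u) x‖ ^ 2) := by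
        refine lintegral_congr_ae ?_
        filter_upwards [ae_restrict_of_ae_restrict_of_subset hAΩ h_density,
          ae_restrict_mem hA.measurableSet] with x hx hxA using hx hxA
    _ ≤ ∫⁻ x in Ω, ENNReal.ofReal (fn (w - u) x ^ 2 + ‖grad (w - u) x‖ ^ 2) :=
        lintegral_mono_set hAΩ
    _ = ENNReal.ofReal (‖w - u‖ ^ 2) := lintegral_fn_sq_add_norm_grad_sq (w - u)

variable {D N : Set Plane} {L : ℝ} {γ : ℝ → Plane}

theorem exists_eLpNorm_comp_curve_le (hD : IsSmoothDomain D)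
    (hγ : IsArclengthParam (frontier D) L γ) (hΩ : IsOpen Ω) (hN : IsOpen N)
    (hDN : frontier D ⊆ N) (hNΩ : N ⊆ Ω) :
    ∃ C : ℝ≥0, ∀ (w u : H1 Ω) (φ : Plane → ℝ), ContDiffOn ℝ ∞ φ Ω →
      fn w =ᵐ[volume.restrict Ω] φ →
      (∀ᵐ x ∂(volume.restrict Ω), x ∈ N \ closure D → fn u x = 0) →
      eLpNorm (fun s ↦ φ (γ s)) 2 (volume.restrict (Ioc 0 L)) ≤ C * ENNReal.ofReal ‖w - u‖ := by
  obtain ⟨C, hC⟩ := exists_lintegral_sq_le hD hγ hΩ hN hDN hNΩ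
  refine ⟨NNReal.sqrt C, fun w u φ hφ hwφ hu ↦ ?_⟩
  have h_density :=
    lintegral_sobolevDensity_le hΩ (hN.sdiff isClosed_closure) (sdiff_subset.trans hNΩ) hφ hwφ hu
  have h_sqrt : (C : ℝ≥0∞) = (NNReal.sqrt C : ℝ≥0∞) ^ 2 := by
    rw [← ENNReal.coe_pow, NNReal.sq_sqrt]
  refine (ENNReal.pow_le_pow_left_iff two_ne_zero).1 ?_
  rw [eLpNorm_two_sq, mul_pow, ← h_sqrt, ← ENNReal.ofReal_pow (norm_nonneg _)]
  exact (hC φ hφ).trans (mul_le_mul_right h_density _)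

end TraceInequality

section TraceMap

variable {Ω D N : Set Plane} {L : ℝ} {γ : ℝ → Plane}

theorem memLp_Ioc {f : ℝ → ℝ} (hf : Continuous f) : MemLp f 2 (volume.restrict (Ioc 0 L)) := by
  obtain ⟨C, hC⟩ := (isCompact_Icc (a := (0 : ℝ)) (b := L)).exists_bound_of_continuousOn
    hf.continuousOn
  refine MemLp.of_bound hf.aestronglyMeasurable C ?_
  filter_upwards [ae_restrict_mem measurableSet_Ioc] with s hs
  exact hC s (Ioc_subset_Icc_self hs)

/-- The pairs of a function in `H¹(Ω)` with a smooth representative and its restriction to the curve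
`γ`. The closure of this set is the graph of the trace operator. -/
def smoothTracePairs (Ω : Set Plane) (L : ℝ) (γ : ℝ → Plane) : Set (H1 Ω × L2Curve L) :=
  {p | ∃ φ : Plane → ℝ, ContDiffOn ℝ ∞ φ Ω ∧ fn p.1 =ᵐ[volume.restrict Ω] φ ∧
    p.2 =ᵐ[volume.restrict (Ioc 0 L)] fun s ↦ φ (γ s)}

/-- The set `smoothTracePairs` as a linear subspace. -/
noncomputable def smoothTraceGraph (Ω : Set Plane) (L : ℝ) (γ : ℝ → Plane) :
    Submodule ℝ (H1 Ω × L2Curve L) where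
  carrier := smoothTracePairs Ω L γ
  zero_mem' := ⟨fun _ ↦ 0, contDiffOn_const, fn_zero, Lp.coeFn_zero _ _ _⟩
  add_mem' := by
    rintro p q ⟨φ, hφ, hpφ, hpγ⟩ ⟨ψ, hψ, hqψ, hqγ⟩
    refine ⟨fun x ↦ φ x + ψ x, hφ.add hψ, ?_, ?_⟩
    · filter_upwards [fn_add p.1 q.1, hpφ, hqψ] with x h hp hq
      exact h.trans (by rw [hp, hq])
    · filter_upwards [Lp.coeFn_add p.2 q.2, hpγ, hqγ] with s h hp hq
      exact h.trans (by rw [Pi.add_apply, hp, hq])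
  smul_mem' := by
    rintro c p ⟨φ, hφ, hpφ, hpγ⟩
    refine ⟨fun x ↦ c * φ x, contDiffOn_const.mul hφ, ?_, ?_⟩
    · filter_upwards [fn_smul c p.1, hpφ] with x h hp
      exact h.trans (by rw [hp])
    · filter_upwards [Lp.coeFn_smul c p.2, hpγ] with s h hp
      exact h.trans (by rw [Pi.smul_apply, hp, smul_eq_mul])

theorem IsArclengthParam.memLp_comp (hγ : IsArclengthParam (frontier D) L γ)
    (hDΩ : closure D ⊆ Ω) {φ : Plane → ℝ} (hφ : ContinuousOn φ Ω) :
    MemLp (fun s ↦ φ (γ s)) 2 (volume.restrict (Ioc 0 L)) :=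
  memLp_Ioc (hφ.comp_continuous hγ.smooth.continuous fun s ↦
    hDΩ (frontier_subset_closure (hγ.mem s)))

theorem isCurveTrace_iff (hγ : IsArclengthParam (frontier D) L γ) (hDΩ : closure D ⊆ Ω) (u : H1 Ω)
    (g : L2Curve L) :
    IsCurveTrace L γ u g ↔ (u, g) ∈ closure (smoothTracePairs Ω L γ) := by
  rw [mem_closure_iff_seq_limit]
  constructor
  · rintro ⟨w, φ, hφ, hw, hg⟩
    have h_memLp n := hγ.memLp_comp hDΩ (hφ n).1.continuousOn
    refine ⟨fun n ↦ (w n, (h_memLp n).toLp _),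
      fun n ↦ ⟨φ n, (hφ n).1, (hφ n).2, (h_memLp n).coeFn_toLp⟩, hw.prodMk_nhds ?_⟩
    rw [Lp.tendsto_Lp_iff_tendsto_eLpNorm']
    refine hg.congr fun n ↦ eLpNorm_congr_ae ?_
    filter_upwards [(h_memLp n).coeFn_toLp] with s hs
    rw [Pi.sub_apply, hs]
  · rintro ⟨p, hp, hlim⟩
    choose φ hφ h_fn h_trace using hp
    obtain ⟨hlim₁, hlim₂⟩ := (Prod.tendsto_iff _ _).1 hlim
    refine ⟨fun n ↦ (p n).1, φ, fun n ↦ ⟨hφ n, h_fn n⟩, hlim₁, ?_⟩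
    refine ((Lp.tendsto_Lp_iff_tendsto_eLpNorm' _ _).1 hlim₂).congr fun n ↦ eLpNorm_congr_ae ?_
    filter_upwards [h_trace n] with s hs
    rw [Pi.sub_apply, hs]

theorem exists_norm_snd_le_of_mem_closure (hD : IsSmoothDomain D)
    (hγ : IsArclengthParam (frontier D) L γ) (hΩ : IsOpen Ω) (hN : IsOpen N)
    (hDN : frontier D ⊆ N) (hNΩ : N ⊆ Ω) :
    ∃ C : ℝ≥0, ∀ u : H1 Ω, (∀ᵐ x ∂(volume.restrict Ω), x ∈ N \ closure D → fn u x = 0) →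
      ∀ p ∈ closure (smoothTracePairs Ω L γ),
        ‖p.2‖ ≤ C * ‖p.1 - u‖ := by
  refine (exists_eLpNorm_comp_curve_le hD hγ hΩ hN hDN hNΩ).imp fun C hC u hu ↦
    norm_snd_le_of_mem_closure fun p hp ↦ ?_
  obtain ⟨φ, hφ, hwφ, hg⟩ := hp
  exact norm_le_of_eLpNorm_le hg (norm_nonneg _) (hC p.1 u φ hφ hwφ hu)

theorem dense_fst_smoothTracePairs (hΩ : IsOpen Ω) (hb : Bornology.IsBounded Ω)
    (hγ : IsArclengthParam (frontier D) L γ) (hDΩ : closure D ⊆ Ω) :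
    Dense (Prod.fst '' (smoothTracePairs Ω L γ)) := by
  have h_smooth (w : H1 Ω) {φ : Plane → ℝ} (hφ : ContDiffOn ℝ ∞ φ Ω)
      (hw : fn w =ᵐ[volume.restrict Ω] φ) : ∃ g, (w, g) ∈ smoothTracePairs Ω L γ :=
    ⟨(hγ.memLp_comp hDΩ hφ.continuousOn).toLp _, φ, hφ, hw,
      (hγ.memLp_comp hDΩ hφ.continuousOn).coeFn_toLp⟩
  intro u
  obtain ⟨v, hv, h_orth⟩ := exists_dirichlet_solution hΩ hb u
  obtain ⟨h, hh, hvh⟩ := exists_contDiffOn_of_dirichlet hΩ hb h_orth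
  refine mem_closure_fst_of_sub_mem (G := smoothTraceGraph Ω L γ)
    (A := {w : H1 Ω | ∃ φ, IsTestFunction Ω φ ∧ fn w =ᵐ[volume.restrict Ω] φ})
    ?_ (h_smooth v hh hvh) hv
  rintro w ⟨φ, hφ, hw⟩
  exact h_smooth w hφ.smooth.contDiffOn hw

theorem exists_clm_mem_closure_smoothTracePairs (hΩ : IsOpen Ω) (hb : Bornology.IsBounded Ω)
    (hD : IsSmoothDomain D) (hγ : IsArclengthParam (frontier D) L γ) (hDΩ : closure D ⊆ Ω) :
    ∃ T : H1 Ω →L[ℝ] L2Curve L, ∀ u g, (u, g) ∈ closure (smoothTracePairs Ω L γ) ↔ g = T u := by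
  obtain ⟨C, hC⟩ :=
    exists_norm_snd_le_of_mem_closure hD hγ hΩ hΩ (frontier_subset_closure.trans hDΩ) le_rfl
  have h_zero : ∀ᵐ x ∂(volume.restrict Ω), x ∈ Ω \ closure D → fn (0 : H1 Ω) x = 0 :=
    fn_zero.mono fun x hx _ ↦ hx
  have h_le (p) (hp : p ∈ closure (smoothTracePairs Ω L γ)) : ‖p.2‖ ≤ C * ‖p.1‖ := by
    simpa only [sub_zero] using hC 0 h_zero p hp
  exact exists_clm_of_norm_snd_le (G := (smoothTraceGraph Ω L γ).topologicalClosure)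
    (Submodule.isClosed_topologicalClosure _) h_le
    ((dense_fst_smoothTracePairs hΩ hb hγ hDΩ).mono (image_mono subset_closure))

theorem exists_traceMap (hΩ : IsOpen Ω) (hb : Bornology.IsBounded Ω) (hD : IsSmoothDomain D)
    (hγ : IsArclengthParam (frontier D) L γ) (hDΩ : closure D ⊆ Ω) :
    ∃ T : H1 Ω →L[ℝ] L2Curve L, (∀ u g, IsCurveTrace L γ u g ↔ g = T u) ∧
      ∀ N, IsOpen N → frontier D ⊆ N → N ⊆ Ω → ∀ u : H1 Ω,
        (∀ᵐ x ∂(volume.restrict Ω), x ∈ N \ closure D → fn u x = 0) → T u = 0 := by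
  refine (exists_clm_mem_closure_smoothTracePairs hΩ hb hD hγ hDΩ).imp fun T hT ↦
    ⟨fun u g ↦ (isCurveTrace_iff hγ hDΩ u g).trans (hT u g), fun N hN hDN hNΩ u hu ↦ ?_⟩
  obtain ⟨C, hC⟩ := exists_norm_snd_le_of_mem_closure hD hγ hΩ hN hDN hNΩ
  simpa using hC u hu (u, T u) ((hT u (T u)).2 rfl)

end TraceMap

/-! ### Symmetric forms and duality -/

section Duality

variable {X : Type*} [NormedAddCommGroup X] [InnerProductSpace ℝ X] {K : Submodule ℝ X}
  {B B' : X →L[ℝ] X →L[ℝ] ℝ} {c r : ℝ} {N : Set X} {φ : X}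

theorem eq_zero_of_coercive_on (hc : 0 < c) (hB : ∀ k ∈ K, c * ‖k‖ ^ 2 ≤ B k k) {d : X}
    (hd : d ∈ K) (h : B d d ≤ 0) : d = 0 :=
  norm_eq_zero.1 <| pow_eq_zero_iff two_ne_zero |>.1 <|
    le_antisymm (nonpos_of_mul_nonpos_right ((hB d hd).trans h) hc) (sq_nonneg _)

theorem eq_of_forall_apply_eq_smul (hs : ∀ x y, B x y = B y x) (hs' : ∀ x y, B' x y = B' y x)
    (hc : 0 < c) (hB : ∀ k ∈ K, c * ‖k‖ ^ 2 ≤ B k k) (hr : r ≠ 0) {u u' : X} (hd : u - u' ∈ K)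
    (hu : ∀ k ∈ K, B u k = 0) (hu' : ∀ k ∈ K, B' u' k = 0)
    (h : ∀ e, B' (u - u') e = r * B (u - u') e) : u = u' := by
  refine sub_eq_zero.1 (eq_zero_of_coercive_on hc hB hd ?_)
  have hdu' : B (u - u') u' = 0 := by
    have h' := h u'
    rw [hs', hu' _ hd] at h'
    exact (mul_eq_zero.1 h'.symm).resolve_left hr
  rw [map_sub (B (u - u')), hs, hu _ hd, hdu', sub_zero]

/-- Here `N` stands for the functions vanishing near the inclusion. The solution `w ∈ K` of
`B w = (B - B') φ` on `K` is orthogonal to `N` with respect to `B`, because every `v ∈ N` agrees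
modulo `K` with a common solution `u` of both problems; unique continuation then yields
`B w φ = 0`. -/
theorem apply_self_eq_of_flux_eq (hK : IsComplete (K : Set X)) (hs : ∀ x y, B x y = B y x)
    (hs' : ∀ x y, B' x y = B' y x) (hc : 0 < c) (hB : ∀ k ∈ K, c * ‖k‖ ^ 2 ≤ B k k)
    (hN : ∀ v ∈ N, ∀ e, B v e = B' v e) (hr : r ≠ 0) (hφ : φ ∈ K)
    (hUC : ∀ w ∈ K, (∀ v ∈ N, B w v = 0) → (∀ e, B' w e = r * B w e) ∧ B w φ = 0)
    (hflux : ∀ v ∈ N, ∃ u u', u - v ∈ K ∧ u' - v ∈ K ∧ (∀ k ∈ K, B u k = 0) ∧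
      (∀ k ∈ K, B' u' k = 0) ∧ ∀ v' ∈ N, B u v' = B u' v') :
    B φ φ = B' φ φ := by
  have h_common : ∀ v ∈ N, ∃ u, u - v ∈ K ∧ (∀ k ∈ K, B u k = 0) ∧ ∀ k ∈ K, B' u k = 0 := by
    intro v hv
    obtain ⟨u, u', huv, huv', hu, hu', h⟩ := hflux v hv
    have hd : u - u' ∈ K := by simpa using K.sub_mem huv huv'
    have hprop := (hUC _ hd fun v' hv' ↦ by
      rw [map_sub, sub_apply, h v' hv', sub_self]).1
    obtain rfl := eq_of_forall_apply_eq_smul hs hs' hc hB hr hd hu hu' hprop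
    exact ⟨u, huv, hu, hu'⟩
  obtain ⟨w, hw, hwB⟩ := exists_of_coercive_on hK B hc hB (B φ - B' φ)
  simp only [sub_apply] at hwB
  have hwN : ∀ v ∈ N, B w v = 0 := by
    intro v hv
    obtain ⟨u, huv, hu, hu'⟩ := h_common v hv
    have h := hwB _ huv
    rw [map_sub, map_sub, map_sub, hs w u, hu w hw, hs φ u, hu φ hφ, hs' φ u, hu' φ hφ, hs φ v,
      hN v hv, hs' φ v] at h
    linarith
  rw [← sub_eq_zero, ← hwB φ hφ]
  exact (hUC w hw hwN).2

end Duality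

theorem exists_clm_comp_eq {E Q : Type*} [NormedAddCommGroup E] [NormedSpace ℝ E] [CompleteSpace E]
    [NormedAddCommGroup Q] [NormedSpace ℝ Q] [CompleteSpace Q] (q : E →L[ℝ] Q)
    (hq : Function.Surjective q) (f : E →L[ℝ] ℝ) (hf : ∀ e, q e = 0 → f e = 0) :
    ∃ ξ : StrongDual ℝ Q, ∀ e, ξ (q e) = f e := by
  let ξ : Q →ₗ[ℝ] ℝ := ((LinearMap.ker q.toLinearMap).liftQ f.toLinearMap hf).comp
    (q.toLinearMap.quotKerEquivOfSurjective hq).symm.toLinearMap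
  have hξ : ∀ e, ξ (q e) = f e := fun e ↦
    congrArg ((LinearMap.ker q.toLinearMap).liftQ f.toLinearMap hf)
      (((q.toLinearMap.quotKerEquivOfSurjective hq).symm_apply_eq (y := Submodule.Quotient.mk e)).2
        rfl)
  have hξ_cont : Continuous ξ :=
    (q.isQuotientMap hq).continuous_iff.2 ((funext hξ : ξ ∘ q = f) ▸ f.continuous)
  exact ⟨⟨ξ, hξ_cont⟩, hξ⟩

/-! ### Energy spaces with derivatives of a trace -/

section EnergySpace

variable {H F : Type*} [NormedAddCommGroup H] [InnerProductSpace ℝ H]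
  [NormedAddCommGroup F] [InnerProductSpace ℝ F] {K : Submodule ℝ H} {T : H →L[ℝ] F}
  {W : Submodule ℝ (F × F)} {A₀ A₁ : H →L[ℝ] H →L[ℝ] ℝ} {c μ b a : ℝ}

/-- Triples `(u, g₁, g₂)` of a function and the first two derivatives of its trace, with the
Hilbert norm. -/
abbrev Triple (H F : Type*) : Type _ := WithLp 2 (H × WithLp 2 (F × F))

/-- The triple `(u, g₁, g₂)`. -/
def Triple.mk (u : H) (g₁ g₂ : F) : Triple H F := WithLp.toLp 2 (u, WithLp.toLp 2 (g₁, g₂))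

/-- The space of the triples `(u, g₁, g₂)` such that `g₁` is the derivative of the trace `T u` and
`g₂` the derivative of `g₁`, where `W` is the graph of the derivation. It encodes `ℋ`. -/
noncomputable def energySpace (T : H →L[ℝ] F) (W : Submodule ℝ (F × F)) :
    Submodule ℝ (Triple H F) :=
  W.comap (((T : H →ₗ[ℝ] F).comp (WithLp.fstL 2 ℝ H _).toLinearMap).prod
      ((WithLp.fstL 2 ℝ F F).comp (WithLp.sndL 2 ℝ H _)).toLinearMap) ⊓
    W.comap (((WithLp.fstL 2 ℝ F F).comp (WithLp.sndL 2 ℝ H _)).toLinearMap.prod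
      ((WithLp.sndL 2 ℝ F F).comp (WithLp.sndL 2 ℝ H _)).toLinearMap)

theorem mem_energySpace {e : Triple H F} :
    e ∈ energySpace T W ↔ (T e.fst, e.snd.fst) ∈ W ∧ (e.snd.fst, e.snd.snd) ∈ W := Iff.rfl

theorem eq_mk_zero_of_mem_energySpace (hW : ∀ g, (0, g) ∈ W → g = 0) {e : Triple H F}
    (he : e ∈ energySpace T W) (h : T e.fst = 0) : e = Triple.mk e.fst 0 0 := by
  obtain ⟨h₁, h₂⟩ := he
  have he₁ : e.snd.fst = 0 := hW _ (h ▸ h₁)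
  have he₂ : e.snd.snd = 0 := hW _ (he₁ ▸ h₂)
  exact congrArg (fun p ↦ WithLp.toLp 2 (e.fst, p))
    (congrArg₂ (fun g₁ g₂ ↦ WithLp.toLp 2 (g₁, g₂)) he₁ he₂)

theorem isClosed_energySpace (T : H →L[ℝ] F) (hW : IsClosed (W : Set (F × F))) :
    IsClosed (energySpace T W : Set (Triple H F)) := by
  have h₁ : Continuous fun e : Triple H F ↦ (T e.fst, e.snd.fst) := by fun_prop
  have h₂ : Continuous fun e : Triple H F ↦ (e.snd.fst, e.snd.snd) := by fun_prop
  exact (hW.preimage h₁).inter (hW.preimage h₂)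

/-- The triples of `energySpace T W` whose function belongs to `K`. With `K = H¹₀(Ω)` these are the
test functions of the weak formulation. -/
noncomputable def energySpaceOn (K : Submodule ℝ H) (T : H →L[ℝ] F) (W : Submodule ℝ (F × F)) :
    Submodule ℝ (Triple H F) :=
  energySpace T W ⊓ K.comap (WithLp.fstL 2 ℝ H _).toLinearMap

theorem isClosed_energySpaceOn (hK : IsClosed (K : Set H)) (T : H →L[ℝ] F)
    (hW : IsClosed (W : Set (F × F))) : IsClosed (energySpaceOn K T W : Set (Triple H F)) :=
  (isClosed_energySpace T hW).inter (hK.preimage (WithLp.fstL 2 ℝ H (WithLp 2 (F × F))).continuous)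

/-- The energy form `A₀ u v + μ A₁ u v + b ⟪g₁, h₁⟫ + a ⟪g₂, h₂⟫` of the triples `(u, g₁, g₂)` and
`(v, h₁, h₂)`, where `A₀` and `A₁` are the Dirichlet forms outside and inside the inclusion. -/
noncomputable def energyForm (F : Type*) [NormedAddCommGroup F] [InnerProductSpace ℝ F]
    (A₀ A₁ : H →L[ℝ] H →L[ℝ] ℝ) (μ b a : ℝ) : Triple H F →L[ℝ] Triple H F →L[ℝ] ℝ :=
  (A₀ + μ • A₁).bilinearComp (WithLp.fstL 2 ℝ H _) (WithLp.fstL 2 ℝ H _)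
    + b • (innerSL ℝ).bilinearComp ((WithLp.fstL 2 ℝ F F).comp (WithLp.sndL 2 ℝ H _))
      ((WithLp.fstL 2 ℝ F F).comp (WithLp.sndL 2 ℝ H _))
    + a • (innerSL ℝ).bilinearComp ((WithLp.sndL 2 ℝ F F).comp (WithLp.sndL 2 ℝ H _))
      ((WithLp.sndL 2 ℝ F F).comp (WithLp.sndL 2 ℝ H _))

theorem energyForm_apply (e e' : Triple H F) :
    energyForm F A₀ A₁ μ b a e e' = A₀ e.fst e'.fst + μ * A₁ e.fst e'.fst
      + b * inner ℝ e.snd.fst e'.snd.fst + a * inner ℝ e.snd.snd e'.snd.snd := rfl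

theorem energyForm_mk_zero (u : H) (e : Triple H F) :
    energyForm F A₀ A₁ μ b a (Triple.mk u 0 0) e = A₀ u e.fst + μ * A₁ u e.fst := by
  simp [energyForm_apply, Triple.mk]

theorem energyForm_comm (h₀ : ∀ u v, A₀ u v = A₀ v u) (h₁ : ∀ u v, A₁ u v = A₁ v u)
    (e e' : Triple H F) : energyForm F A₀ A₁ μ b a e e' = energyForm F A₀ A₁ μ b a e' e := by
  rw [energyForm_apply, energyForm_apply, h₀, h₁, real_inner_comm, real_inner_comm e.snd.snd]

theorem min_mul_norm_sq_le_energyForm {e : Triple H F}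
    (h : c * ‖e.fst‖ ^ 2 ≤ A₀ e.fst e.fst + μ * A₁ e.fst e.fst) :
    min c (min b a) * ‖e‖ ^ 2 ≤ energyForm F A₀ A₁ μ b a e e := by
  rw [energyForm_apply, real_inner_self_eq_norm_sq, real_inner_self_eq_norm_sq,
    WithLp.prod_norm_sq_eq_of_L2, WithLp.prod_norm_sq_eq_of_L2, mul_add, mul_add]
  have hc : min c (min b a) * ‖e.fst‖ ^ 2 ≤ c * ‖e.fst‖ ^ 2 := by
    gcongr
    exact min_le_left _ _
  have hb : min c (min b a) * ‖e.snd.fst‖ ^ 2 ≤ b * ‖e.snd.fst‖ ^ 2 := by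
    gcongr
    exact (min_le_right _ _).trans (min_le_left _ _)
  have ha : min c (min b a) * ‖e.snd.snd‖ ^ 2 ≤ a * ‖e.snd.snd‖ ^ 2 := by
    gcongr
    exact (min_le_right _ _).trans (min_le_right _ _)
  linarith

variable [CompleteSpace H] [CompleteSpace F]

theorem exists_energy_solution (hK : IsClosed (K : Set H)) (hW : IsClosed (W : Set (F × F)))
    (hc : 0 < c) (hA : ∀ u ∈ K, c * ‖u‖ ^ 2 ≤ A₀ u u + μ * A₁ u u) (hb : 0 < b) (ha : 0 < a)
    {e₀ : Triple H F} (he₀ : e₀ ∈ energySpace T W) :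
    ∃ e ∈ energySpace T W, e.fst - e₀.fst ∈ K ∧
      ∀ k ∈ energySpaceOn K T W, energyForm F A₀ A₁ μ b a e k = 0 := by
  obtain ⟨w, hw, h⟩ := exists_of_coercive_on (isClosed_energySpaceOn hK T hW).isComplete
    (energyForm F A₀ A₁ μ b a) (lt_min hc (lt_min hb ha))
    (fun e he ↦ min_mul_norm_sq_le_energyForm (hA e.fst he.2)) (energyForm F A₀ A₁ μ b a e₀)
  refine ⟨e₀ - w, sub_mem he₀ hw.1, ?_, fun k hk ↦ ?_⟩
  · rw [WithLp.sub_fst, sub_sub_cancel_left]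
    exact K.neg_mem hw.2
  · rw [map_sub, sub_apply, h k hk, sub_self]

theorem exists_energy_flux (hK : IsClosed (K : Set H)) (hW : IsClosed (W : Set (F × F)))
    (hs : ∀ u, ∃ e ∈ energySpace T W, e.fst - u ∈ K) {f : Triple H F →L[ℝ] ℝ}
    (hf : ∀ k ∈ energySpaceOn K T W, f k = 0) :
    ∃ ξ : StrongDual ℝ (H ⧸ K), ∀ e ∈ energySpace T W, ξ (K.mkQ e.fst) = f e := by
  have : IsClosed (K : Set H) := hK
  have : CompleteSpace (energySpace T W) := (isClosed_energySpace T hW).completeSpace_coe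
  let q : energySpace T W →L[ℝ] H ⧸ K :=
    K.mkQL.comp ((WithLp.fstL 2 ℝ H _).comp (energySpace T W).subtypeL)
  have hq : Function.Surjective q := fun y ↦ by
    obtain ⟨u, rfl⟩ := K.mkQ_surjective y
    obtain ⟨e, he, heu⟩ := hs u
    exact ⟨⟨e, he⟩, (Submodule.Quotient.eq K).2 heu⟩
  obtain ⟨ξ, hξ⟩ := exists_clm_comp_eq q hq (f.comp (energySpace T W).subtypeL)
    fun e he ↦ hf e ⟨e.2, (Submodule.Quotient.mk_eq_zero K).1 he⟩
  exact ⟨ξ, fun e he ↦ hξ ⟨e, he⟩⟩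

theorem energyForm_self_eq_of_flux_eq {μ' b' a' : ℝ} (hK : IsClosed (K : Set H))
    (hW : IsClosed (W : Set (F × F))) (h₀ : ∀ u v, A₀ u v = A₀ v u)
    (h₁ : ∀ u v, A₁ u v = A₁ v u) (hc : 0 < c) (hA : ∀ u ∈ K, c * ‖u‖ ^ 2 ≤ A₀ u u + μ * A₁ u u)
    (hb : 0 < b) (ha : 0 < a) (hμ : μ ≠ 0) (hμ' : μ' ≠ 0) {N : Set H}
    (hN : ∀ v ∈ N, Triple.mk v 0 0 ∈ energySpace T W) (hN₁ : ∀ v ∈ N, ∀ u, A₁ v u = 0)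
    {φ : Triple H F} (hφ : φ ∈ energySpaceOn K T W)
    (hUC : ∀ w ∈ energySpaceOn K T W, (∀ v ∈ N, A₀ w.fst v = 0) →
      w = Triple.mk w.fst 0 0 ∧ (∀ u, A₀ w.fst u = 0) ∧ A₁ w.fst φ.fst = 0)
    (hflux : ∀ v ∈ N, ∃ e ∈ energySpace T W, ∃ e' ∈ energySpace T W, e.fst - v ∈ K ∧
      e'.fst - v ∈ K ∧ (∀ k ∈ energySpaceOn K T W, energyForm F A₀ A₁ μ b a e k = 0) ∧
      (∀ k ∈ energySpaceOn K T W, energyForm F A₀ A₁ μ' b' a' e' k = 0) ∧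
      ∀ v' ∈ N, A₀ e.fst v' = A₀ e'.fst v') :
    energyForm F A₀ A₁ μ b a φ φ = energyForm F A₀ A₁ μ' b' a' φ φ := by
  have h_near (m s t : ℝ) {v : H} (hv : v ∈ N) (e : Triple H F) :
      energyForm F A₀ A₁ m s t e (Triple.mk v 0 0) = A₀ e.fst v := by
    rw [energyForm_comm h₀ h₁, energyForm_mk_zero, hN₁ v hv, mul_zero, add_zero, h₀]
  refine apply_self_eq_of_flux_eq (N := (fun v ↦ Triple.mk v 0 0) '' N) (r := μ' / μ)
    (isClosed_energySpaceOn hK T hW).isComplete (energyForm_comm h₀ h₁) (energyForm_comm h₀ h₁)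
    (lt_min hc (lt_min hb ha)) (fun k hk ↦ min_mul_norm_sq_le_energyForm (hA k.fst hk.2)) ?_
    (div_ne_zero hμ' hμ) hφ (fun w hw h ↦ ?_) ?_
  · rintro _ ⟨v, hv, rfl⟩ e
    rw [energyForm_comm h₀ h₁, h_near _ _ _ hv, energyForm_comm h₀ h₁, h_near _ _ _ hv]
  · obtain ⟨hw_mk, hw₀, hw₁⟩ := hUC w hw fun v hv ↦
      (h_near _ _ _ hv w).symm.trans (h _ (mem_image_of_mem _ hv))
    rw [hw_mk]
    refine ⟨fun e ↦ ?_, ?_⟩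
    · rw [energyForm_mk_zero, energyForm_mk_zero, hw₀, zero_add, zero_add, ← mul_assoc,
        div_mul_cancel₀ _ hμ]
    · rw [energyForm_mk_zero, hw₀, hw₁, mul_zero, add_zero]
  · rintro _ ⟨v, hv, rfl⟩
    obtain ⟨e, he, e', he', hev, hev', h, h', h_flux⟩ := hflux v hv
    refine ⟨e, e', ⟨sub_mem he (hN v hv), hev⟩, ⟨sub_mem he' (hN v hv), hev'⟩, h, h', ?_⟩
    rintro _ ⟨v', hv', rfl⟩
    exact (h_near _ _ _ hv' e).trans ((h_flux v' hv').trans (h_near _ _ _ hv' e').symm)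

end EnergySpace

/-! ### Weak derivatives along a closed curve -/

section CurveDerivative

variable {L : ℝ} {k : ℝ → ℝ}

theorem inner_toLp_curve {f : ℝ → ℝ} (hf : MemLp f 2 (volume.restrict (Ioc 0 L)))
    (g : L2Curve L) : inner ℝ (hf.toLp f) g = ∫ s in Ioc 0 L, g s * f s := by
  rw [inner_toLp_left]
  rfl

/-- The graph of the weak derivative along a closed curve of length `L`, as an intersection of
closed hyperplanes indexed by the periodic test functions. -/
noncomputable def weakDerivGraph (L : ℝ) : Submodule ℝ (L2Curve L × L2Curve L) :=
  ⨅ (η : ℝ → ℝ) (hη : ContDiff ℝ ∞ η) (_ : Function.Periodic η L), LinearMap.ker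
    ((innerSL ℝ ((memLp_Ioc (L := L) (hη.continuous_deriv (by simp))).toLp (deriv η))).coprod
      (innerSL ℝ ((memLp_Ioc (L := L) hη.continuous).toLp η))).toLinearMap

theorem mem_weakDerivGraph {p : L2Curve L × L2Curve L} :
    p ∈ weakDerivGraph L ↔ IsWeakDerivCurve L p.1 p.2 := by
  simp only [weakDerivGraph, Submodule.mem_iInf]
  refine forall_congr' fun η ↦ forall_congr' fun hη ↦ forall_congr' fun _ ↦ ?_
  rw [← inner_toLp_curve (memLp_Ioc (hη.continuous_deriv (by simp))),
    ← inner_toLp_curve (memLp_Ioc hη.continuous), ← add_eq_zero_iff_eq_neg]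
  rfl

theorem isClosed_weakDerivGraph (L : ℝ) :
    IsClosed (weakDerivGraph L : Set (L2Curve L × L2Curve L)) := by
  simp only [weakDerivGraph, Submodule.coe_iInf]
  exact isClosed_iInter fun η ↦ isClosed_iInter fun hη ↦ isClosed_iInter fun _ ↦
    ContinuousLinearMap.isClosed_ker _

theorem periodic_deriv (hk : Function.Periodic k L) : Function.Periodic (deriv k) L := fun s ↦ by
  rw [← deriv_comp_add_const]
  exact congrArg (fun f ↦ deriv f s) (funext hk)

theorem isWeakDerivCurve_of_periodic (hL : 0 < L) (hk : ContDiff ℝ 1 k)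
    (hp : Function.Periodic k L) :
    IsWeakDerivCurve L ((memLp_Ioc hk.continuous).toLp k)
      ((memLp_Ioc hk.continuous_deriv_one).toLp (deriv k)) := by
  intro η hη hηp
  have hη1 : ContDiff ℝ 1 η := hη.of_le (by simp)
  have h_coe {f : ℝ → ℝ} (hf : Continuous f) (g : ℝ → ℝ) :
      ∫ s in Ioc 0 L, (memLp_Ioc (L := L) hf).toLp f s * g s = ∫ s in 0..L, f s * g s := by
    rw [intervalIntegral.integral_of_le hL.le]
    refine integral_congr_ae ?_
    filter_upwards [(memLp_Ioc (L := L) hf).coeFn_toLp] with s hs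
    rw [hs]
  have h_boundary : k L * η L = k 0 * η 0 := by rw [hp.eq, hηp.eq]
  rw [h_coe hk.continuous, h_coe hk.continuous_deriv_one,
    intervalIntegral.integral_mul_deriv_eq_deriv_mul
      (fun s _ ↦ (hk.differentiable one_ne_zero s).hasDerivAt)
      (fun s _ ↦ (hη1.differentiable one_ne_zero s).hasDerivAt)
      hk.continuous_deriv_one.continuousOn.intervalIntegrable
      hη1.continuous_deriv_one.continuousOn.intervalIntegrable,
    h_boundary, sub_self, zero_sub]

theorem integral_mul_periodic_eq_zero {g : L2Curve L}
    (hg : ∀ η : ℝ → ℝ, ContDiff ℝ ∞ η → Function.Periodic η L → ∫ s in Ioc 0 L, g s * η s = 0)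
    {e : ℝ → ℂ} (he : ContDiff ℝ ∞ e) (hp : Function.Periodic e L) :
    ∫ s in Ioc 0 L, e s * (g s : ℂ) = 0 := by
  have h_re : ContDiff ℝ ∞ fun s ↦ (e s).re := Complex.reCLM.contDiff.comp he
  have h_im : ContDiff ℝ ∞ fun s ↦ (e s).im := Complex.imCLM.contDiff.comp he
  have h_int {η : ℝ → ℝ} (hη : ContDiff ℝ ∞ η) :
      Integrable (fun s ↦ ((g s * η s : ℝ) : ℂ)) (volume.restrict (Ioc 0 L)) :=
    ((Lp.memLp g).integrable_mul (memLp_Ioc hη.continuous)).ofReal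
  have h_split : ∀ s, e s * (g s : ℂ)
      = ((g s * (e s).re : ℝ) : ℂ) + ((g s * (e s).im : ℝ) : ℂ) * Complex.I := fun s ↦ by
    conv_lhs => rw [← Complex.re_add_im (e s)]
    push_cast
    ring
  simp only [h_split]
  rw [integral_add (h_int h_re) ((h_int h_im).mul_const _), integral_mul_const,
    integral_complex_ofReal, integral_complex_ofReal, hg _ h_re fun s ↦ congrArg Complex.re (hp s),
    hg _ h_im fun s ↦ congrArg Complex.im (hp s)]
  simp

theorem fourierCoeffOn_eq_zero (hL : 0 < L) {g : L2Curve L}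
    (hg : ∀ η : ℝ → ℝ, ContDiff ℝ ∞ η → Function.Periodic η L → ∫ s in Ioc 0 L, g s * η s = 0)
    (n : ℤ) : fourierCoeffOn hL (fun s ↦ (g s : ℂ)) n = 0 := by
  have h_smooth : ContDiff ℝ ∞ fun s : ℝ ↦ fourier (-n) (s : AddCircle (L - 0)) := by
    simp only [fourier_coe_apply]
    exact ((contDiff_const.mul Complex.ofRealCLM.contDiff).div_const _).cexp
  have h_periodic : Function.Periodic (fun s : ℝ ↦ fourier (-n) (s : AddCircle (L - 0))) L :=
    fun s ↦ congrArg (fourier (-n)) (by simp)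
  rw [fourierCoeffOn_eq_integral, intervalIntegral.integral_of_le hL.le]
  simp only [smul_eq_mul]
  rw [integral_mul_periodic_eq_zero hg h_smooth h_periodic, smul_zero]

theorem integral_norm_sq_eq_zero_of_fourierCoeffOn_eq_zero (hL : 0 < L) {f : ℝ → ℂ}
    (hf : MemLp f 2 (volume.restrict (Ioc 0 L))) (h : ∀ n, fourierCoeffOn hL f n = 0) :
    ∫ s in Ioc 0 L, ‖f s‖ ^ 2 = 0 := by
  have h_parseval := hasSum_sq_fourierCoeffOn hL hf
  simp only [h, norm_zero, ne_eq, OfNat.ofNat_ne_zero, not_false_eq_true, zero_pow] at h_parseval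
  rw [← intervalIntegral.integral_of_le hL.le]
  exact (smul_eq_zero.1 (h_parseval.unique hasSum_zero)).resolve_left
    (inv_ne_zero (sub_ne_zero.2 hL.ne'))

theorem IsWeakDerivCurve.eq_zero (hL : 0 < L) {g : L2Curve L} (hg : IsWeakDerivCurve L 0 g) :
    g = 0 := by
  have h_test : ∀ η : ℝ → ℝ, ContDiff ℝ ∞ η → Function.Periodic η L →
      ∫ s in Ioc 0 L, g s * η s = 0 := fun η hη hp ↦ by
    rw [← neg_eq_zero, ← hg η hη hp]
    refine integral_eq_zero_of_ae ?_
    filter_upwards [Lp.coeFn_zero ℝ 2 (volume.restrict (Ioc 0 L))] with s hs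
    simp only [hs, Pi.zero_apply, zero_mul]
  have h_norm := integral_norm_sq_eq_zero_of_fourierCoeffOn_eq_zero hL
    ((Lp.memLp g).ofReal (K := ℂ)) (fourierCoeffOn_eq_zero hL h_test)
  simp only [RCLike.norm_ofReal, sq_abs] at h_norm
  rw [← norm_eq_zero, ← pow_eq_zero_iff two_ne_zero, norm_sq_eq_integral]
  simpa using h_norm

end CurveDerivative

/-! ### The Dirichlet form -/

section LpRestrict

variable {α F : Type*} [MeasurableSpace α] [NormedAddCommGroup F] [InnerProductSpace ℝ F]

/-- The bilinear form `(f, g) ↦ ∫_s ⟪f, g⟫` on `L²(ν)`. -/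
noncomputable def setInner (ν : Measure α) (s : Set α) : Lp F 2 ν →L[ℝ] Lp F 2 ν →L[ℝ] ℝ :=
  (innerSL ℝ).bilinearComp (LpToLpRestrictCLM α F ℝ ν 2 s) (LpToLpRestrictCLM α F ℝ ν 2 s)

theorem setInner_apply (ν : Measure α) (s : Set α) (f g : Lp F 2 ν) :
    setInner ν s f g = ∫ x, inner ℝ (f x) (g x) ∂(ν.restrict s) := by
  refine (L2.inner_def _ _).trans (integral_congr_ae ?_)
  filter_upwards [LpToLpRestrictCLM_coeFn ℝ s f, LpToLpRestrictCLM_coeFn ℝ s g] with x hf hg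
  exact congrArg₂ (inner ℝ) hf hg

theorem setInner_diff_add {ν : Measure α} {s t : Set α} (hs : MeasurableSet s)
    (ht : ∀ᵐ x ∂ν, x ∈ t) (f g : Lp F 2 ν) :
    setInner ν (t \ s) f g + setInner ν s f g = inner ℝ f g := by
  have h_int : Integrable (fun x ↦ inner ℝ (f x) (g x)) ν := L2.integrable_inner f g
  have h_split := integral_inter_add_sdiff (s := t) hs h_int.integrableOn
  have h_inter : ν.restrict (t ∩ s) = ν.restrict s := Measure.restrict_congr_set <| by
    filter_upwards [ht] with x hx
    exact propext (and_iff_right hx)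
  rw [h_inter, Measure.restrict_eq_self_of_ae_mem ht] at h_split
  rw [setInner_apply, setInner_apply, L2.inner_def, add_comm, h_split]

end LpRestrict

section DirichletForm

variable {Ω D s : Set Plane} {μ : ℝ}

/-- The Dirichlet form `∫_s ∇u · ∇v` of a subset `s` of `Ω`, as a bounded bilinear form on
`H¹(Ω)`. -/
noncomputable def dirichletForm (Ω s : Set Plane) : H1 Ω →L[ℝ] H1 Ω →L[ℝ] ℝ :=
  (setInner (volume.restrict Ω) s).bilinearComp (gradCLM Ω) (gradCLM Ω)

theorem dirichletForm_eq_setInner (u v : H1 Ω) :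
    dirichletForm Ω s u v = setInner (volume.restrict Ω) s (grad u) (grad v) := rfl

attribute [irreducible] dirichletForm

theorem dirichletForm_apply (hs : s ⊆ Ω) (u v : H1 Ω) :
    dirichletForm Ω s u v = ∫ x in s, inner ℝ (grad u x) (grad v x) := by
  rw [dirichletForm_eq_setInner, setInner_apply, Measure.restrict_restrict_of_subset hs]

theorem dirichletForm_comm (hs : s ⊆ Ω) (u v : H1 Ω) :
    dirichletForm Ω s u v = dirichletForm Ω s v u := by
  simp only [dirichletForm_apply hs, real_inner_comm]

theorem dirichletForm_self_nonneg (hs : s ⊆ Ω) (u : H1 Ω) : 0 ≤ dirichletForm Ω s u u := by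
  rw [dirichletForm_apply hs]
  exact integral_nonneg fun _ ↦ real_inner_self_nonneg

theorem dirichletForm_sdiff_add (hΩ : MeasurableSet Ω) (hD : MeasurableSet D) (u v : H1 Ω) :
    dirichletForm Ω (Ω \ D) u v + dirichletForm Ω D u v = inner ℝ (grad u) (grad v) :=
  (congrArg₂ (· + ·) (dirichletForm_eq_setInner u v) (dirichletForm_eq_setInner u v)).trans
    (setInner_diff_add hD (ae_restrict_mem hΩ) (grad u) (grad v))

theorem dirichletForm_eq_zero (hs : s ⊆ Ω) {u : H1 Ω}
    (h : ∀ᵐ x ∂(volume.restrict s), grad u x = 0) (v : H1 Ω) : dirichletForm Ω s u v = 0 := by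
  rw [dirichletForm_apply hs]
  refine integral_eq_zero_of_ae ?_
  filter_upwards [h] with x hx
  rw [hx, inner_zero_left, Pi.zero_apply]

theorem min_mul_le_add_mul {c r x y : ℝ} (hx : 0 ≤ x) (hy : 0 ≤ y) (hμ : 0 < μ)
    (h : c * r ≤ x + y) : min 1 μ * c * r ≤ x + μ * y := by
  rw [mul_assoc]
  refine (mul_le_mul_of_nonneg_left h (lt_min one_pos hμ).le).trans ?_
  rw [mul_add]
  exact add_le_add (mul_le_of_le_one_left hx (min_le_left 1 μ))
    (mul_le_mul_of_nonneg_right (min_le_right 1 μ) hy)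

theorem exists_mul_norm_sq_le_dirichletForm (hΩ : IsOpen Ω) (hb : Bornology.IsBounded Ω)
    (hD : MeasurableSet D) (hDΩ : D ⊆ Ω) (hμ : 0 < μ) :
    ∃ c > 0, ∀ u ∈ H10 Ω,
      c * ‖u‖ ^ 2 ≤ dirichletForm Ω (Ω \ D) u u + μ * dirichletForm Ω D u u := by
  have h_poincare := exists_norm_sq_le_norm_grad_sq hΩ hb
  obtain ⟨c, hc, h⟩ := h_poincare
  refine ⟨min 1 μ * c, mul_pos (lt_min one_pos hμ) hc, fun u hu ↦ ?_⟩
  have h_energy : c * ‖u‖ ^ 2 ≤ dirichletForm Ω (Ω \ D) u u + dirichletForm Ω D u u :=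
    (h u hu).trans_eq ((real_inner_self_eq_norm_sq (grad u)).symm.trans
      (dirichletForm_sdiff_add hΩ.measurableSet hD u u).symm)
  exact min_mul_le_add_mul (dirichletForm_self_nonneg sdiff_subset u)
    (dirichletForm_self_nonneg hDΩ u) hμ h_energy

theorem dirichletForm_ofContDiff_self {φ : Plane → ℝ} (hs : s ⊆ Ω) (hφ : ContDiff ℝ 1 φ)
    (hc : HasCompactSupport φ) :
    dirichletForm Ω s (ofContDiff Ω hφ hc) (ofContDiff Ω hφ hc) = ∫ x in s, ‖∇ φ x‖ ^ 2 := by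
  rw [dirichletForm_apply hs]
  refine integral_congr_ae ?_
  filter_upwards [ae_restrict_of_ae_restrict_of_subset hs (grad_ofContDiff (Ω := Ω) hφ hc)]
    with x hx
  rw [hx, real_inner_self_eq_norm_sq]

end DirichletForm

/-! ### Functions vanishing near the inclusion and unique continuation -/

section UniqueContinuation

variable {Ω D : Set Plane} {L : ℝ} {γ : ℝ → Plane} {u v w : H1 Ω} {φ ψ : Plane → ℝ}

/-- The functions in `H¹(Ω)` that vanish near `closure D`. They represent all the boundary values
in `H^{1/2}(∂Ω)`. -/
def vanishingNear (Ω D : Set Plane) : Set (H1 Ω) :=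
  {φ | ∃ V : Set Plane, IsOpen V ∧ closure D ⊆ V ∧ ∀ᵐ x ∂(volume.restrict Ω), x ∈ V → fn φ x = 0}

theorem dirichletForm_eq_zero_of_mem_vanishingNear (hD : IsOpen D) (hDΩ : D ⊆ Ω)
    (hv : v ∈ vanishingNear Ω D) (u : H1 Ω) : dirichletForm Ω D v u = 0 := by
  obtain ⟨V, -, hDV, h⟩ := hv
  refine dirichletForm_eq_zero hDΩ ?_ u
  have h_grad := grad_eq_zero_of_fn_eq_zero hD hDΩ v
    (h.mono fun x hx hxD ↦ hx (hDV (subset_closure hxD)))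
  filter_upwards [ae_restrict_of_ae_restrict_of_subset hDΩ h_grad,
    ae_restrict_mem hD.measurableSet] with x hx hxD
  exact hx hxD

theorem IsTestFunction.ofContDiff_mem_vanishingNear (hψ : IsTestFunction (closure D)ᶜ ψ) :
    ofContDiff Ω (hψ.smooth.of_le (by simp)) hψ.compact ∈ vanishingNear Ω D := by
  refine ⟨(tsupport ψ)ᶜ, (isClosed_tsupport ψ).isOpen_compl, fun x hx h ↦ hψ.supp h hx, ?_⟩
  filter_upwards [fn_ofContDiff (Ω := Ω) (hψ.smooth.of_le (by simp)) hψ.compact] with x hx hxV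
  rw [hx, image_eq_zero_of_notMem_tsupport hxV]

theorem isWeaklyHarmonic_zeroExtension (hΩ : IsOpen Ω) (hD : IsOpen D) (hDΩ : D ⊆ Ω)
    (hw : w ∈ H10 Ω) (h : ∀ v ∈ vanishingNear Ω D, dirichletForm Ω (Ω \ D) w v = 0) :
    IsWeaklyHarmonic (closure D)ᶜ (zeroExtension w) := by
  intro ψ hψ
  have hN := hψ.ofContDiff_mem_vanishingNear (Ω := Ω)
  have h_split := dirichletForm_sdiff_add hΩ.measurableSet hD.measurableSet w
    (ofContDiff Ω (hψ.smooth.of_le (by simp)) hψ.compact)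
  have h_outside := h _ hN
  have h_inside := (dirichletForm_comm hDΩ _ _).trans
    (dirichletForm_eq_zero_of_mem_vanishingNear hD hDΩ hN w)
  rw [integral_zeroExtension_mul hΩ,
    integral_fn_mul_laplacian_of_mem_H10 hΩ hw (hψ.smooth.of_le (by norm_cast)) hψ.compact]
  linarith

theorem IsWeaklyHarmonic.ae_eq_zero {U O : Set Plane} {f : Plane → ℝ}
    (hf : IsWeaklyHarmonic U f) (hf_int : LocallyIntegrable f) (hU : IsOpen U)
    (hU_conn : IsPreconnected U) (hO : IsOpen O) (hO_ne : O.Nonempty) (hOU : O ⊆ U)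
    (h : ∀ x ∈ O, f x = 0) : ∀ᵐ x, x ∈ U → f x = 0 := by
  obtain ⟨k, hk, hae⟩ := hf.exists_harmonicOnNhd hU hf_int
  have h_analytic := analyticOnNhd_of_harmonicOnNhd hk
  have hkO : EqOn k 0 O := by
    refine Measure.eqOn_open_of_ae_eq (μ := volume) ?_ hO (h_analytic.continuousOn.mono hOU)
      continuousOn_const
    filter_upwards [ae_restrict_of_ae hae, ae_restrict_mem hO.measurableSet] with x hx hxO
    rw [← hx (hOU hxO), h x hxO, Pi.zero_apply]
  obtain ⟨x₀, hx₀⟩ := hO_ne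
  have hkU := h_analytic.eqOn_zero_of_preconnected_of_eventuallyEq_zero hU_conn (hOU hx₀)
    (eventually_of_mem (hO.mem_nhds hx₀) hkO)
  filter_upwards [hae] with x hx hxU
  rw [hx hxU, hkU hxU, Pi.zero_apply]

/-- The extension of `w` by zero is harmonic in the whole exterior of `D` because the flux of `w`
through `∂Ω` vanishes, and it is zero outside `Ω`. -/
theorem fn_eq_zero_of_flux_eq_zero (hΩ : IsOpen Ω) (hb : Bornology.IsBounded Ω)
    (hD : IsSmoothDomain D) (hγ : IsArclengthParam (frontier D) L γ) (hDΩ : closure D ⊆ Ω)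
    (hw : w ∈ H10 Ω) (h : ∀ v ∈ vanishingNear Ω D, dirichletForm Ω (Ω \ D) w v = 0) :
    ∀ᵐ x ∂(volume.restrict Ω), x ∈ Ω \ closure D → fn w x = 0 := by
  obtain ⟨R, hR⟩ := hb.subset_closedBall 0
  have h_notMem : ∀ x ∈ (closedBall (0 : Plane) R)ᶜ, x ∉ Ω := fun x hx hxΩ ↦ hx (hR hxΩ)
  have h_nonempty : (closedBall (0 : Plane) R)ᶜ.Nonempty := by
    obtain ⟨x, hx⟩ := NormedSpace.exists_lt_norm ℝ Plane R
    exact ⟨x, by simpa using hx⟩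
  have h_harmonic :=
    isWeaklyHarmonic_zeroExtension hΩ hD.isOpen (subset_closure.trans hDΩ) hw h
  have h_zero := h_harmonic.ae_eq_zero (integrable_zeroExtension hΩ hb w).locallyIntegrable
    isClosed_closure.isOpen_compl (hD.isPreconnected_exterior hγ)
    isClosed_closedBall.isOpen_compl h_nonempty
    (fun x hx hxD ↦ h_notMem x hx (hDΩ hxD)) fun x hx ↦ indicator_of_notMem (h_notMem x hx) _
  filter_upwards [ae_restrict_of_ae h_zero] with x hx hxD
  rw [← hx hxD.2, zeroExtension, indicator_of_mem hxD.1]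

theorem grad_eq_zero_of_fn_eq_zero_outside (hΩ : IsOpen Ω) (hD : IsOpen D)
    (hγ : IsArclengthParam (frontier D) L γ)
    (h : ∀ᵐ x ∂(volume.restrict Ω), x ∈ Ω \ closure D → fn w x = 0) :
    ∀ᵐ x ∂(volume.restrict (Ω \ D)), grad w x = 0 := by
  have h_grad := grad_eq_zero_of_fn_eq_zero (hΩ.sdiff isClosed_closure) sdiff_subset w h
  have h_frontier : ∀ᵐ x ∂(volume : Measure Plane), x ∉ frontier D :=
    measure_eq_zero_iff_ae_notMem.1 hγ.volume_eq_zero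
  filter_upwards [ae_restrict_of_ae_restrict_of_subset sdiff_subset h_grad,
    ae_restrict_of_ae h_frontier, ae_restrict_mem (hΩ.measurableSet.diff hD.measurableSet)]
    with x hx hx_frontier hxD
  rw [hD.frontier_eq] at hx_frontier
  exact hx ⟨hxD.1, fun hx_closure ↦ hx_frontier ⟨hx_closure, hxD.2⟩⟩

theorem dirichletForm_toH1_eq_zero (hΩ : IsOpen Ω) (hD : IsOpen D)
    (hγ : IsArclengthParam (frontier D) L γ)
    (h : ∀ᵐ x ∂(volume.restrict Ω), x ∈ Ω \ closure D → fn w x = 0) (hφ : IsTestFunction Ω φ)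
    (hφD : ∀ x ∈ closure D, Δ φ x = 0) : dirichletForm Ω D w hφ.toH1 = 0 := by
  have h_split := dirichletForm_sdiff_add hΩ.measurableSet hD.measurableSet w hφ.toH1
  have h_outside := dirichletForm_eq_zero sdiff_subset
    (grad_eq_zero_of_fn_eq_zero_outside hΩ hD hγ h) hφ.toH1
  have h_laplacian : ∫ x in Ω, fn w x * Δ φ x = 0 := by
    refine integral_eq_zero_of_ae ?_
    filter_upwards [h, ae_restrict_mem hΩ.measurableSet] with x hx hxΩ
    by_cases hxD : x ∈ closure D
    · rw [hφD x hxD, mul_zero, Pi.zero_apply]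
    · rw [hx ⟨hxΩ, hxD⟩, zero_mul, Pi.zero_apply]
  rw [hφ.integral_fn_mul_laplacian] at h_laplacian
  linarith

end UniqueContinuation

/-! ### Weak solutions and the Dirichlet-to-Neumann map -/

section WeakSolution

variable {Ω D : Set Plane} {L : ℝ} {γ : ℝ → Plane} {T : H1 Ω →L[ℝ] L2Curve L} {u v : H1 Ω}
  {μ μs ℓ : ℝ} {φ : Plane → ℝ}

theorem contDiff_comp_curve (hγ : IsArclengthParam (frontier D) L γ)
    (hDΩ : closure D ⊆ Ω) (hφ : ContDiffOn ℝ ∞ φ Ω) : ContDiff ℝ ∞ fun s ↦ φ (γ s) :=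
  hφ.comp_contDiff hγ.smooth fun s ↦ hDΩ (frontier_subset_closure (hγ.mem s))

theorem hasH2Trace_of_contDiffOn (hγ : IsArclengthParam (frontier D) L γ)
    (hDΩ : closure D ⊆ Ω) (hφ : ContDiffOn ℝ ∞ φ Ω) (hu : fn u =ᵐ[volume.restrict Ω] φ)
    (h₁ : MemLp (deriv fun s ↦ φ (γ s)) 2 (volume.restrict (Ioc 0 L)))
    (h₂ : MemLp (deriv (deriv fun s ↦ φ (γ s))) 2 (volume.restrict (Ioc 0 L))) :
    HasH2Trace L γ u (h₁.toLp _) (h₂.toLp _) := by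
  have hk := contDiff_comp_curve hγ hDΩ hφ
  have hk' : ContDiff ℝ ∞ (deriv fun s ↦ φ (γ s)) := (contDiff_infty_iff_deriv.1 hk).2
  have hp : Function.Periodic (fun s ↦ φ (γ s)) L := fun s ↦ congrArg φ (hγ.periodic s)
  have h₀ := hγ.memLp_comp hDΩ hφ.continuousOn
  exact ⟨h₀.toLp _, (isCurveTrace_iff hγ hDΩ _ _).2 (subset_closure ⟨φ, hφ, hu, h₀.coeFn_toLp⟩),
    isWeakDerivCurve_of_periodic hγ.length_pos (hk.of_le (by simp)) hp,
    isWeakDerivCurve_of_periodic hγ.length_pos (hk'.of_le (by simp)) (periodic_deriv hp)⟩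

theorem hasH2Trace_iff (hT : ∀ u g, IsCurveTrace L γ u g ↔ g = T u) (u : H1 Ω)
    (g₁ g₂ : L2Curve L) :
    HasH2Trace L γ u g₁ g₂ ↔ Triple.mk u g₁ g₂ ∈ energySpace T (weakDerivGraph L) := by
  simp only [HasH2Trace, hT, mem_energySpace, mem_weakDerivGraph, exists_eq_left]
  rfl

theorem exists_mem_energySpace_sub_mem_H10 (hΩ : IsOpen Ω) (hb : Bornology.IsBounded Ω)
    (hγ : IsArclengthParam (frontier D) L γ) (hDΩ : closure D ⊆ Ω)
    (hT : ∀ u g, IsCurveTrace L γ u g ↔ g = T u) (u : H1 Ω) :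
    ∃ e ∈ energySpace T (weakDerivGraph L), e.fst - u ∈ H10 Ω := by
  have h_harmonic := exists_dirichlet_solution hΩ hb u
  obtain ⟨v, hv, hv_dirichlet⟩ := h_harmonic
  have h_smooth := exists_contDiffOn_of_dirichlet hΩ hb hv_dirichlet
  obtain ⟨φ, hφ, hvφ⟩ := h_smooth
  have hk : ContDiff ℝ ∞ (deriv fun s ↦ φ (γ s)) :=
    (contDiff_infty_iff_deriv.1 (contDiff_comp_curve hγ hDΩ hφ)).2
  exact ⟨_, (hasH2Trace_iff hT v _ _).1 (hasH2Trace_of_contDiffOn hγ hDΩ hφ hvφ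
    (memLp_Ioc hk.continuous) (memLp_Ioc (hk.continuous_deriv (by simp)))), hv⟩

/-- The bilinear form of the weak formulation. -/
noncomputable def shearForm (Ω D : Set Plane) (L μ μs ℓ : ℝ) :
    Triple (H1 Ω) (L2Curve L) →L[ℝ] Triple (H1 Ω) (L2Curve L) →L[ℝ] ℝ :=
  energyForm (L2Curve L) (dirichletForm Ω (Ω \ D)) (dirichletForm Ω D) μ μs (μs * ℓ ^ 2)

theorem mul_inner_curve (c : ℝ) (g h : L2Curve L) :
    c * inner ℝ g h = ∫ s in Ioc 0 L, c * (g s * h s) := by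
  rw [integral_const_mul, L2.inner_def]
  exact congrArg (c * ·) (integral_congr_ae (.of_forall fun s ↦ mul_comm _ _))

theorem shearForm_apply (hDΩ : D ⊆ Ω) (e k : Triple (H1 Ω) (L2Curve L)) :
    shearForm Ω D L μ μs ℓ e k = (∫ x in Ω \ D, inner ℝ (grad e.fst x) (grad k.fst x))
      + (∫ x in D, μ * inner ℝ (grad e.fst x) (grad k.fst x))
      + (∫ s in Ioc 0 L, μs * (e.snd.fst s * k.snd.fst s))
      + (∫ s in Ioc 0 L, μs * ℓ ^ 2 * (e.snd.snd s * k.snd.snd s)) :=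
  (energyForm_apply e k).trans <| congrArg₂ (· + ·) (congrArg₂ (· + ·) (congrArg₂ (· + ·)
    (dirichletForm_apply sdiff_subset e.fst k.fst)
    ((congrArg (μ * ·) (dirichletForm_apply hDΩ e.fst k.fst)).trans (integral_const_mul _ _).symm))
    (mul_inner_curve _ _ _)) (mul_inner_curve _ _ _)

theorem shearForm_mk_zero_of_mem_vanishingNear (hD : IsOpen D) (hDΩ : D ⊆ Ω)
    (hv : v ∈ vanishingNear Ω D) (e : Triple (H1 Ω) (L2Curve L)) :
    shearForm Ω D L μ μs ℓ e (Triple.mk v 0 0) = dirichletForm Ω (Ω \ D) e.fst v := by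
  have h_inside := dirichletForm_eq_zero_of_mem_vanishingNear hD hDΩ hv e.fst
  have h_comm : dirichletForm Ω (Ω \ D) v e.fst = dirichletForm Ω (Ω \ D) e.fst v :=
    dirichletForm_comm sdiff_subset v e.fst
  refine (energyForm_comm (dirichletForm_comm sdiff_subset) (dirichletForm_comm hDΩ) e _).trans
    ((energyForm_mk_zero v e).trans ?_)
  linear_combination μ * h_inside + h_comm

theorem isWeakSolution_iff (hDΩ : D ⊆ Ω) (hT : ∀ u g, IsCurveTrace L γ u g ↔ g = T u) :
    IsWeakSolution D L γ μ μs ℓ (outerTrace v) u ↔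
      ∃ e ∈ energySpace T (weakDerivGraph L), e.fst = u ∧ e.fst - v ∈ H10 Ω ∧
        ∀ k ∈ energySpaceOn (H10 Ω) T (weakDerivGraph L), shearForm Ω D L μ μs ℓ e k = 0 := by
  constructor
  · rintro ⟨hu, g₁, g₂, h_trace, h⟩
    exact ⟨Triple.mk u g₁ g₂, (hasH2Trace_iff hT u g₁ g₂).1 h_trace, rfl,
      (Submodule.Quotient.eq (H10 Ω)).1 hu, fun k hk ↦ (shearForm_apply hDΩ _ k).trans
        (h k.fst hk.2 k.snd.fst k.snd.snd ((hasH2Trace_iff hT _ _ _).2 hk.1))⟩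
  · rintro ⟨e, he, rfl, hu, h⟩
    exact ⟨(Submodule.Quotient.eq (H10 Ω)).2 hu, e.snd.fst, e.snd.snd,
      (hasH2Trace_iff hT _ _ _).2 he, fun φ hφ φ₁ φ₂ hφ_trace ↦
        (shearForm_apply hDΩ e (Triple.mk φ φ₁ φ₂)).symm.trans
          (h _ ⟨(hasH2Trace_iff hT φ φ₁ φ₂).1 hφ_trace, hφ⟩)⟩

theorem isNormalDeriv_iff {ξ : NegHalf Ω} : IsNormalDeriv D u ξ ↔
    ∀ v ∈ vanishingNear Ω D, ξ (outerTrace v) = dirichletForm Ω (Ω \ D) u v :=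
  forall₂_congr fun v _ ↦ Eq.congr_right (dirichletForm_apply sdiff_subset u v).symm

theorem mk_zero_mem_energySpace (hΩ : IsOpen Ω) (hDΩ : closure D ⊆ Ω)
    (hT₀ : ∀ N, IsOpen N → frontier D ⊆ N → N ⊆ Ω → ∀ u : H1 Ω,
      (∀ᵐ x ∂(volume.restrict Ω), x ∈ N \ closure D → fn u x = 0) → T u = 0)
    (hv : v ∈ vanishingNear Ω D) : Triple.mk v 0 0 ∈ energySpace T (weakDerivGraph L) := by
  obtain ⟨V, hV, hDV, h⟩ := hv
  have hTv : T v = 0 := hT₀ (V ∩ Ω) (hV.inter hΩ)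
    (frontier_subset_closure.trans (subset_inter hDV hDΩ)) inter_subset_right v
    (h.mono fun x hx hxV ↦ hx hxV.1.1)
  refine ⟨?_, (weakDerivGraph L).zero_mem⟩
  change (T v, (0 : L2Curve L)) ∈ weakDerivGraph L
  rw [hTv]
  exact (weakDerivGraph L).zero_mem

theorem exists_isDtNValue (hΩ : IsOpen Ω) (hb : Bornology.IsBounded Ω) (hD : IsSmoothDomain D)
    (hγ : IsArclengthParam (frontier D) L γ) (hDΩ : closure D ⊆ Ω) (hμ : 0 < μ) (hμs : 0 < μs)
    (hℓ : 0 < ℓ) (f : HalfTrace Ω) : ∃ ξ, IsDtNValue D L γ μ μs ℓ f ξ := by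
  have hD_sub : D ⊆ Ω := subset_closure.trans hDΩ
  have h_trace := exists_traceMap hΩ hb hD hγ hDΩ
  obtain ⟨T, hT, hT₀⟩ := h_trace
  have h_coercive := exists_mul_norm_sq_le_dirichletForm hΩ hb hD.isOpen.measurableSet hD_sub hμ
  obtain ⟨c, hc, h_coercive⟩ := h_coercive
  have h_lift := (H10 Ω).mkQ_surjective f
  obtain ⟨v, rfl⟩ := h_lift
  have h_lift := exists_mem_energySpace_sub_mem_H10 hΩ hb hγ hDΩ hT
  have h_data := h_lift v
  obtain ⟨e₀, he₀, he₀v⟩ := h_data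
  have h_solution := exists_energy_solution (isClosed_H10 Ω) (isClosed_weakDerivGraph L) hc
    h_coercive hμs (mul_pos hμs (pow_pos hℓ 2)) he₀
  obtain ⟨e, he, hee₀, h⟩ := h_solution
  have h_flux := exists_energy_flux (isClosed_H10 Ω) (isClosed_weakDerivGraph L) h_lift h
  obtain ⟨ξ, hξ⟩ := h_flux
  have hev : e.fst - v ∈ H10 Ω := by
    rw [← sub_add_sub_cancel e.fst e₀.fst v]
    exact (H10 Ω).add_mem hee₀ he₀v
  exact ⟨ξ, e.fst, (isWeakSolution_iff hD_sub hT).2 ⟨e, he, rfl, hev, h⟩,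
    isNormalDeriv_iff.2 fun v' hv' ↦ (hξ _ (mk_zero_mem_energySpace hΩ hDΩ hT₀ hv')).trans
      (shearForm_mk_zero_of_mem_vanishingNear hD.isOpen hD_sub hv' e)⟩

theorem isDtNValue_dtn (hΩ : IsOpen Ω) (hb : Bornology.IsBounded Ω) (hD : IsSmoothDomain D)
    (hγ : IsArclengthParam (frontier D) L γ) (hDΩ : closure D ⊆ Ω) (hμ : 0 < μ) (hμs : 0 < μs)
    (hℓ : 0 < ℓ) (f : HalfTrace Ω) : IsDtNValue D L γ μ μs ℓ f (dtn Ω D L γ μ μs ℓ f) := by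
  have h := exists_isDtNValue hΩ hb hD hγ hDΩ hμ hμs hℓ f
  rw [dtn, dif_pos h]
  exact h.choose_spec

end WeakSolution

/-! ### The difference of the energies -/

section IntegralIdentity

variable {Ω D : Set Plane} {L : ℝ} {γ : ℝ → Plane} {T : H1 Ω →L[ℝ] L2Curve L} {v : H1 Ω}
  {μ μs ℓ μ' μs' ℓ' : ℝ} {φ : Plane → ℝ} {w : Triple (H1 Ω) (L2Curve L)}

theorem IsDtNValue.exists_mem_energySpace {ξ : NegHalf Ω} (hDΩ : D ⊆ Ω)
    (hT : ∀ u g, IsCurveTrace L γ u g ↔ g = T u)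
    (h : IsDtNValue D L γ μ μs ℓ (outerTrace v) ξ) :
    ∃ e ∈ energySpace T (weakDerivGraph L), e.fst - v ∈ H10 Ω ∧
      (∀ k ∈ energySpaceOn (H10 Ω) T (weakDerivGraph L), shearForm Ω D L μ μs ℓ e k = 0) ∧
      ∀ v' ∈ vanishingNear Ω D, ξ (outerTrace v') = dirichletForm Ω (Ω \ D) e.fst v' := by
  obtain ⟨u, hu, hξ⟩ := h
  have h_solution := (isWeakSolution_iff hDΩ hT).1 hu
  obtain ⟨e, he, rfl, hev, h⟩ := h_solution
  exact ⟨e, he, hev, h, isNormalDeriv_iff.1 hξ⟩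

theorem shearForm_toH1_self (hDΩ : D ⊆ Ω) (hφ : IsTestFunction Ω φ)
    (h₁ : MemLp (deriv fun s ↦ φ (γ s)) 2 (volume.restrict (Ioc 0 L)))
    (h₂ : MemLp (deriv (deriv fun s ↦ φ (γ s))) 2 (volume.restrict (Ioc 0 L))) :
    shearForm Ω D L μ μs ℓ (Triple.mk hφ.toH1 (h₁.toLp _) (h₂.toLp _))
        (Triple.mk hφ.toH1 (h₁.toLp _) (h₂.toLp _))
      = (∫ x in Ω \ D, ‖∇ φ x‖ ^ 2) + μ * (∫ x in D, ‖∇ φ x‖ ^ 2)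
        + μs * (∫ s in Ioc 0 L, deriv (fun s ↦ φ (γ s)) s ^ 2)
        + μs * ℓ ^ 2 * (∫ s in Ioc 0 L, deriv (deriv fun s ↦ φ (γ s)) s ^ 2) := by
  have h_curve {k : ℝ → ℝ} (hk : MemLp k 2 (volume.restrict (Ioc 0 L))) :
      inner ℝ (hk.toLp k) (hk.toLp k) = ∫ s in Ioc 0 L, k s ^ 2 := by
    refine (inner_toLp_curve hk _).trans (integral_congr_ae ?_)
    filter_upwards [hk.coeFn_toLp] with s hs
    rw [hs, sq]
  exact (energyForm_apply _ _).trans <| congrArg₂ (· + ·) (congrArg₂ (· + ·) (congrArg₂ (· + ·)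
    (dirichletForm_ofContDiff_self sdiff_subset (hφ.smooth.of_le (by simp)) hφ.compact)
    (congrArg (μ * ·) (dirichletForm_ofContDiff_self hDΩ (hφ.smooth.of_le (by simp)) hφ.compact)))
    (congrArg (μs * ·) (h_curve h₁))) (congrArg (μs * ℓ ^ 2 * ·) (h_curve h₂))

theorem shearForm_self_eq_of_dtn_eq (hΩ : IsOpen Ω) (hb : Bornology.IsBounded Ω)
    (hD : IsSmoothDomain D) (hγ : IsArclengthParam (frontier D) L γ) (hDΩ : closure D ⊆ Ω)
    (hμ : 0 < μ) (hμs : 0 < μs) (hℓ : 0 < ℓ) (hμ' : 0 < μ') (hμs' : 0 < μs') (hℓ' : 0 < ℓ')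
    (heq : dtn Ω D L γ μ μs ℓ = dtn Ω D L γ μ' μs' ℓ')
    (hT : ∀ u g, IsCurveTrace L γ u g ↔ g = T u)
    (hT₀ : ∀ N, IsOpen N → frontier D ⊆ N → N ⊆ Ω → ∀ u : H1 Ω,
      (∀ᵐ x ∂(volume.restrict Ω), x ∈ N \ closure D → fn u x = 0) → T u = 0)
    (hφ : IsTestFunction Ω φ) (hφD : ∀ x ∈ closure D, Δ φ x = 0)
    {e : Triple (H1 Ω) (L2Curve L)} (he : e ∈ energySpaceOn (H10 Ω) T (weakDerivGraph L))
    (heφ : e.fst = hφ.toH1) :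
    shearForm Ω D L μ μs ℓ e e = shearForm Ω D L μ' μs' ℓ' e e := by
  have hD_sub : D ⊆ Ω := subset_closure.trans hDΩ
  have h_coercive := exists_mul_norm_sq_le_dirichletForm hΩ hb hD.isOpen.measurableSet hD_sub hμ
  obtain ⟨c, hc, h_coercive⟩ := h_coercive
  refine energyForm_self_eq_of_flux_eq (isClosed_H10 Ω) (isClosed_weakDerivGraph L)
    (dirichletForm_comm sdiff_subset) (dirichletForm_comm hD_sub) hc h_coercive hμs
    (mul_pos hμs (pow_pos hℓ 2)) hμ.ne' hμ'.ne' (N := vanishingNear Ω D)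
    (fun _ ↦ mk_zero_mem_energySpace hΩ hDΩ hT₀)
    (fun _ ↦ dirichletForm_eq_zero_of_mem_vanishingNear hD.isOpen hD_sub) he
    (fun w hw h ↦ ?_) (fun v _ ↦ ?_)
  · have h_outside := fn_eq_zero_of_flux_eq_zero hΩ hb hD hγ hDΩ hw.2 h
    have hTw : T w.fst = 0 :=
      hT₀ Ω hΩ (frontier_subset_closure.trans hDΩ) le_rfl _ h_outside
    exact ⟨eq_mk_zero_of_mem_energySpace
        (fun g hg ↦ IsWeakDerivCurve.eq_zero hγ.length_pos (mem_weakDerivGraph.1 hg)) hw.1 hTw,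
      dirichletForm_eq_zero sdiff_subset
        (grad_eq_zero_of_fn_eq_zero_outside hΩ hD.isOpen hγ h_outside),
      (congrArg _ heφ).trans (dirichletForm_toH1_eq_zero hΩ hD.isOpen hγ h_outside hφ hφD)⟩
  · have h_left := (isDtNValue_dtn hΩ hb hD hγ hDΩ hμ hμs hℓ
      (outerTrace v)).exists_mem_energySpace hD_sub hT
    have h_right := (isDtNValue_dtn hΩ hb hD hγ hDΩ hμ' hμs' hℓ'
      (outerTrace v)).exists_mem_energySpace hD_sub hT
    obtain ⟨u, hu, huv, hu_sol, hu_flux⟩ := h_left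
    obtain ⟨u', hu', huv', hu_sol', hu_flux'⟩ := h_right
    exact ⟨u, hu, u', hu', huv, huv', hu_sol, hu_sol', fun v' hv' ↦ (hu_flux v' hv').symm.trans <|
      (congrArg (fun Λ ↦ Λ (outerTrace v) (outerTrace v')) heq).trans (hu_flux' v' hv')⟩

theorem integral_identity_of_isTestFunction (hΩ : IsOpen Ω) (hb : Bornology.IsBounded Ω)
    (hD : IsSmoothDomain D) (hγ : IsArclengthParam (frontier D) L γ) (hDΩ : closure D ⊆ Ω)
    (hμ : 0 < μ) (hμs : 0 < μs) (hℓ : 0 < ℓ) (hμ' : 0 < μ') (hμs' : 0 < μs') (hℓ' : 0 < ℓ')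
    (heq : dtn Ω D L γ μ μs ℓ = dtn Ω D L γ μ' μs' ℓ') (hφ : IsTestFunction Ω φ)
    (hφD : ∀ x ∈ closure D, Δ φ x = 0) :
    (μ - μ') * (∫ x in D, ‖∇ φ x‖ ^ 2)
      + (μs - μs') * (∫ s in Ioc 0 L, deriv (fun s ↦ φ (γ s)) s ^ 2)
      + (μs * ℓ ^ 2 - μs' * ℓ' ^ 2) * (∫ s in Ioc 0 L, deriv (deriv fun s ↦ φ (γ s)) s ^ 2)
      = 0 := by
  have hD_sub : D ⊆ Ω := subset_closure.trans hDΩ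
  have h_trace := exists_traceMap hΩ hb hD hγ hDΩ
  obtain ⟨T, hT, hT₀⟩ := h_trace
  have hk : ContDiff ℝ ∞ (deriv fun s ↦ φ (γ s)) :=
    (contDiff_infty_iff_deriv.1 (contDiff_comp_curve hγ hDΩ hφ.smooth.contDiffOn)).2
  have h₁ := memLp_Ioc (L := L) hk.continuous
  have h₂ := memLp_Ioc (L := L) (hk.continuous_deriv (by simp))
  have h_mem := (hasH2Trace_iff hT hφ.toH1 _ _).1
    (hasH2Trace_of_contDiffOn hγ hDΩ hφ.smooth.contDiffOn hφ.fn_toH1 h₁ h₂)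
  have h := shearForm_self_eq_of_dtn_eq hΩ hb hD hγ hDΩ hμ hμs hℓ hμ' hμs' hℓ' heq hT hT₀ hφ hφD
    (e := Triple.mk hφ.toH1 (h₁.toLp _) (h₂.toLp _)) ⟨h_mem, hφ.toH1_mem_H10⟩ rfl
  have h_left := shearForm_toH1_self (μ := μ) (μs := μs) (ℓ := ℓ) hD_sub hφ h₁ h₂
  have h_right := shearForm_toH1_self (μ := μ') (μs := μs') (ℓ := ℓ') hD_sub hφ h₁ h₂
  linarith [h_left.symm.trans (h.trans h_right)]

theorem exists_isTestFunction_eventuallyEq {K : Set Plane} (hΩ : IsOpen Ω)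
    (hb : Bornology.IsBounded Ω) (hK : IsClosed K) (hKΩ : K ⊆ Ω) (hφ : ContDiff ℝ ∞ φ) :
    ∃ ψ, IsTestFunction Ω ψ ∧ ∀ x ∈ K, ψ =ᶠ[𝓝 x] φ := by
  obtain ⟨χ, hχ_zero, hχ_one, -⟩ := exists_contMDiffMap_zero_one_nhds_of_isClosed (n := (⊤ : ℕ∞))
    (modelWithCornersSelf ℝ Plane) hΩ.isClosed_compl hK (disjoint_compl_left_iff_subset.2 hKΩ)
  rw [eventually_nhdsSet_iff_forall] at hχ_zero hχ_one
  have h_supp : tsupport (fun x ↦ χ x * φ x) ⊆ Ω := fun x hx ↦ by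
    by_contra hxΩ
    refine (notMem_tsupport_iff_eventuallyEq.2 ?_) hx
    filter_upwards [hχ_zero x hxΩ] with y hy
    rw [hy, zero_mul, Pi.zero_apply]
  refine ⟨fun x ↦ χ x * φ x, ⟨χ.contMDiff.contDiff.mul hφ, ?_, h_supp⟩, fun x hx ↦ ?_⟩
  · exact isCompact_of_isClosed_isBounded (isClosed_tsupport _) (hb.subset h_supp)
  · filter_upwards [hχ_one x hx] with y hy
    rw [hy, one_mul]

theorem integral_identity (hΩ : IsOpen Ω) (hb : Bornology.IsBounded Ω)
    (hD : IsSmoothDomain D) (hγ : IsArclengthParam (frontier D) L γ) (hDΩ : closure D ⊆ Ω)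
    (hμ : 0 < μ) (hμs : 0 < μs) (hℓ : 0 < ℓ) (hμ' : 0 < μ') (hμs' : 0 < μs') (hℓ' : 0 < ℓ')
    (heq : dtn Ω D L γ μ μs ℓ = dtn Ω D L γ μ' μs' ℓ') (hφ : ContDiff ℝ ∞ φ)
    (hφ_harm : ∀ x, Δ φ x = 0) :
    (μ - μ') * (∫ x in D, ‖∇ φ x‖ ^ 2)
      + (μs - μs') * (∫ s in Ioc 0 L, deriv (fun s ↦ φ (γ s)) s ^ 2)
      + (μs * ℓ ^ 2 - μs' * ℓ' ^ 2) * (∫ s in Ioc 0 L, deriv (deriv fun s ↦ φ (γ s)) s ^ 2)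
      = 0 := by
  obtain ⟨ψ, hψ, h_eq⟩ := exists_isTestFunction_eventuallyEq hΩ hb isClosed_closure hDΩ hφ
  have h := integral_identity_of_isTestFunction hΩ hb hD hγ hDΩ hμ hμs hℓ hμ' hμs' hℓ' heq hψ
    fun x hx ↦ (laplacian_congr_nhds (h_eq x hx)).self_of_nhds.trans (hφ_harm x)
  have h_curve : (fun s ↦ ψ (γ s)) = fun s ↦ φ (γ s) := funext fun s ↦
    (h_eq _ (frontier_subset_closure (hγ.mem s))).self_of_nhds
  have h_grad : ∫ x in D, ‖∇ ψ x‖ ^ 2 = ∫ x in D, ‖∇ φ x‖ ^ 2 := by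
    refine setIntegral_congr_fun hD.isOpen.measurableSet fun x hx ↦ ?_
    simp only [norm_gradient, (h_eq x (subset_closure hx)).fderiv_eq]
  rwa [h_curve, h_grad] at h

end IntegralIdentity

/-! ### Harmonic exponentials -/

section ExpWave

/-- The identification of the plane with `ℂ` that sends `(x₀, x₁)` to `x₀ + i x₁`. -/
noncomputable def toComplex : Plane ≃ₗᵢ[ℝ] ℂ := Complex.orthonormalBasisOneI.repr.symm

theorem toComplex_apply (x : Plane) : toComplex x = x 0 + x 1 * Complex.I :=
  Complex.orthonormalBasisOneI_repr_symm_apply x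

theorem toComplex_re (x : Plane) : (toComplex x).re = x 0 := by
  simp [toComplex_apply]

/-- The harmonic function `x ↦ Re (w exp (l z))`, `z = x₀ + i x₁`. The amplitude `w` is kept
general because differentiation along a vector `v` multiplies it by `l v`. -/
noncomputable def expWave (l : ℝ) (w : ℂ) (x : Plane) : ℝ :=
  (w * Complex.exp (l * toComplex x)).re

variable {c : ℝ → Plane} {v : Plane} {s l : ℝ}

theorem contDiff_expWave (l : ℝ) (w : ℂ) : ContDiff ℝ ∞ (expWave l w) :=
  Complex.reCLM.contDiff.comp <| contDiff_const.mul <|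
    (contDiff_const.mul toComplex.toContinuousLinearEquiv.contDiff).cexp

theorem laplacian_expWave (l : ℝ) (w : ℂ) (x : Plane) : Δ (expWave l w) x = 0 := by
  have h_analytic : AnalyticAt ℂ (fun z ↦ w * Complex.exp (l * z)) (toComplex x) := by fun_prop
  exact (laplacian_comp_linearIsometryEquiv toComplex
    (fun z ↦ (w * Complex.exp (l * z)).re) x).trans h_analytic.harmonicAt_re.2.self_of_nhds

theorem hasDerivAt_expWave {w : ℝ → ℂ} {w' : ℂ} (hw : HasDerivAt w w' s) (hc : HasDerivAt c v s) :
    HasDerivAt (fun s ↦ expWave l (w s) (c s))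
      (expWave l (w' + l * toComplex v * w s) (c s)) s := by
  have hc' : HasDerivAt (fun s ↦ toComplex (c s)) (toComplex v) s :=
    toComplex.toContinuousLinearEquiv.hasFDerivAt.comp_hasDerivAt s hc
  convert! Complex.reCLM.hasFDerivAt.comp_hasDerivAt s (hw.mul (hc'.const_mul (l : ℂ)).cexp) using 1
  rw [expWave, Complex.reCLM_apply]
  congr 1
  ring

theorem fderiv_expWave (l : ℝ) (w : ℂ) (x v : Plane) :
    fderiv ℝ (expWave l w) x v = expWave l (l * toComplex v * w) x := by
  have h_line : HasDerivAt (fun t : ℝ ↦ x + t • v) v 0 := by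
    simpa using ((hasDerivAt_id (0 : ℝ)).smul_const v).const_add x
  have h := hasDerivAt_expWave (l := l) (hasDerivAt_const 0 w) h_line
  rw [← ((contDiff_expWave l w).differentiable (by simp) x).lineDeriv_eq_fderiv, lineDeriv]
  simpa using h.deriv

theorem expWave_sq_add_expWave_I_mul_sq (l : ℝ) (w : ℂ) (x : Plane) :
    expWave l w x ^ 2 + expWave l (Complex.I * w) x ^ 2 = ‖w‖ ^ 2 * Real.exp (2 * l * x 0) := by
  have h_norm : ‖w * Complex.exp (l * toComplex x)‖ ^ 2 = ‖w‖ ^ 2 * Real.exp (2 * l * x 0) := by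
    rw [norm_mul, mul_pow, Complex.norm_exp, Complex.re_ofReal_mul, toComplex_re,
      ← Real.exp_nat_mul, Nat.cast_two, mul_assoc]
  rw [← h_norm, expWave, expWave, mul_assoc, Complex.I_mul_re, Complex.sq_norm,
    Complex.normSq_apply]
  ring

theorem norm_gradient_expWave_sq (l : ℝ) (w : ℂ) (x : Plane) :
    ‖∇ (expWave l w) x‖ ^ 2 = l ^ 2 * ‖w‖ ^ 2 * Real.exp (2 * l * x 0) := by
  let b := EuclideanSpace.basisFun (Fin 2) ℝ
  have h₀ : toComplex (b 0) = 1 := by simp [b, toComplex_apply]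
  have h₁ : toComplex (b 1) = Complex.I := by simp [b, toComplex_apply]
  have h_norm : ‖(l : ℂ) * w‖ ^ 2 = l ^ 2 * ‖w‖ ^ 2 := by
    rw [norm_mul, mul_pow, Complex.norm_real, Real.norm_eq_abs, sq_abs]
  rw [← h_norm, ← expWave_sq_add_expWave_I_mul_sq, ← b.sum_sq_norm_inner_left, Fin.sum_univ_two,
    inner_gradient_left, inner_gradient_left, fderiv_expWave, fderiv_expWave, h₀, h₁, mul_one,
    mul_right_comm, mul_comm _ Complex.I, Real.norm_eq_abs, Real.norm_eq_abs, sq_abs, sq_abs]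

end ExpWave

section Curve

variable {Γ : Set Plane} {L : ℝ} {γ : ℝ → Plane}

theorem IsArclengthParam.contDiff_deriv (hγ : IsArclengthParam Γ L γ) : ContDiff ℝ ∞ (deriv γ) :=
  (contDiff_infty_iff_deriv.1 hγ.smooth).2

theorem IsArclengthParam.continuous_deriv_deriv (hγ : IsArclengthParam Γ L γ) :
    Continuous (deriv (deriv γ)) :=
  hγ.contDiff_deriv.continuous_deriv (by simp)

/-- The factor `exp (-l z) ∂ₛ² exp (l z)` of the second tangential derivative of `exp (l z)` along
the curve `γ`. -/
noncomputable def curveSymbol (γ : ℝ → Plane) (l s : ℝ) : ℂ :=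
  l * toComplex (deriv (deriv γ) s) + (l * toComplex (deriv γ s)) ^ 2

theorem deriv_expWave_curve (hγ : IsArclengthParam Γ L γ) (l : ℝ) (w : ℂ) :
    deriv (fun s ↦ expWave l w (γ s))
      = fun s ↦ expWave l (l * toComplex (deriv γ s) * w) (γ s) := by
  funext s
  have h := hasDerivAt_expWave (l := l) (hasDerivAt_const s w) (hγ.differentiable s).hasDerivAt
  rw [h.deriv, zero_add]

theorem deriv_deriv_expWave_curve (hγ : IsArclengthParam Γ L γ) (l : ℝ) (w : ℂ) :
    deriv (deriv fun s ↦ expWave l w (γ s))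
      = fun s ↦ expWave l (curveSymbol γ l s * w) (γ s) := by
  rw [deriv_expWave_curve hγ]
  funext s
  have h_tangent : HasDerivAt (fun s ↦ toComplex (deriv γ s)) (toComplex (deriv (deriv γ) s)) s :=
    toComplex.toContinuousLinearEquiv.hasFDerivAt.comp_hasDerivAt s
      (hγ.contDiff_deriv.differentiable (by simp) s).hasDerivAt
  have h := hasDerivAt_expWave (l := l) ((h_tangent.const_mul (l : ℂ)).mul_const w)
    (hγ.differentiable s).hasDerivAt
  rw [h.deriv, curveSymbol]
  congr 1
  ring

theorem deriv_sq_add_deriv_sq (hγ : IsArclengthParam Γ L γ) (l s : ℝ) :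
    deriv (fun s ↦ expWave l 1 (γ s)) s ^ 2 + deriv (fun s ↦ expWave l Complex.I (γ s)) s ^ 2
      = l ^ 2 * Real.exp (2 * l * γ s 0) := by
  simp only [deriv_expWave_curve hγ]
  rw [mul_one, mul_comm _ Complex.I, expWave_sq_add_expWave_I_mul_sq, norm_mul,
    toComplex.norm_map, hγ.unit_speed, mul_one, Complex.norm_real, Real.norm_eq_abs, sq_abs]

theorem deriv_deriv_sq_add_deriv_deriv_sq (hγ : IsArclengthParam Γ L γ) (l s : ℝ) :
    deriv (deriv fun s ↦ expWave l 1 (γ s)) s ^ 2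
        + deriv (deriv fun s ↦ expWave l Complex.I (γ s)) s ^ 2
      = ‖curveSymbol γ l s‖ ^ 2 * Real.exp (2 * l * γ s 0) := by
  simp only [deriv_deriv_expWave_curve hγ]
  rw [mul_one, mul_comm _ Complex.I, expWave_sq_add_expWave_I_mul_sq]

theorem continuous_curveSymbol (hγ : IsArclengthParam Γ L γ) (l : ℝ) :
    Continuous (curveSymbol γ l) := by
  have := hγ.continuous_deriv
  have := hγ.continuous_deriv_deriv
  unfold curveSymbol
  fun_prop

theorem eventually_le_norm_curveSymbol (hγ : IsArclengthParam Γ L γ) :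
    ∀ᶠ l in atTop, ∀ s ∈ Ioc 0 L, l ^ 2 / 2 ≤ ‖curveSymbol γ l s‖ := by
  obtain ⟨κ, hκ⟩ := (isCompact_Icc (a := (0 : ℝ)) (b := L)).exists_bound_of_continuousOn
    hγ.continuous_deriv_deriv.continuousOn
  filter_upwards [eventually_ge_atTop 0, eventually_ge_atTop (2 * κ)] with l hl hlκ s hs
  have h_curvature : ‖l * toComplex (deriv (deriv γ) s)‖ ≤ l * κ := by
    rw [norm_mul, toComplex.norm_map, Complex.norm_of_nonneg hl]
    gcongr
    exact hκ s (Ioc_subset_Icc_self hs)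
  have h_tangent : ‖(l * toComplex (deriv γ s)) ^ 2‖ = l ^ 2 := by
    rw [norm_pow, norm_mul, toComplex.norm_map, hγ.unit_speed, mul_one,
      Complex.norm_of_nonneg hl]
  have h_triangle := norm_sub_le_norm_add ((l * toComplex (deriv γ s)) ^ 2)
    (l * toComplex (deriv (deriv γ) s))
  rw [curveSymbol, add_comm]
  nlinarith

end Curve

/-! ### Asymptotics of the exponential integrals -/

section Asymptotics

theorem eq_zero_of_tendsto {ι : Type*} {f : Filter ι} [f.NeBot] {m b a : ℝ} {p q : ι → ℝ}
    (hp : Tendsto p f (𝓝 0)) (hp₀ : ∀ x, p x ≠ 0) (hq : Tendsto q f atTop)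
    (h : ∀ᶠ x in f, m * p x + b + a * q x = 0) : m = 0 ∧ b = 0 ∧ a = 0 := by
  have h_mpb : Tendsto (fun x ↦ m * p x + b) f (𝓝 b) := by
    simpa using (hp.const_mul m).add_const b
  obtain rfl : a = 0 := by
    by_contra ha
    refine not_tendsto_nhds_of_tendsto_atTop hq (-b / a) ((h_mpb.neg.div_const a).congr' ?_)
    filter_upwards [h] with x hx
    rw [div_eq_iff ha]
    linarith
  simp only [zero_mul, add_zero] at h
  obtain rfl : b = 0 :=
    tendsto_nhds_unique h_mpb (tendsto_const_nhds.congr' (h.mono fun _ ↦ Eq.symm))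
  obtain ⟨x, hx⟩ := h.exists
  rw [add_zero] at hx
  exact ⟨(mul_eq_zero.1 hx).resolve_right (hp₀ x), rfl, rfl⟩

theorem mul_le_setIntegral_of_periodic {f : ℝ → ℝ} {L s₀ τ c : ℝ} (hf : Continuous f)
    (hf₀ : ∀ s, 0 ≤ f s) (hL : Function.Periodic f L) (hτ : 0 ≤ τ) (hτL : τ ≤ L)
    (hc : ∀ s ∈ Icc s₀ (s₀ + τ), c ≤ f s) : τ * c ≤ ∫ s in Ioc 0 L, f s :=
  calc τ * c = ∫ _ in s₀..s₀ + τ, c := by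
        rw [intervalIntegral.integral_const, smul_eq_mul, add_sub_cancel_left]
    _ ≤ ∫ s in s₀..s₀ + τ, f s :=
        intervalIntegral.integral_mono_on (by linarith) intervalIntegrable_const
          (hf.intervalIntegrable _ _) hc
    _ ≤ ∫ s in s₀..s₀ + L, f s :=
        intervalIntegral.integral_mono_interval le_rfl (by linarith) (by linarith)
          (Eventually.of_forall hf₀) (hf.intervalIntegrable _ _)
    _ = ∫ s in Ioc 0 L, f s := by
        rw [← intervalIntegral.integral_of_le (hτ.trans hτL), hL.intervalIntegral_add_eq s₀ 0,
          zero_add]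

/-- The constant `A` is arbitrary because `f` is flat at its critical point `s₀`: on an interval of
length `1 / (η t)` next to `s₀` it drops by at most `1 / t`, for every `η > 0`. -/
theorem eventually_le_setIntegral_exp_of_periodic {f : ℝ → ℝ} {L s₀ A : ℝ} (hf : Continuous f)
    (hL₀ : 0 < L) (hL : Function.Periodic f L) (hs₀ : HasDerivAt f 0 s₀) (hA : 0 < A) :
    ∀ᶠ t in atTop, A * (Real.exp (t * f s₀) / t) ≤ ∫ s in Ioc 0 L, Real.exp (t * f s) := by
  set η := Real.exp (-1) / A with hη
  have hη₀ : 0 < η := by positivity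
  obtain ⟨δ, hδ, h_flat⟩ := Metric.eventually_nhds_iff.1 (hs₀.isLittleO.bound hη₀)
  simp only [smul_zero, sub_zero, Real.norm_eq_abs, Real.dist_eq] at h_flat
  have hτ : Tendsto (fun t : ℝ ↦ (η * t)⁻¹) atTop (𝓝 0) :=
    (tendsto_id.const_mul_atTop hη₀).inv_tendsto_atTop
  filter_upwards [hτ.eventually_lt_const hδ, hτ.eventually_lt_const hL₀, eventually_gt_atTop 0]
    with t hτδ hτL ht
  have h_drop (s : ℝ) (hs : s ∈ Icc s₀ (s₀ + (η * t)⁻¹)) : f s₀ - t⁻¹ ≤ f s := by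
    have h_abs : |s - s₀| ≤ (η * t)⁻¹ := by
      rw [abs_of_nonneg (by linarith [hs.1])]
      linarith [hs.2]
    have h_le : η * |s - s₀| ≤ t⁻¹ :=
      calc η * |s - s₀| ≤ η * (η * t)⁻¹ := by gcongr
        _ = t⁻¹ := by field_simp
    linarith [(abs_le.1 (h_flat (h_abs.trans_lt hτδ))).1]
  calc A * (Real.exp (t * f s₀) / t) = (η * t)⁻¹ * Real.exp (t * (f s₀ - t⁻¹)) := by
        rw [hη, mul_sub, mul_inv_cancel₀ ht.ne', sub_eq_add_neg, Real.exp_add]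
        field_simp
    _ ≤ ∫ s in Ioc 0 L, Real.exp (t * f s) :=
        mul_le_setIntegral_of_periodic (by fun_prop) (fun _ ↦ (Real.exp_pos _).le)
          (hL.comp fun y ↦ Real.exp (t * y)) (by positivity) hτL.le fun s hs ↦
          Real.exp_le_exp.2 (mul_le_mul_of_nonneg_left (h_drop s hs) ht.le)

variable {D : Set Plane} {L : ℝ} {γ : ℝ → Plane}

theorem exists_mem_frontier_forall_coord_le (hD : IsOpen D) (hb : Bornology.IsBounded D)
    (hne : D.Nonempty) : ∃ y ∈ frontier D, ∀ x ∈ closure D, x 0 ≤ y 0 := by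
  obtain ⟨y, hy, h_max⟩ := hb.isCompact_closure.exists_isMaxOn hne.closure
    (f := fun x : Plane ↦ x 0) (by fun_prop)
  refine ⟨y, hD.frontier_eq ▸ ⟨hy, fun hyD ↦ ?_⟩, h_max⟩
  have h_zero : (EuclideanSpace.proj 0 : Plane →L[ℝ] ℝ) = 0 :=
    (h_max.isLocalMax (mem_of_superset (hD.mem_nhds hyD) subset_closure)).hasFDerivAt_eq_zero
      (EuclideanSpace.proj 0 : Plane →L[ℝ] ℝ).hasFDerivAt
  simpa using congrArg (· (EuclideanSpace.single (0 : Fin 2) (1 : ℝ))) h_zero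

theorem exists_setIntegral_exp_coord_le (hb : Bornology.IsBounded D) {M : ℝ}
    (hM : ∀ x ∈ D, x 0 ≤ M) :
    ∃ C > 0, ∀ t > 0, ∫ x in D, Real.exp (t * x 0) ≤ C * (Real.exp (t * M) / t) := by
  obtain ⟨R, hR₀, hR⟩ := hb.subset_closedBall_lt 0 (0 : Plane)
  refine ⟨2 * R, by positivity, fun t ht ↦ ?_⟩
  have h_sub : D ⊆ box (Iic M) (Icc (-R) R) := fun x hx ↦
    ⟨hM x hx, abs_le.1 ((PiLp.norm_apply_le x 1).trans (by simpa using hR hx))⟩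
  have h_meas : Measurable fun x : Plane ↦ Real.exp (t * x 0) := by fun_prop
  rw [integral_eq_lintegral_of_nonneg_ae (Eventually.of_forall fun _ ↦ (Real.exp_pos _).le)
    h_meas.aestronglyMeasurable]
  refine ENNReal.toReal_le_of_le_ofReal (by positivity) ?_
  calc ∫⁻ x in D, ENNReal.ofReal (Real.exp (t * x 0))
      ≤ ∫⁻ x in box (Iic M) (Icc (-R) R), ENNReal.ofReal (Real.exp (t * x 0)) :=
        lintegral_mono_set h_sub
    _ = ∫⁻ s in Iic M, ∫⁻ _ in Icc (-R) R, ENNReal.ofReal (Real.exp (t * s)) :=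
        lintegral_box measurableSet_Iic measurableSet_Icc h_meas.ennreal_ofReal
    _ = ENNReal.ofReal (2 * R) * ∫⁻ s in Iic M, ENNReal.ofReal (Real.exp (t * s)) := by
        simp only [setLIntegral_const, Real.volume_Icc, sub_neg_eq_add, ← two_mul]
        rw [lintegral_mul_const' _ _ ENNReal.ofReal_ne_top, mul_comm]
    _ = ENNReal.ofReal (2 * R * (Real.exp (t * M) / t)) := by
        rw [← ofReal_integral_eq_lintegral_ofReal (integrableOn_exp_mul_Iic ht M)
          (Eventually.of_forall fun _ ↦ (Real.exp_pos _).le), integral_exp_mul_Iic ht,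
          ← ENNReal.ofReal_mul (by positivity)]

theorem setIntegral_exp_coord_pos (hD : IsOpen D) (hb : Bornology.IsBounded D) (hne : D.Nonempty)
    (t : ℝ) : 0 < ∫ x in D, Real.exp (t * x 0) := by
  have : NeZero (volume D) := ⟨(hD.measure_pos _ hne).ne'⟩
  have h_cont : Continuous fun x : Plane ↦ Real.exp (t * x 0) := by fun_prop
  exact integral_exp_pos
    ((h_cont.continuousOn.integrableOn_compact hb.isCompact_closure).mono_set subset_closure)

theorem setIntegral_exp_curve_pos (hγ : IsArclengthParam (frontier D) L γ) (t : ℝ) :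
    0 < ∫ s in Ioc 0 L, Real.exp (t * γ s 0) := by
  have : NeZero (volume (Ioc 0 L)) := ⟨by simpa using hγ.length_pos⟩
  have hγ_cont := hγ.smooth.continuous
  have h_cont : Continuous fun s ↦ Real.exp (t * γ s 0) := by fun_prop
  exact integral_exp_pos (h_cont.integrableOn_Icc.mono_set Ioc_subset_Icc_self)

theorem tendsto_setIntegral_exp_div (hD : IsOpen D) (hb : Bornology.IsBounded D)
    (hne : D.Nonempty) (hγ : IsArclengthParam (frontier D) L γ) :
    Tendsto (fun t ↦ (∫ x in D, Real.exp (t * x 0)) / ∫ s in Ioc 0 L, Real.exp (t * γ s 0)) atTop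
      (𝓝 0) := by
  obtain ⟨y, hy, h_max⟩ := exists_mem_frontier_forall_coord_le hD hb hne
  obtain ⟨s₀, rfl⟩ := hγ.range_eq.symm ▸ hy
  obtain ⟨C, hC, h_area⟩ := exists_setIntegral_exp_coord_le hb fun x hx ↦
    h_max x (subset_closure hx)
  have h_deriv : HasDerivAt (fun s ↦ γ s 0) (deriv γ s₀ 0) s₀ :=
    (EuclideanSpace.proj 0 : Plane →L[ℝ] ℝ).hasFDerivAt.comp_hasDerivAt s₀
      (hγ.differentiable s₀).hasDerivAt
  have h_crit : deriv γ s₀ 0 = 0 := IsLocalMax.hasDerivAt_eq_zero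
    (Eventually.of_forall fun s ↦ h_max _ (frontier_subset_closure (hγ.mem s))) h_deriv
  rw [h_crit] at h_deriv
  have hγ_cont := hγ.smooth.continuous
  have h_length {A : ℝ} (hA : 0 < A) := eventually_le_setIntegral_exp_of_periodic
    (f := fun s ↦ γ s 0) (by fun_prop) hγ.length_pos (hγ.periodic.comp fun x : Plane ↦ x 0)
    h_deriv hA
  refine (nhds_basis_Icc_pos 0).tendsto_right_iff.2 fun ε hε ↦ ?_
  filter_upwards [h_length (div_pos hC hε), eventually_gt_atTop 0] with t h_le ht
  have hJ := setIntegral_exp_curve_pos hγ t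
  refine ⟨(by linarith : 0 - ε ≤ 0).trans
    (div_nonneg (setIntegral_exp_coord_pos hD hb hne t).le hJ.le), ?_⟩
  rw [zero_add, div_le_iff₀ hJ]
  calc ∫ x in D, Real.exp (t * x 0) ≤ C * (Real.exp (t * γ s₀ 0) / t) := h_area t ht
    _ = ε * (C / ε * (Real.exp (t * γ s₀ 0) / t)) := by field_simp
    _ ≤ ε * ∫ s in Ioc 0 L, Real.exp (t * γ s 0) := by gcongr

end Asymptotics

/-! ### Identification of the parameters -/

section Identification

variable {D : Set Plane} {L m b a : ℝ} {γ : ℝ → Plane}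

theorem setIntegral_sq_add_setIntegral_sq {f g h : ℝ → ℝ} (hf : Continuous f) (hg : Continuous g)
    (h_eq : ∀ s, f s ^ 2 + g s ^ 2 = h s) :
    (∫ s in Ioc 0 L, f s ^ 2) + ∫ s in Ioc 0 L, g s ^ 2 = ∫ s in Ioc 0 L, h s := by
  simp only [← h_eq]
  exact (integral_add (hf.pow 2).integrableOn_Ioc (hg.pow 2).integrableOn_Ioc).symm

theorem integral_identity_expWave (hγ : IsArclengthParam (frontier D) L γ)
    (h : ∀ φ : Plane → ℝ, ContDiff ℝ ∞ φ → (∀ x, Δ φ x = 0) →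
      m * (∫ x in D, ‖∇ φ x‖ ^ 2) + b * (∫ s in Ioc 0 L, deriv (fun s ↦ φ (γ s)) s ^ 2)
        + a * (∫ s in Ioc 0 L, deriv (deriv fun s ↦ φ (γ s)) s ^ 2) = 0) (l : ℝ) :
    2 * m * (l ^ 2 * ∫ x in D, Real.exp (2 * l * x 0))
      + b * (l ^ 2 * ∫ s in Ioc 0 L, Real.exp (2 * l * γ s 0))
      + a * (∫ s in Ioc 0 L, ‖curveSymbol γ l s‖ ^ 2 * Real.exp (2 * l * γ s 0)) = 0 := by
  have h_deriv (w : ℂ) : ContDiff ℝ ∞ (deriv fun s ↦ expWave l w (γ s)) :=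
    (contDiff_infty_iff_deriv.1 ((contDiff_expWave l w).comp hγ.smooth)).2
  have h_first := setIntegral_sq_add_setIntegral_sq (L := L) (h_deriv 1).continuous
    (h_deriv Complex.I).continuous (deriv_sq_add_deriv_sq hγ l)
  have h_second := setIntegral_sq_add_setIntegral_sq (L := L)
    ((h_deriv 1).continuous_deriv (by simp)) ((h_deriv Complex.I).continuous_deriv (by simp))
    (deriv_deriv_sq_add_deriv_deriv_sq hγ l)
  have h_one := h _ (contDiff_expWave l 1) (laplacian_expWave l 1)
  have h_I := h _ (contDiff_expWave l Complex.I) (laplacian_expWave l Complex.I)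
  simp only [norm_gradient_expWave_sq, norm_one, Complex.norm_I, one_pow, mul_one,
    integral_const_mul] at h_one h_I h_first
  rw [← h_first, ← h_second]
  linear_combination h_one + h_I

theorem tendsto_setIntegral_curveSymbol_div (hγ : IsArclengthParam (frontier D) L γ) :
    Tendsto (fun l ↦ (∫ s in Ioc 0 L, ‖curveSymbol γ l s‖ ^ 2 * Real.exp (2 * l * γ s 0))
      / (l ^ 2 * ∫ s in Ioc 0 L, Real.exp (2 * l * γ s 0))) atTop atTop := by
  have h_sq : Tendsto (fun l : ℝ ↦ l ^ 2 / 4) atTop atTop :=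
    (tendsto_pow_atTop two_ne_zero).atTop_div_const (by norm_num)
  refine tendsto_atTop_mono' _ ?_ h_sq
  filter_upwards [eventually_le_norm_curveSymbol hγ, eventually_gt_atTop 0] with l h_symbol hl
  have hJ := setIntegral_exp_curve_pos hγ (2 * l)
  have hγ_cont := hγ.smooth.continuous
  have h_cont := continuous_curveSymbol hγ l
  rw [le_div_iff₀ (by positivity)]
  calc l ^ 2 / 4 * (l ^ 2 * ∫ s in Ioc 0 L, Real.exp (2 * l * γ s 0))
      = ∫ s in Ioc 0 L, (l ^ 2 / 2) ^ 2 * Real.exp (2 * l * γ s 0) := by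
        rw [integral_const_mul]
        ring
    _ ≤ ∫ s in Ioc 0 L, ‖curveSymbol γ l s‖ ^ 2 * Real.exp (2 * l * γ s 0) := by
        refine setIntegral_mono_on (Continuous.integrableOn_Ioc (by fun_prop))
          (Continuous.integrableOn_Ioc (by fun_prop)) measurableSet_Ioc fun s hs ↦ ?_
        have := h_symbol s hs
        gcongr

theorem eq_zero_of_integral_identity (hD : IsOpen D) (hb : Bornology.IsBounded D)
    (hne : D.Nonempty) (hγ : IsArclengthParam (frontier D) L γ)
    (h : ∀ φ : Plane → ℝ, ContDiff ℝ ∞ φ → (∀ x, Δ φ x = 0) →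
      m * (∫ x in D, ‖∇ φ x‖ ^ 2) + b * (∫ s in Ioc 0 L, deriv (fun s ↦ φ (γ s)) s ^ 2)
        + a * (∫ s in Ioc 0 L, deriv (deriv fun s ↦ φ (γ s)) s ^ 2) = 0) :
    m = 0 ∧ b = 0 ∧ a = 0 := by
  have h_area : Tendsto (fun l ↦ (∫ x in D, Real.exp (2 * l * x 0))
      / ∫ s in Ioc 0 L, Real.exp (2 * l * γ s 0)) atTop (𝓝 0) :=
    (tendsto_setIntegral_exp_div hD hb hne hγ).comp (tendsto_id.const_mul_atTop two_pos)
  have h_zero := eq_zero_of_tendsto (m := 2 * m) (b := b) (a := a) h_area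
    (fun l ↦ (div_pos (setIntegral_exp_coord_pos hD hb hne _)
      (setIntegral_exp_curve_pos hγ _)).ne') (tendsto_setIntegral_curveSymbol_div hγ) ?_
  · simpa using h_zero
  · filter_upwards [eventually_gt_atTop 0] with l hl
    have hJ := setIntegral_exp_curve_pos hγ (2 * l)
    have h_identity := integral_identity_expWave hγ h l
    field_simp
    linarith

end Identification

end AntiplaneShear

theorem theorem4p2_general (Ω D : Set AntiplaneShear.Plane) (hΩ : IsOpen Ω)
    (hb : Bornology.IsBounded Ω) (hD : AntiplaneShear.IsSmoothDomain D) (hDΩ : closure D ⊆ Ω)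
    (L : ℝ) (γ : ℝ → AntiplaneShear.Plane)
    (hγ : AntiplaneShear.IsArclengthParam (frontier D) L γ) :
    Set.InjOn
      (fun p : ℝ × ℝ × ℝ ↦ AntiplaneShear.dtn Ω D L γ p.1 p.2.1 p.2.2)
      {p : ℝ × ℝ × ℝ | 0 < p.1 ∧ 0 < p.2.1 ∧ 0 < p.2.2} := by
  rintro ⟨μ, μs, ℓ⟩ ⟨hμ, hμs, hℓ⟩ ⟨μ', μs', ℓ'⟩ ⟨hμ', hμs', hℓ'⟩ h_dtn
  dsimp only at hμ hμs hℓ hμ' hμs' hℓ' h_dtn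
  obtain ⟨h_bulk, h_tension, h_bending⟩ := AntiplaneShear.eq_zero_of_integral_identity hD.isOpen
    hD.isBounded hD.isConnected.nonempty hγ fun φ hφ hφ_harm ↦ AntiplaneShear.integral_identity
      hΩ hb hD hγ hDΩ hμ hμs hℓ hμ' hμs' hℓ' h_dtn hφ hφ_harm
  obtain rfl : μ = μ' := sub_eq_zero.1 h_bulk
  obtain rfl : μs = μs' := sub_eq_zero.1 h_tension
  have hℓ_sq : ℓ ^ 2 = ℓ' ^ 2 := mul_left_cancel₀ hμs.ne' (sub_eq_zero.1 h_bending)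
  rw [(pow_left_inj₀ hℓ.le hℓ'.le two_ne_zero).1 hℓ_sq]

theorem theorem4p2 (Ω D : Set AntiplaneShear.Plane)
    (hΩ : AntiplaneShear.IsSmoothDomain Ω) (hD : AntiplaneShear.IsSmoothDomain D)
    (hDΩ : closure D ⊆ Ω)
    (L : ℝ) (γ : ℝ → AntiplaneShear.Plane)
    (hγ : AntiplaneShear.IsArclengthParam (frontier D) L γ) :
    Set.InjOn
      (fun p : ℝ × ℝ × ℝ => AntiplaneShear.dtn Ω D L γ p.1 p.2.1 p.2.2)
      {p : ℝ × ℝ × ℝ | 0 < p.1 ∧ 0 < p.2.1 ∧ 0 < p.2.2} :=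
  theorem4p2_general Ω D hΩ.isOpen hΩ.isBounded hD hDΩ L γ hγ
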